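/- **Theorem.** Let $n\ge 0$, $k\ge 1$ be integers and $2\le m\le\infty$. Let $N\subset\mathbb C^n$ be an open set with a defining function $\rho:\mathbb C^n\to\mathbb R$ of class $C^m$, that is, $N=\{\rho<0\}$ and $d\rho\neq 0$ on $\partial N$. Assume that $N$ is strictly $k$-pseudoconvex: for every $p\in\partial N$ and every $k$-dimensional complex subspace $U$ of the complex tangent space $W_p=\{v\in\mathbb C^n:\sum_j\frac{\partial\rho}{\partial z_j}(p)v_j=0\}$, the trace over $U$ (in a unitary basis of $U$) of the Levi form $\sum_{j,l}\frac{\partial^2\rho}{\partial z_j\partial\bar z_l}(p)\,v_j\bar v_l$ is positive. Let $D$ be the open unit disk in $\mathbb C$ and let $f:\overline D\to\mathbb C^n$ be $C^\infty$ up to the boundary, with $f(D)\subset N$ and $f(\partial D)\subset\partial N$. Let $E''(f)=\int_D|\partial f/\partial\bar z|^2\,dx\,dy$ be the $\bar\partial$-energy. A variation of $f$ is a family $f_t:\overline D\to\mathbb C^n$, $|t|<\varepsilon$, of class $C^m$ jointly in $(t,z)\in(-\varepsilon,\varepsilon)\times\overline D$, with $f_0=f$, $f_t(D)\subset N$ and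 $f_t(\partial D)\subset\partial N$ for all $t$; its variation field is $V=\frac{\partial f_t}{\partial t}\big|_{t=0}$. Suppose that $f$ is a critical point of $E''$, that is, $\frac{d}{dt}\big|_{t=0}E''(f_t)=0$ for every variation of $f$. If $f$ is not holomorphic on $D$, then the Morse index of $f$ for $E''$ is at least $n-k$. Here the Morse index is the supremum in $\{0,1,2,\dots,\infty\}$ of the dimensions of the real vector spaces $S$ of variation fields on which the second variation is negative definite: every nonzero $V\in S$ is the variation field of some variation of $f$, and $\frac{d^2}{dt^2}\big|_{t=0}E''(f_t)<0$ for every variation $f_t$ of $f$ with variation field $V$. -/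

import Mathlib

open scoped ContDiff

noncomputable section

namespace DbarDisk

/-- Complex Euclidean space `ℂⁿ` with its Hermitian inner product and norm. -/
abbrev Cn (n : ℕ) : Type := EuclideanSpace ℂ (Fin n)

/-- `ρ` is a defining function of class `C^m` of the open set `N ⊆ ℂⁿ`:
`N = {ρ < 0}` and `dρ ≠ 0` at every point of the boundary of `N`. -/
structure IsDefiningFunction {n : ℕ} (m : ℕ∞) (ρ : Cn n → ℝ) (N : Set (Cn n)) : Prop where
  contDiff : ContDiff ℝ m ρ
  eq_sublevel : N = {z | ρ z < 0}
  fderiv_ne_zero : ∀ p ∈ frontier N, fderiv ℝ ρ p ≠ 0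

/-- The complex tangent space at `p` of the level set of `ρ`: the vectors `v` with
`∑ j, (∂ρ/∂z_j)(p) v_j = 0`.  As `∑ j, (∂ρ/∂z_j) v_j = (dρ(v) - i dρ(i v)) / 2`, this means
that both `v` and `i v` are annihilated by the real differential `dρ`. -/
def complexTangentSpace {n : ℕ} (ρ : Cn n → ℝ) (p : Cn n) : Submodule ℂ (Cn n) where
  carrier := {v | fderiv ℝ ρ p v = 0 ∧ fderiv ℝ ρ p (Complex.I • v) = 0}
  zero_mem' := by simp
  add_mem' := by
    rintro v w ⟨hv, hv'⟩ ⟨hw, hw'⟩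
    simp [smul_add, hv, hv', hw, hw']
  smul_mem' := by
    rintro c v ⟨hv, hv'⟩
    have key : ∀ a b : ℝ, fderiv ℝ ρ p (((a : ℂ) + (b : ℂ) * Complex.I) • v) = 0 := by
      intro a b
      have e : ((a : ℂ) + (b : ℂ) * Complex.I) • v = a • v + b • (Complex.I • v) := by
        rw [add_smul, mul_smul, Complex.coe_smul, Complex.coe_smul]
      rw [e, map_add, map_smul, map_smul, hv, hv']
      simp
    refine ⟨?_, ?_⟩
    · have := key c.re c.im
      rwa [Complex.re_add_im] at this
    · have := key (-c.im) c.re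
      rw [smul_smul]
      convert this using 3
      apply Complex.ext <;> simp

/-- The Levi form `∑ j k, (∂²ρ/∂z_j ∂z̄_k)(p) v_j v̄_k` of `ρ`, written with the real Hessian
as `(D²ρ(v, v) + D²ρ(i v, i v)) / 4`. -/
def leviForm {n : ℕ} (ρ : Cn n → ℝ) (p v : Cn n) : ℝ :=
  (fderiv ℝ (fderiv ℝ ρ) p v v +
    fderiv ℝ (fderiv ℝ ρ) p (Complex.I • v) (Complex.I • v)) / 4

/-- `N` is strictly `k`-pseudoconvex with boundary of class `C^m`: it has a `C^m` defining function
whose Levi form has positive trace on every `k`-dimensional complex subspace `U` of the complex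
tangent space at every boundary point, the trace being taken in a unitary basis of `U`. -/
def IsStrictlyKPseudoconvex {n : ℕ} (m : ℕ∞) (k : ℕ) (N : Set (Cn n)) : Prop :=
  ∃ ρ : Cn n → ℝ, IsDefiningFunction m ρ N ∧
    ∀ p ∈ frontier N, ∀ U : Submodule ℂ (Cn n), U ≤ complexTangentSpace ρ p →
      ∀ b : OrthonormalBasis (Fin k) ℂ U, 0 < ∑ i, leviForm ρ p (b i : Cn n)

/-- `∂f/∂z̄ = (∂f/∂x + i ∂f/∂y) / 2`. -/
def dbar {n : ℕ} (f : ℂ → Cn n) (z : ℂ) : Cn n :=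
  (1 / 2 : ℂ) • (fderiv ℝ f z 1 + Complex.I • fderiv ℝ f z Complex.I)

/-- The `∂̄`-energy of a map on the unit disk. -/
def dbarEnergy {n : ℕ} (f : ℂ → Cn n) : ℝ :=
  ∫ z in Metric.ball (0 : ℂ) 1, ‖dbar f z‖ ^ 2

/-- A map of the disk into `N`, smooth up to the boundary, with `f(∂D) ⊆ ∂N`. -/
structure IsDisk {n : ℕ} (N : Set (Cn n)) (f : ℂ → Cn n) : Prop where
  smooth : ContDiffOn ℝ ∞ f (Metric.closedBall 0 1)
  mapsTo_interior : Set.MapsTo f (Metric.ball 0 1) N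
  mapsTo_boundary : Set.MapsTo f (Metric.sphere 0 1) (frontier N)

/-- `F t`, `|t| < ε`, is a variation of `f` of class `C^m`, jointly in the parameter and the point
of the closed disk, through maps of the disk into `N` with boundary in `∂N`. -/
structure IsVariation {n : ℕ} (m : ℕ∞) (N : Set (Cn n)) (f : ℂ → Cn n) (ε : ℝ)
    (F : ℝ → ℂ → Cn n) : Prop where
  pos : 0 < ε
  contDiffOn : ContDiffOn ℝ m (fun q : ℝ × ℂ => F q.1 q.2)
    (Set.Ioo (-ε) ε ×ˢ Metric.closedBall (0 : ℂ) 1)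
  initial : Set.EqOn (F 0) f (Metric.closedBall 0 1)
  mapsTo_interior : ∀ t ∈ Set.Ioo (-ε) ε, Set.MapsTo (F t) (Metric.ball 0 1) N
  mapsTo_boundary : ∀ t ∈ Set.Ioo (-ε) ε, Set.MapsTo (F t) (Metric.sphere 0 1) (frontier N)

/-- The variation field `∂F/∂t` at `t = 0`, a function on the closed disk. -/
def variationField {n : ℕ} (F : ℝ → ℂ → Cn n) : Metric.closedBall (0 : ℂ) 1 → Cn n :=
  fun z => deriv (fun t => F t z) 0

/-- `f` is a critical point of the `∂̄`-energy with free boundary on `∂N`. -/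
def IsCritical {n : ℕ} (m : ℕ∞) (N : Set (Cn n)) (f : ℂ → Cn n) : Prop :=
  ∀ (ε : ℝ) (F : ℝ → ℂ → Cn n), IsVariation m N f ε F →
    HasDerivAt (fun t => dbarEnergy (F t)) 0 0

/-- The second variation of the `∂̄`-energy at `f` is negative definite on the real vector space
`S` of fields along `f`: every nonzero `V ∈ S` is a variation field, and the second derivative of
the energy is negative along each variation of `f` with field `V`. -/
def IsNegativeDefiniteOn {n : ℕ} (m : ℕ∞) (N : Set (Cn n)) (f : ℂ → Cn n)
    (S : Submodule ℝ (Metric.closedBall (0 : ℂ) 1 → Cn n)) : Prop :=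
  ∀ V ∈ S, V ≠ 0 →
    (∃ (ε : ℝ) (F : ℝ → ℂ → Cn n), IsVariation m N f ε F ∧ variationField F = V) ∧
    ∀ (ε : ℝ) (F : ℝ → ℂ → Cn n), IsVariation m N f ε F → variationField F = V →
      deriv (deriv (fun t => dbarEnergy (F t))) 0 < 0

/-- The Morse index of `f` for the `∂̄`-energy: the maximal (real, possibly infinite) dimension of a
space of variation fields on which the second variation is negative definite. -/
def morseIndex {n : ℕ} (m : ℕ∞) (N : Set (Cn n)) (f : ℂ → Cn n) : ℕ∞ :=
  ⨆ (S : Submodule ℝ (Metric.closedBall (0 : ℂ) 1 → Cn n)) (_ : IsNegativeDefiniteOn m N f S),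
    Cardinal.toENat (Module.rank ℝ S)

end DbarDisk

end

open scoped ContDiff

noncomputable section

namespace DbarDisk

/-! Write h = ∂f/∂z̄, with ⟨·,·⟩ conjugate-linear in its first slot. Interior variations show that a
critical f is harmonic, so ⟨h, v⟩ is holomorphic for constant v. Variations along the circle give
Re(z⟨h, V⟩) = μ dρ(V) with a real multiplier μ (`delOn_dbarOn_eq_zero`, `bdryPairing_eq`).
Differentiating ρ(f_t) = 0 twice on the circle eliminates the acceleration, and the second variation
becomes 2∫|∂̄V|² − ∮ μ D²ρ(V, V) dθ (`IsVariation.second_variation_eq`). Good negative directions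
are thus holomorphic fields, tangent to ∂N along the circle, with positive boundary integral.

The multiplier is positive somewhere (`exists_multiplier_pos`). Test the boundary condition with the
radial derivative f_r = z f_z + z̄ h: Green's formula removes the first part, so ∮ μ dρ(f_r) = ∮
|h|², while dρ(f_r) ≥ 0 because f(D) lies in N. If μ ≤ 0 throughout, then h vanishes on the circle,
hence on the disk, and f is holomorphic.

Let μ(z₀) > 0 and c = h(z₀). The boundary condition makes the Hermitian complement of c complex
tangent at f(z₀). For k < n its dimension n − 1 is at least k, so it contains some w with positive
Levi form. The field V₀ = ⟨h, c⟩w − ⟨h, w⟩c is holomorphic and orthogonal to h, hence tangent along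
the circle, and it equals |c|²w at z₀. For scalar η, D²ρ(ηV₀, ηV₀) = 2L(V₀)|η|² + Re(η²S(V₀)), with
L the Levi form. Take η = p(z) z^{J(j+1)} with |p| peaked at z₀ and J large: by Riemann–Lebesgue the
η² terms and the cross terms become negligible, and a positive definite form remains
(`exists_holomorphic_pos`). The number of functions η is arbitrary; n − k of them are used.

The variations constructed here keep ρ(f_t(z)) fixed for z near the circle, so ηV₀ must first be
corrected by a field that vanishes on the circle. Confined to a layer of width about δ, the
correction has ∂̄-energy tending to 0 with δ (`tendsto_integral_dbarOn_tangentField`), and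
negativity survives. -/

open Set MeasureTheory Metric Filter Topology

/-! ### Wirtinger derivatives up to the boundary and Green's formula on the disk. -/

/-- The operator `∂/∂z̄` on maps of the closed unit disk, differentiable up to the boundary. -/
def dbarOn {E : Type*} [NormedAddCommGroup E] [NormedSpace ℝ E] [NormedSpace ℂ E]
    (u : ℂ → E) (z : ℂ) : E :=
  (1 / 2 : ℂ) • (fderivWithin ℝ u (closedBall 0 1) z 1 +
    Complex.I • fderivWithin ℝ u (closedBall 0 1) z Complex.I)

/-- The operator `∂/∂z` on maps of the closed unit disk, differentiable up to the boundary. -/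
def delOn {E : Type*} [NormedAddCommGroup E] [NormedSpace ℝ E] [NormedSpace ℂ E]
    (u : ℂ → E) (z : ℂ) : E :=
  (1 / 2 : ℂ) • (fderivWithin ℝ u (closedBall 0 1) z 1 -
    Complex.I • fderivWithin ℝ u (closedBall 0 1) z Complex.I)

/-- Disks are smooth only on the closed disk, so boundary values of derivatives are taken within it;
unique differentiability makes them well determined. -/
theorem uniqueDiffOn_closedDisk : UniqueDiffOn ℝ (closedBall (0 : ℂ) 1) :=
  uniqueDiffOn_convex (convex_closedBall _ _) (by simp [interior_closedBall])

theorem fderivWithin_closedDisk {E : Type*} [NormedAddCommGroup E] [NormedSpace ℝ E]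
    (u : ℂ → E) {z : ℂ} (hz : z ∈ ball (0 : ℂ) 1) :
    fderivWithin ℝ u (closedBall 0 1) z = fderiv ℝ u z :=
  fderivWithin_of_mem_nhds (Filter.mem_of_superset (isOpen_ball.mem_nhds hz) ball_subset_closedBall)

theorem dbarOn_eq_dbar {n : ℕ} (u : ℂ → Cn n) {z : ℂ} (hz : z ∈ ball (0 : ℂ) 1) :
    dbarOn u z = dbar u z := by
  simp only [dbarOn, dbar, fderivWithin_closedDisk u hz]

theorem contDiffOn_dbarOn {E : Type*} [NormedAddCommGroup E] [NormedSpace ℝ E] [NormedSpace ℂ E]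
    [IsScalarTower ℝ ℂ E]
    {u : ℂ → E} {m k : ℕ∞ω} (hu : ContDiffOn ℝ m u (closedBall 0 1)) (hk : k + 1 ≤ m) :
    ContDiffOn ℝ k (dbarOn u) (closedBall 0 1) := by
  have h := hu.fderivWithin uniqueDiffOn_closedDisk hk
  unfold dbarOn
  exact ((h.clm_apply contDiffOn_const).add
    ((h.clm_apply contDiffOn_const).const_smul Complex.I)).const_smul (1 / 2 : ℂ)

theorem contDiffOn_delOn {E : Type*} [NormedAddCommGroup E] [NormedSpace ℝ E] [NormedSpace ℂ E]
    [IsScalarTower ℝ ℂ E]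
    {u : ℂ → E} {m k : ℕ∞ω} (hu : ContDiffOn ℝ m u (closedBall 0 1)) (hk : k + 1 ≤ m) :
    ContDiffOn ℝ k (delOn u) (closedBall 0 1) := by
  have h := hu.fderivWithin uniqueDiffOn_closedDisk hk
  unfold delOn
  exact ((h.clm_apply contDiffOn_const).sub
    ((h.clm_apply contDiffOn_const).const_smul Complex.I)).const_smul (1 / 2 : ℂ)

theorem integral_disk_polar {E : Type*} [NormedAddCommGroup E] [NormedSpace ℝ E] (u : ℂ → E) :
    ∫ z in ball (0 : ℂ) 1, u z =
      ∫ p in Ioo (0 : ℝ) 1 ×ˢ Ioo (-Real.pi) Real.pi,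
        p.1 • u (p.1 * Complex.exp (p.2 * Complex.I)) := by
  rw [← integral_indicator measurableSet_ball, ← Complex.integral_comp_polarCoord_symm]
  rw [show polarCoord.target = Ioi (0 : ℝ) ×ˢ Ioo (-Real.pi) Real.pi from rfl]
  rw [← integral_indicator (measurableSet_Ioi.prod measurableSet_Ioo),
    ← integral_indicator (measurableSet_Ioo.prod measurableSet_Ioo)]
  congr 1
  ext p
  have e : Complex.polarCoord.symm p = p.1 * Complex.exp (p.2 * Complex.I) := by
    rw [Complex.polarCoord_symm_apply, Complex.exp_mul_I]
    simp
  have en : ‖(p.1 * Complex.exp (p.2 * Complex.I) : ℂ)‖ = |p.1| := by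
    simp [Complex.norm_exp_ofReal_mul_I]
  by_cases hp : p ∈ Ioo (0 : ℝ) 1 ×ˢ Ioo (-Real.pi) Real.pi
  · rw [indicator_of_mem hp, indicator_of_mem (by exact ⟨hp.1.1, hp.2⟩), e, indicator_of_mem]
    rw [mem_ball_zero_iff, en, abs_of_pos hp.1.1]; exact hp.1.2
  · rw [indicator_of_notMem hp]
    by_cases hp' : p ∈ Ioi (0 : ℝ) ×ˢ Ioo (-Real.pi) Real.pi
    · rw [indicator_of_mem hp', e, indicator_of_notMem, smul_zero]
      rw [mem_ball_zero_iff, en, abs_of_pos hp'.1]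
      exact fun h => hp ⟨⟨hp'.1, h⟩, hp'.2⟩
    · rw [indicator_of_notMem hp']

/-- The integral over the unit circle with respect to the angle. -/
def circleInt {E : Type*} [NormedAddCommGroup E] [NormedSpace ℝ E] (u : ℂ → E) : E :=
  ∫ θ in (-Real.pi)..Real.pi, u (Complex.exp (θ * Complex.I))

/-- The divergence theorem on the rectangle of polar coordinates, based on 2∂̄ = e^{iθ}(∂_r +
(i/r)∂_θ). -/
theorem integral_dbarOn {u : ℂ → ℂ} (hu : ContDiffOn ℝ 1 u (closedBall 0 1)) :
    ∫ z in ball (0 : ℂ) 1, dbarOn u z = (1 / 2 : ℂ) * circleInt (fun z => z * u z) := by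
  have hπ := Real.pi_pos
  let e : ℝ × ℝ → ℂ := fun p => Complex.exp (p.2 * Complex.I)
  have hece : Continuous e := by fun_prop
  have hmaps : ∀ p ∈ Icc (0 : ℝ) 1 ×ˢ Icc (-Real.pi) Real.pi, (p.1 : ℂ) * e p ∈ closedBall (0 : ℂ) 1 := by
    intro p hp
    simp [e, Complex.norm_exp_ofReal_mul_I, abs_of_nonneg hp.1.1, hp.1.2]
  have hmaps' : ∀ p ∈ Ioo (0 : ℝ) 1 ×ˢ Ioo (-Real.pi) Real.pi, (p.1 : ℂ) * e p ∈ ball (0 : ℂ) 1 := by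
    intro p hp
    simp [e, Complex.norm_exp_ofReal_mul_I, abs_of_pos hp.1.1, hp.1.2]
  have hcu : ContinuousOn (fun p : ℝ × ℝ => u (p.1 * e p)) (Icc (0 : ℝ) 1 ×ˢ Icc (-Real.pi) Real.pi) :=
    hu.continuousOn.comp (by fun_prop) hmaps
  have hdb : ContinuousOn (dbarOn u) (closedBall 0 1) :=
    (contDiffOn_dbarOn (k := 0) hu (by norm_num)).continuousOn
  let D : ℝ × ℝ → ℂ →L[ℝ] ℂ := fun p => fderiv ℝ u (p.1 * e p)
  let pe : ℝ × ℝ → ℝ × ℝ →L[ℝ] ℂ := fun p =>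
    (e p) • ((Complex.I • Complex.ofRealCLM).comp (ContinuousLinearMap.snd ℝ ℝ ℝ))
  have hpe : ∀ p, HasFDerivAt e (pe p) p := by
    intro p
    have h1 : HasFDerivAt (fun p : ℝ × ℝ => (p.2 : ℂ) * Complex.I)
        ((Complex.I • Complex.ofRealCLM).comp (ContinuousLinearMap.snd ℝ ℝ ℝ)) p := by
      refine ((((Complex.I • Complex.ofRealCLM).comp
        (ContinuousLinearMap.snd ℝ ℝ ℝ)).hasFDerivAt (x := p))).congr_of_eventuallyEq ?_
      filter_upwards with q
      simp [mul_comm]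
    exact h1.cexp
  let pr : ℝ × ℝ → ℝ × ℝ →L[ℝ] ℂ := fun p => Complex.ofRealCLM.comp (ContinuousLinearMap.fst ℝ ℝ ℝ)
  have hpr : ∀ p, HasFDerivAt (fun p : ℝ × ℝ => (p.1 : ℂ)) (pr p) p := fun p =>
    (Complex.ofRealCLM.comp (ContinuousLinearMap.fst ℝ ℝ ℝ)).hasFDerivAt
  have hpu : ∀ p ∈ Ioo (0 : ℝ) 1 ×ˢ Ioo (-Real.pi) Real.pi,
      HasFDerivAt (fun p : ℝ × ℝ => u (p.1 * e p)) ((D p).comp ((p.1 : ℂ) • pe p + e p • pr p)) p := by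
    intro p hp
    have h1 : HasFDerivAt u (D p) (p.1 * e p) := by
      apply DifferentiableAt.hasFDerivAt
      exact ((hu.differentiableOn (by norm_num)).mono ball_subset_closedBall).differentiableAt
        (isOpen_ball.mem_nhds (hmaps' p hp))
    exact h1.comp p ((hpr p).mul (hpe p))
  -- The vector field (r e^{iθ}u, i e^{iθ}u) has divergence 2r ∂̄u: the two undifferentiated terms
  -- e^{iθ}u cancel.
  let F : ℝ × ℝ → ℂ := fun p => (p.1 : ℂ) * (e p * u (p.1 * e p))
  let G : ℝ × ℝ → ℂ := fun p => Complex.I * (e p * u (p.1 * e p))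
  let W : ℝ × ℝ → ℝ × ℝ →L[ℝ] ℂ := fun p =>
    e p • ((D p).comp ((p.1 : ℂ) • pe p + e p • pr p)) + u (p.1 * e p) • pe p
  let F' : ℝ × ℝ → ℝ × ℝ →L[ℝ] ℂ := fun p => (p.1 : ℂ) • W p + (e p * u (p.1 * e p)) • pr p
  let G' : ℝ × ℝ → ℝ × ℝ →L[ℝ] ℂ := fun p => Complex.I • W p
  have hW : ∀ p ∈ Ioo (0 : ℝ) 1 ×ˢ Ioo (-Real.pi) Real.pi,
      HasFDerivAt (fun p => e p * u (p.1 * e p)) (W p) p := fun p hp => (hpe p).mul (hpu p hp)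
  have hdiv : ∀ p ∈ Ioo (0 : ℝ) 1 ×ˢ Ioo (-Real.pi) Real.pi,
      F' p (1, 0) + G' p (0, 1) = 2 * (p.1 • dbarOn u (p.1 * e p)) := by
    intro p hp
    have e1 : ∀ a b : ℝ, D p ((a : ℂ) + b * Complex.I) = a * D p 1 + b * D p Complex.I := by
      intro a b
      have : (a : ℂ) + b * Complex.I = a • (1 : ℂ) + b • Complex.I := by simp
      rw [this, map_add, map_smul, map_smul]; simp
    have e2 : D p (e p) = (Real.cos p.2 : ℂ) * D p 1 + Real.sin p.2 * D p Complex.I := by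
      rw [← e1]; congr 1; simp only [e]; rw [Complex.exp_mul_I]; simp
    have e3 : D p (p.1 * (e p * Complex.I)) =
        p.1 * (-(Real.sin p.2 : ℂ) * D p 1 + Real.cos p.2 * D p Complex.I) := by
      have : (p.1 * (e p * Complex.I) : ℂ) = (p.1 : ℝ) • (((-Real.sin p.2 : ℝ) : ℂ) + (Real.cos p.2 : ℝ) * Complex.I) := by
        simp only [e]; rw [Complex.exp_mul_I]; simp; ring_nf; simp; ring
      rw [this, map_smul, e1]; simp; ring
    have e4 : e p = Real.cos p.2 + Real.sin p.2 * Complex.I := by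
      simp only [e]; rw [Complex.exp_mul_I]; simp
    simp only [F', G', W, pe, pr, dbarOn, fderivWithin_closedDisk u (hmaps' p hp)]
    change _ = 2 * (p.1 • ((1 / 2 : ℂ) • (D p 1 + Complex.I • D p Complex.I)))
    simp [e2, e3]
    rw [e4]
    push_cast
    have hI : Complex.I ^ 2 = -1 := Complex.I_sq
    have hcs : Complex.cos (p.2 : ℂ) ^ 2 = 1 - Complex.sin (p.2 : ℂ) ^ 2 := by
      linear_combination Complex.sin_sq_add_cos_sq (p.2 : ℂ)
    ring_nf
    rw [hI]
    have hI3 : Complex.I ^ 3 = - Complex.I := by rw [pow_succ, hI]; ring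
    try rw [hI3]
    ring_nf
    rw [hcs]
    ring
  have hcW : ContinuousOn (fun p => 2 * (p.1 • dbarOn u (p.1 * e p))) (Icc (0 : ℝ) 1 ×ˢ Icc (-Real.pi) Real.pi) := by
    exact continuousOn_const.mul (continuous_fst.continuousOn.smul
      (hdb.comp (by fun_prop) hmaps))
  have hIcc : Icc ((0 : ℝ), -Real.pi) (1, Real.pi) = Icc (0 : ℝ) 1 ×ˢ Icc (-Real.pi) Real.pi := by
    rw [Icc_prod_eq]
  have hae : (Ioo (0 : ℝ) 1 ×ˢ Ioo (-Real.pi) Real.pi : Set (ℝ × ℝ)) =ᵐ[volume]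
      Icc ((0 : ℝ), -Real.pi) (1, Real.pi) := by
    rw [hIcc]
    exact Measure.set_prod_ae_eq Ioo_ae_eq_Icc Ioo_ae_eq_Icc
  have hmeas : MeasurableSet (Ioo (0 : ℝ) 1 ×ˢ Ioo (-Real.pi) Real.pi : Set (ℝ × ℝ)) :=
    measurableSet_Ioo.prod measurableSet_Ioo
  have hi0 : IntegrableOn (fun p : ℝ × ℝ => 2 * (p.1 • dbarOn u (p.1 * e p)))
      (Ioo (0 : ℝ) 1 ×ˢ Ioo (-Real.pi) Real.pi) := by
    rw [integrableOn_congr_set_ae hae]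
    exact (hIcc ▸ hcW).integrableOn_compact isCompact_Icc
  have hi : IntegrableOn (fun p => F' p (1, 0) + G' p (0, 1))
      (Icc ((0 : ℝ), -Real.pi) (1, Real.pi)) := by
    rw [← integrableOn_congr_set_ae hae]
    exact hi0.congr_fun (fun p hp => (hdiv p hp).symm) hmeas
  have key := integral_divergence_prod_Icc_of_hasFDerivAt_off_countable_of_le F G F' G'
    (0, -Real.pi) (1, Real.pi) ⟨by norm_num, by simp only; linarith⟩ ∅ countable_empty
    (by
      rw [hIcc]
      exact (Complex.continuous_ofReal.comp continuous_fst).continuousOn.mul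
        (hece.continuousOn.mul hcu))
    (by rw [hIcc]; exact continuousOn_const.mul (hece.continuousOn.mul hcu))
    (fun p hp => (hpr p).mul (hW p hp.1)) (fun p hp => (hW p hp.1).const_mul _) hi
  rw [← setIntegral_congr_set hae, setIntegral_congr_fun hmeas hdiv, integral_const_mul] at key
  rw [integral_disk_polar]
  -- The sides θ = ±π cancel by periodicity, and the side r = 0 is killed by the factor r in `F`;
  -- only r = 1 contributes.
  have hper : ∀ x : ℝ, G (x, Real.pi) = G (x, -Real.pi) := by
    intro x
    have : e (x, Real.pi) = e (x, -Real.pi) := by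
      simp [e, Complex.exp_neg, Complex.exp_pi_mul_I]
    simp only [G, this]
  have key2 : (2 : ℂ) * ∫ p in Ioo (0 : ℝ) 1 ×ˢ Ioo (-Real.pi) Real.pi,
      p.1 • dbarOn u (p.1 * Complex.exp (p.2 * Complex.I)) = circleInt fun z => z * u z := by
    refine key.trans ?_
    simp only [hper, F, sub_self, zero_add, circleInt, e]
    simp
  rw [← key2]; ring

theorem fderivWithin_inner {n : ℕ} {x y : ℂ → Cn n} {z : ℂ}
    (hz : z ∈ closedBall (0 : ℂ) 1)
    (hx : DifferentiableWithinAt ℝ x (closedBall 0 1) z)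
    (hy : DifferentiableWithinAt ℝ y (closedBall 0 1) z) (v : ℂ) :
    fderivWithin ℝ (fun z => inner ℂ (x z) (y z)) (closedBall 0 1) z v =
      inner ℂ (x z) (fderivWithin ℝ y (closedBall 0 1) z v) +
        inner ℂ (fderivWithin ℝ x (closedBall 0 1) z v) (y z) :=
  by
  rw [(hx.hasFDerivWithinAt.inner ℂ hy.hasFDerivWithinAt).fderivWithin
    (uniqueDiffOn_closedDisk z hz)]
  simp

/-- Conjugate-linearity in the first slot turns ∂̄ into ∂ there. -/
theorem dbarOn_inner {n : ℕ} {x y : ℂ → Cn n} {z : ℂ} (hz : z ∈ closedBall (0 : ℂ) 1)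
    (hx : DifferentiableWithinAt ℝ x (closedBall 0 1) z)
    (hy : DifferentiableWithinAt ℝ y (closedBall 0 1) z) :
    dbarOn (fun z => inner ℂ (x z) (y z)) z =
      inner ℂ (x z) (dbarOn y z) + inner ℂ (delOn x z) (y z) := by
  simp only [dbarOn, delOn, fderivWithin_inner hz hx hy, inner_smul_right, inner_smul_left,
    inner_add_right, inner_sub_left, smul_eq_mul]
  have h2 : (starRingEnd ℂ) 2 = 2 := Complex.conj_ofReal 2
  simp [h2]
  ring

theorem circleInt_continuousOn {E : Type*} [NormedAddCommGroup E] {u : ℂ → E}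
    (hu : ContinuousOn u (sphere 0 1)) :
    Continuous fun θ : ℝ => u (Complex.exp (θ * Complex.I)) := by
  refine hu.comp_continuous (by fun_prop) fun θ => ?_
  simp [Complex.norm_exp_ofReal_mul_I]

/-- Integration by parts for `∂/∂z̄` on the unit disk. -/
theorem integral_inner_dbarOn {n : ℕ} {x y : ℂ → Cn n}
    (hx : ContDiffOn ℝ 1 x (closedBall 0 1)) (hy : ContDiffOn ℝ 1 y (closedBall 0 1)) :
    ∫ z in ball (0 : ℂ) 1, inner ℂ (x z) (dbarOn y z) =
      (1 / 2 : ℂ) * circleInt (fun z => z * inner ℂ (x z) (y z)) -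
        ∫ z in ball (0 : ℂ) 1, inner ℂ (delOn x z) (y z) := by
  have h := integral_dbarOn (u := fun z => inner ℂ (x z) (y z)) (hx.inner ℂ hy)
  rw [← h]
  have hc1 : ContinuousOn (fun z => inner ℂ (x z) (dbarOn y z)) (closedBall (0 : ℂ) 1) :=
    hx.continuousOn.inner (contDiffOn_dbarOn (k := 0) hy (by norm_num)).continuousOn
  have hc2 : ContinuousOn (fun z => inner ℂ (delOn x z) (y z)) (closedBall (0 : ℂ) 1) :=
    (contDiffOn_delOn (k := 0) hx (by norm_num)).continuousOn.inner hy.continuousOn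
  have hi1 := (hc1.integrableOn_compact (isCompact_closedBall 0 1) (μ := volume)).mono_set
    ball_subset_closedBall
  have hi2 := (hc2.integrableOn_compact (isCompact_closedBall 0 1) (μ := volume)).mono_set
    ball_subset_closedBall
  rw [setIntegral_congr_fun measurableSet_ball fun z hz => dbarOn_inner
    (ball_subset_closedBall hz) (hx.differentiableOn (by norm_num) z (ball_subset_closedBall hz))
    (hy.differentiableOn (by norm_num) z (ball_subset_closedBall hz)), integral_add hi1 hi2]
  ring

/-! ### Moving points while keeping the value of ρ. -/

section ImplicitHeight

variable {E : Type*} [NormedAddCommGroup E] [NormedSpace ℝ E] [CompleteSpace E]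

/-- The implicit function theorem in the scalar s, whose partial derivative is dρ applied to the
transverse direction. -/
theorem exists_local_height {m : ℕ∞} (hm : m ≠ 0) {ρ : E → ℝ} (hρ : ContDiff ℝ m ρ)
    (y₀ : E × E × E) (s₀ : ℝ)
    (hd : fderiv ℝ ρ (y₀.1 + y₀.2.2 + s₀ • y₀.2.1) y₀.2.1 ≠ 0)
    (h₀ : ρ (y₀.1 + y₀.2.2 + s₀ • y₀.2.1) = ρ y₀.1) :
    ∃ τ : E × E × E → ℝ, ContDiffAt ℝ m τ y₀ ∧ τ y₀ = s₀ ∧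
      ∀ᶠ y in 𝓝 y₀, ρ (y.1 + y.2.2 + τ y • y.2.1) = ρ y.1 := by
  have hm' : (m : ℕ∞ω) ≠ 0 := by exact_mod_cast hm
  let Φ : (E × E × E) × ℝ → ℝ := fun q => ρ (q.1.1 + q.1.2.2 + q.2 • q.1.2.1) - ρ q.1.1
  have hΦ : ContDiff ℝ m Φ := by
    refine (hρ.comp ?_).sub (hρ.comp ?_) <;> fun_prop
  have hΦa : ContDiffAt ℝ m Φ (y₀, s₀) := hΦ.contDiffAt
  have hlin : HasFDerivAt (fun s : ℝ => Φ (y₀, s))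
      ((fderiv ℝ ρ (y₀.1 + y₀.2.2 + s₀ • y₀.2.1)).comp
        ((ContinuousLinearMap.id ℝ ℝ).smulRight y₀.2.1)) s₀ := by
    have h1 : HasFDerivAt ρ (fderiv ℝ ρ (y₀.1 + y₀.2.2 + s₀ • y₀.2.1))
        (y₀.1 + y₀.2.2 + s₀ • y₀.2.1) := (hρ.differentiable hm').differentiableAt.hasFDerivAt
    have h2 : HasFDerivAt (fun s : ℝ => y₀.1 + y₀.2.2 + s • y₀.2.1)
        ((ContinuousLinearMap.id ℝ ℝ).smulRight y₀.2.1) s₀ :=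
      ((hasFDerivAt_id s₀).smul_const y₀.2.1).const_add _
    have h3 : HasFDerivAt (fun s : ℝ => ρ (y₀.1 + y₀.2.2 + s • y₀.2.1)) _ s₀ := h1.comp s₀ h2
    exact h3.sub_const (ρ y₀.1)
  have hpart : fderiv ℝ Φ (y₀, s₀) ∘L .inr ℝ (E × E × E) ℝ =
      (fderiv ℝ ρ (y₀.1 + y₀.2.2 + s₀ • y₀.2.1)).comp
        ((ContinuousLinearMap.id ℝ ℝ).smulRight y₀.2.1) := by
    have h3 : HasFDerivAt (fun s : ℝ => (y₀, s)) (.inr ℝ (E × E × E) ℝ) s₀ :=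
      hasFDerivAt_prodMk_right y₀ s₀
    exact ((hΦ.differentiable hm').differentiableAt.hasFDerivAt.comp s₀ h3).unique hlin
  set a := fderiv ℝ ρ (y₀.1 + y₀.2.2 + s₀ • y₀.2.1) y₀.2.1 with ha
  have hinv : (fderiv ℝ Φ (y₀, s₀) ∘L .inr ℝ (E × E × E) ℝ).IsInvertible := by
    refine ⟨ContinuousLinearEquiv.unitsEquivAut ℝ (Units.mk0 a hd), ?_⟩
    rw [hpart]
    ext
    simp [ha]
  have hu : Φ (y₀, s₀) = 0 := by simp [Φ, h₀]
  refine ⟨hΦa.implicitFunction hm' hinv, hΦa.contDiffAt_implicitFunction hm' hinv,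
    hΦa.implicitFunction_apply_self hm' hinv, ?_⟩
  filter_upwards [hΦa.eventually_apply_implicitFunction hm' hinv] with y hy
  rw [hu] at hy
  exact sub_eq_zero.1 hy

/-- Near a compact set of pairs `(p, x)` with `dρ_p(x) > 0`, a displacement `v` of `p` can be
corrected by a multiple `σ` of `x` so that the value of `ρ` is kept, with `σ` as smooth as `ρ`. -/
theorem exists_height {m : ℕ∞} (hm : m ≠ 0) {ρ : E → ℝ} (hρ : ContDiff ℝ m ρ)
    {K : Set (E × E)} (hK : IsCompact K) (hpos : ∀ κ ∈ K, 0 < fderiv ℝ ρ κ.1 κ.2) :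
    ∃ (O : Set (E × E × E)) (σ : E × E × E → ℝ), IsOpen O ∧ ContDiffOn ℝ m σ O ∧
      (∀ κ ∈ K, (κ.1, κ.2, (0 : E)) ∈ O ∧ σ (κ.1, κ.2, 0) = 0) ∧
      ∀ y ∈ O, ρ (y.1 + y.2.2 + σ y • y.2.1) = ρ y.1 ∧
        0 < fderiv ℝ ρ (y.1 + y.2.2 + σ y • y.2.1) y.2.1 := by
  classical
  have hm' : (m : ℕ∞ω) ≠ 0 := by exact_mod_cast hm
  have hcd : Continuous (fderiv ℝ ρ) := hρ.continuous_fderiv hm'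
  let Θ : (E × E × E) × ℝ → ℝ := fun q => fderiv ℝ ρ (q.1.1 + q.1.2.2 + q.2 • q.1.2.1) q.1.2.1
  have hΘ : Continuous Θ := by
    refine (hcd.comp ?_).clm_apply ?_ <;> fun_prop
  let K' : Set (E × E × E) := (fun κ : E × E => (κ.1, κ.2, (0 : E))) '' K
  have hK' : IsCompact K' := hK.image (by fun_prop)
  -- By compactness the s-derivative is positive for all base data in one neighbourhood and all s in
  -- one interval. Roots in this interval are then unique, which glues the local implicit functions.
  obtain ⟨U, W, hU, hW, hKU, h0W, hUW⟩ := generalized_tube_lemma hK' (isCompact_singleton (x := (0 : ℝ)))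
    (isOpen_lt continuous_const hΘ : IsOpen {q | 0 < Θ q}) (by
      rintro ⟨_, s⟩ ⟨⟨κ, hκ, rfl⟩, hs⟩
      obtain rfl : s = 0 := hs
      simpa [Θ] using hpos κ hκ)
  obtain ⟨r, hr, hrW⟩ := Metric.isOpen_iff.1 hW 0 (h0W rfl)
  rw [Real.ball_eq_Ioo] at hrW
  simp only [zero_sub, zero_add] at hrW
  let eqn : E × E × E → ℝ → Prop := fun y s => ρ (y.1 + y.2.2 + s • y.2.1) = ρ y.1
  have huniq : ∀ y ∈ U, ∀ s ∈ Ioo (-r) r, ∀ s' ∈ Ioo (-r) r, eqn y s → eqn y s' → s = s' := by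
    intro y hy s hs s' hs' h h'
    have hmono : StrictMonoOn (fun s : ℝ => ρ (y.1 + y.2.2 + s • y.2.1)) (Ioo (-r) r) := by
      have hder : ∀ s : ℝ, HasDerivAt (fun s : ℝ => ρ (y.1 + y.2.2 + s • y.2.1)) (Θ (y, s)) s := by
        intro s
        have h2 : HasDerivAt (fun s : ℝ => y.1 + y.2.2 + s • y.2.1) y.2.1 s := by
          simpa using ((hasDerivAt_id s).smul_const y.2.1).const_add (y.1 + y.2.2)
        exact (hρ.differentiable hm').differentiableAt.hasFDerivAt.comp_hasDerivAt s h2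
      refine strictMonoOn_of_deriv_pos (convex_Ioo _ _)
        (fun s _ => (hder s).continuousAt.continuousWithinAt) fun s hs => ?_
      rw [interior_Ioo] at hs
      rw [(hder s).deriv]
      exact hUW (mk_mem_prod hy (hrW hs))
    exact hmono.injOn hs hs' (h.trans h'.symm)
  -- The default value 0 is never used on `O`, which contains only points having a root.
  let σ : E × E × E → ℝ := fun y => if h : ∃ s ∈ Ioo (-r) r, eqn y s then h.choose else 0
  have hσ : ∀ y, (∃ s ∈ Ioo (-r) r, eqn y s) → σ y ∈ Ioo (-r) r ∧ eqn y (σ y) := by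
    intro y h
    simp only [σ, dif_pos h]
    exact h.choose_spec
  let O : Set (E × E × E) := {y | y ∈ U ∧ ∃ s ∈ Ioo (-r) r, eqn y s}
  have hloc : ∀ y ∈ O, O ∈ 𝓝 y ∧ ContDiffAt ℝ m σ y := by
    rintro y ⟨hyU, hy⟩
    obtain ⟨h1, h2⟩ := hσ y hy
    have hd : 0 < Θ (y, σ y) := hUW (mk_mem_prod hyU (hrW h1))
    obtain ⟨τ, hτ, hτy, hτe⟩ := exists_local_height hm hρ y (σ y) hd.ne' h2
    have hev : ∀ᶠ y' in 𝓝 y, τ y' ∈ Ioo (-r) r :=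
      hτ.continuousAt.eventually (by rw [hτy]; exact isOpen_Ioo.mem_nhds h1)
    have hev' : ∀ᶠ y' in 𝓝 y, y' ∈ O ∧ σ y' = τ y' := by
      filter_upwards [hev, hτe, hU.mem_nhds hyU] with y' ha hb hc
      have hO : ∃ s ∈ Ioo (-r) r, eqn y' s := ⟨_, ha, hb⟩
      exact ⟨⟨hc, hO⟩, huniq y' hc _ (hσ y' hO).1 _ ha (hσ y' hO).2 hb⟩
    exact ⟨hev'.mono fun _ h => h.1, hτ.congr_of_eventuallyEq (hev'.mono fun _ h => h.2)⟩
  refine ⟨O, σ, isOpen_iff_mem_nhds.2 fun y hy => (hloc y hy).1,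
    fun y hy => (hloc y hy).2.contDiffWithinAt, fun κ hκ => ?_, fun y hy => ?_⟩
  · have h0 : eqn (κ.1, κ.2, 0) 0 := by simp [eqn]
    have hr0 : (0 : ℝ) ∈ Ioo (-r) r := ⟨by linarith, hr⟩
    have hU' : (κ.1, κ.2, (0 : E)) ∈ U := hKU ⟨κ, hκ, rfl⟩
    have hex : ∃ s ∈ Ioo (-r) r, eqn (κ.1, κ.2, 0) s := ⟨0, hr0, h0⟩
    exact ⟨⟨hU', hex⟩, huniq _ hU' _ (hσ _ hex).1 _ hr0 (hσ _ hex).2 h0⟩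
  · exact ⟨(hσ y hy.2).2, hUW (mk_mem_prod hy.1 (hrW (hσ y hy.2).1))⟩

omit [CompleteSpace E] in
-- The zero set of ρ may be larger than ∂N. A nonzero differential yields a direction in which ρ
-- becomes negative, so the zero is a limit of points of the sublevel set.
theorem mem_frontier_of_fderiv_ne_zero {ρ : E → ℝ} (hρ : Continuous ρ) {q : E} (hq : ρ q = 0)
    (hd : fderiv ℝ ρ q ≠ 0) : q ∈ frontier {z | ρ z < 0} := by
  have hopen : IsOpen {z | ρ z < 0} := isOpen_lt hρ continuous_const
  rw [hopen.frontier_eq]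
  refine ⟨?_, by simp [hq]⟩
  obtain ⟨v, hv⟩ : ∃ v, fderiv ℝ ρ q v < 0 := by
    obtain ⟨v, hv⟩ := DFunLike.exists_ne hd
    rcases lt_or_gt_of_ne hv with h | h
    · exact ⟨v, h⟩
    · exact ⟨-v, by simpa using h⟩
  have hdiff : DifferentiableAt ℝ ρ q := by
    by_contra h
    exact hd (fderiv_zero_of_not_differentiableAt h)
  have hline : HasDerivAt (fun t : ℝ => q + t • v) v 0 := by
    simpa using ((hasDerivAt_id (0 : ℝ)).smul_const v).const_add q
  have hder : HasDerivAt (fun t : ℝ => ρ (q + t • v)) (fderiv ℝ ρ q v) 0 := by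
    have : HasFDerivAt ρ (fderiv ℝ ρ q) (q + (0 : ℝ) • v) := by simpa using hdiff.hasFDerivAt
    exact this.comp_hasDerivAt (0 : ℝ) hline
  have hneg : ∀ᶠ t in 𝓝[>] (0 : ℝ), ρ (q + t • v) < 0 := by
    have := (hasDerivAt_iff_tendsto_slope.1 hder).eventually (gt_mem_nhds hv)
    have h2 : ∀ᶠ t in 𝓝[>] (0 : ℝ), slope (fun t : ℝ => ρ (q + t • v)) 0 t < 0 :=
      this.filter_mono (nhdsWithin_mono _ fun t ht => ne_of_gt ht)
    filter_upwards [h2, self_mem_nhdsWithin] with t ht ht0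
    have ht0 : 0 < t := ht0
    rw [slope_def_field] at ht
    simp only [zero_smul, add_zero, hq, sub_zero] at ht
    by_contra hcon
    push Not at hcon
    exact absurd ht (not_lt.2 (div_nonneg hcon ht0.le))
  refine mem_closure_of_tendsto (f := fun t : ℝ => q + t • v) (b := 𝓝[>] (0 : ℝ)) ?_ hneg
  have : Tendsto (fun t : ℝ => q + t • v) (𝓝 0) (𝓝 (q + (0 : ℝ) • v)) := hline.continuousAt
  simp only [zero_smul, add_zero] at this
  exact this.mono_left nhdsWithin_le_nhds

end ImplicitHeight

/-! ### Variations with prescribed field away from the boundary. -/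

theorem IsDefiningFunction.isOpen {n : ℕ} {m : ℕ∞} {ρ : Cn n → ℝ} {N : Set (Cn n)}
    (h : IsDefiningFunction m ρ N) : IsOpen N :=
  h.eq_sublevel ▸ isOpen_lt h.contDiff.continuous continuous_const

theorem IsDefiningFunction.eq_zero {n : ℕ} {m : ℕ∞} {ρ : Cn n → ℝ} {N : Set (Cn n)}
    (h : IsDefiningFunction m ρ N) {p : Cn n} (hp : p ∈ frontier N) : ρ p = 0 := by
  rw [h.eq_sublevel] at hp
  exact frontier_lt_subset_eq h.contDiff.continuous continuous_const hp

theorem IsDefiningFunction.neg {n : ℕ} {m : ℕ∞} {ρ : Cn n → ℝ} {N : Set (Cn n)}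
    (h : IsDefiningFunction m ρ N) {p : Cn n} (hp : p ∈ N) : ρ p < 0 := by
  rw [h.eq_sublevel] at hp
  exact hp

/-- Every field `V` along a disk can be corrected near the boundary, in the direction of a
transverse field `X`, to the field of a variation along which `ρ` stays constant there. -/
theorem exists_variation {n : ℕ} {m : ℕ∞} (hm : 2 ≤ m) {ρ : Cn n → ℝ} {N : Set (Cn n)}
    (hρ : IsDefiningFunction m ρ N) {f : ℂ → Cn n} (hf : IsDisk N f) {X V : ℂ → Cn n}
    (hX : ContDiffOn ℝ ∞ X (closedBall 0 1)) (hV : ContDiffOn ℝ ∞ V (closedBall 0 1))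
    {χ : ℂ → ℝ} (hχ : ContDiff ℝ ∞ χ) {r₀ r₁ r₂ : ℝ} (h01 : r₀ < r₁) (h2 : r₂ < 1)
    (hpos : ∀ z ∈ closedBall (0 : ℂ) 1, r₀ ≤ ‖z‖ → 0 < fderiv ℝ ρ (f z) (X z))
    (hχ0 : ∀ z, ‖z‖ < r₁ → χ z = 0) (hχ1 : ∀ z, r₂ ≤ ‖z‖ → χ z = 1) :
    ∃ (ε : ℝ) (F : ℝ → ℂ → Cn n), IsVariation m N f ε F ∧ ∀ z ∈ closedBall (0 : ℂ) 1,
      deriv (fun t => F t z) 0 =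
        V z - (χ z * (fderiv ℝ ρ (f z) (V z) / fderiv ℝ ρ (f z) (X z))) • X z := by
  have hm0 : m ≠ 0 := by rintro rfl; exact absurd hm (by decide)
  have hmo : (m : ℕ∞ω) ≠ 0 := by exact_mod_cast hm0
  have hmle : (m : ℕ∞ω) ≤ ∞ := by exact_mod_cast le_top
  let A : Set ℂ := {z | z ∈ closedBall (0 : ℂ) 1 ∧ r₀ ≤ ‖z‖}
  have hA : IsCompact A := (isCompact_closedBall 0 1).inter_right
    (isClosed_le continuous_const continuous_norm)
  have hAsub : A ⊆ closedBall 0 1 := fun z hz => hz.1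
  have hK : IsCompact ((fun z => (f z, X z)) '' A) := hA.image_of_continuousOn
    ((hf.smooth.continuousOn.mono hAsub).prodMk (hX.continuousOn.mono hAsub))
  obtain ⟨O, σ, hO, hσ, hσ0, hσO⟩ := exists_height hm0 hρ.contDiff hK (by
    rintro _ ⟨z, hz, rfl⟩; exact hpos z hz.1 hz.2)
  obtain ⟨U, W, hU, hW, hKU, h0W, hUW⟩ := generalized_tube_lemma hK
    (isCompact_singleton (x := (0 : Cn n)))
    (hO.preimage (f := fun q : (Cn n × Cn n) × Cn n => (q.1.1, q.1.2, q.2)) (by fun_prop)) (by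
      rintro ⟨_, v⟩ ⟨hκ, hv⟩
      obtain rfl : v = 0 := hv
      exact (hσ0 _ hκ).1)
  obtain ⟨C, hC⟩ := (isCompact_closedBall (0 : ℂ) 1).exists_bound_of_continuousOn hV.continuousOn
  obtain ⟨δ, hδ, hδW⟩ := Metric.isOpen_iff.1 hW 0 (h0W rfl)
  -- Keeps t V(z) in the δ-ball on which the height function is defined.
  let ε₁ : ℝ := δ / (|C| + 1)
  have hε₁ : 0 < ε₁ := by positivity
  have hmemO : ∀ t ∈ Ioo (-ε₁) ε₁, ∀ z ∈ A, (f z, X z, t • V z) ∈ O := by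
    intro t ht z hz
    refine hUW (mk_mem_prod (a := (f z, X z)) (hKU ⟨z, hz, rfl⟩) (hδW ?_))
    rw [mem_ball_zero_iff, norm_smul]
    calc ‖t‖ * ‖V z‖ ≤ ‖t‖ * (|C| + 1) := by
          gcongr; linarith [hC z hz.1, le_abs_self C]
      _ < ε₁ * (|C| + 1) := by
          gcongr; exact abs_lt.2 ht
      _ = δ := div_mul_cancel₀ _ (by positivity)
  -- A straight displacement, corrected along X so that ρ keeps its value exactly where χ = 1. Where
  -- χ = 0 the value of `σ` is irrelevant, even off its domain of smoothness.
  let F : ℝ → ℂ → Cn n := fun t z => f z + t • V z + (χ z * σ (f z, X z, t • V z)) • X z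
  have hFin : ∀ t z, ‖z‖ < r₁ → F t z = f z + t • V z := by
    intro t z hz; simp [F, hχ0 z hz]
  have hFsm : ContDiffOn ℝ m (fun q : ℝ × ℂ => F q.1 q.2)
      (Ioo (-ε₁) ε₁ ×ˢ closedBall (0 : ℂ) 1) := by
    rintro ⟨t, z⟩ ⟨ht, hz⟩
    have hsnd : MapsTo (Prod.snd : ℝ × ℂ → ℂ) (Ioo (-ε₁) ε₁ ×ˢ closedBall (0 : ℂ) 1)
      (closedBall 0 1) := fun q hq => hq.2
    have hf' : ContDiffWithinAt ℝ m (fun q : ℝ × ℂ => f q.2)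
        (Ioo (-ε₁) ε₁ ×ˢ closedBall (0 : ℂ) 1) (t, z) :=
      ((hf.smooth.of_le hmle).comp contDiff_snd.contDiffOn hsnd) (t, z) ⟨ht, hz⟩
    have hX' : ContDiffWithinAt ℝ m (fun q : ℝ × ℂ => X q.2)
        (Ioo (-ε₁) ε₁ ×ˢ closedBall (0 : ℂ) 1) (t, z) :=
      ((hX.of_le hmle).comp contDiff_snd.contDiffOn hsnd) (t, z) ⟨ht, hz⟩
    have hV' : ContDiffWithinAt ℝ m (fun q : ℝ × ℂ => q.1 • V q.2)
        (Ioo (-ε₁) ε₁ ×ˢ closedBall (0 : ℂ) 1) (t, z) :=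
      contDiffWithinAt_fst.smul
        (((hV.of_le hmle).comp contDiff_snd.contDiffOn hsnd) (t, z) ⟨ht, hz⟩)
    rcases lt_or_ge ‖z‖ r₁ with h | h
    · refine (hf'.add hV').congr_of_eventuallyEq ?_ (hFin t z h)
      filter_upwards [nhdsWithin_le_nhds ((isOpen_lt (continuous_norm.comp continuous_snd)
        continuous_const).mem_nhds (show ‖((t, z) : ℝ × ℂ).2‖ < r₁ from h))] with q hq
      exact hFin q.1 q.2 hq
    · have hzA : z ∈ A := ⟨hz, h01.le.trans h⟩
      have hσ' : ContDiffWithinAt ℝ m (fun q : ℝ × ℂ => σ (f q.2, X q.2, q.1 • V q.2))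
          (Ioo (-ε₁) ε₁ ×ˢ closedBall (0 : ℂ) 1) (t, z) :=
        (hσ.contDiffAt (hO.mem_nhds (hmemO t ht z hzA))).comp_contDiffWithinAt
          (x := (t, z)) (f := fun q : ℝ × ℂ => (f q.2, X q.2, q.1 • V q.2))
          (hf'.prodMk (hX'.prodMk hV'))
      have hχ' : ContDiffWithinAt ℝ m (fun q : ℝ × ℂ => χ q.2)
          (Ioo (-ε₁) ε₁ ×ˢ closedBall (0 : ℂ) 1) (t, z) :=
        ((hχ.of_le hmle).comp contDiff_snd).contDiffWithinAt
      exact (hf'.add hV').add ((hχ'.mul hσ').smul hX')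
  have hF0 : ∀ z ∈ closedBall (0 : ℂ) 1, F 0 z = f z := by
    intro z hz
    rcases lt_or_ge ‖z‖ r₁ with h | h
    · simp [hFin 0 z h]
    · simp [F, (hσ0 (f z, X z) ⟨z, ⟨hz, h01.le.trans h⟩, rfl⟩).2]
  have hlevel : ∀ t ∈ Ioo (-ε₁) ε₁, ∀ z ∈ A, r₂ ≤ ‖z‖ →
      ρ (F t z) = ρ (f z) ∧ 0 < fderiv ℝ ρ (F t z) (X z) := by
    intro t ht z hz hz2
    have := hσO _ (hmemO t ht z hz)
    simpa [F, hχ1 z hz2] using this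
  -- On the compact disk of radius r₂ the image of f is inside the open set N, so small t suffices
  -- there; outside it the preserved value of ρ decides.
  have hcore : ∀ᶠ t in 𝓝 (0 : ℝ), ∀ z ∈ closedBall (0 : ℂ) r₂, F t z ∈ N := by
    refine (isCompact_closedBall (0 : ℂ) r₂).eventually_forall_of_forall_eventually fun z hz => ?_
    have hz1 : z ∈ ball (0 : ℂ) 1 := by
      rw [mem_closedBall_zero_iff] at hz; rw [mem_ball_zero_iff]; linarith
    have hca : ContinuousAt (fun q : ℝ × ℂ => F q.1 q.2) (0, z) := by
      refine hFsm.continuousOn.continuousAt (prod_mem_nhds (Ioo_mem_nhds (by linarith) hε₁) ?_)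
      exact mem_of_superset (isOpen_ball.mem_nhds hz1) ball_subset_closedBall
    refine hca.eventually (hρ.isOpen.mem_nhds ?_)
    change F 0 z ∈ N
    rw [hF0 z (ball_subset_closedBall hz1)]
    exact hf.mapsTo_interior hz1
  obtain ⟨ε₂, hε₂, hε₂'⟩ := Metric.eventually_nhds_iff_ball.1 hcore
  -- χ cannot be both 0 and 1, so the collar where χ = 1 lies in the region of transversality.
  have hr : ∀ z ∈ closedBall (0 : ℂ) 1, r₂ ≤ ‖z‖ → z ∈ A := by
    intro z hz h
    refine ⟨hz, ?_⟩
    by_contra hcon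
    push Not at hcon
    have := hχ0 z (hcon.trans h01)
    rw [hχ1 z h] at this
    exact one_ne_zero this
  refine ⟨min ε₁ ε₂, F, ⟨lt_min hε₁ hε₂, hFsm.mono (prod_mono (Ioo_subset_Ioo
    (neg_le_neg (min_le_left _ _)) (min_le_left _ _)) Subset.rfl), hF0, ?_, ?_⟩, ?_⟩
  · intro t ht z hz
    have ht1 : t ∈ Ioo (-ε₁) ε₁ := Ioo_subset_Ioo
      (neg_le_neg (min_le_left _ _)) (min_le_left _ _) ht
    have ht2 : t ∈ ball (0 : ℝ) ε₂ := by
      rw [mem_ball_zero_iff, Real.norm_eq_abs]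
      exact (abs_lt.2 ht).trans_le (min_le_right _ _)
    rcases le_or_gt r₂ ‖z‖ with h | h
    · rw [hρ.eq_sublevel]
      change ρ (F t z) < 0
      rw [(hlevel t ht1 z (hr z (ball_subset_closedBall hz) h) h).1]
      exact hρ.neg (hf.mapsTo_interior hz)
    · exact hε₂' t ht2 z (mem_closedBall_zero_iff.2 h.le)
  · intro t ht z hz
    have ht1 : t ∈ Ioo (-ε₁) ε₁ := Ioo_subset_Ioo
      (neg_le_neg (min_le_left _ _)) (min_le_left _ _) ht
    have hz' : r₂ ≤ ‖z‖ := by rw [mem_sphere_zero_iff_norm.1 hz]; exact h2.le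
    obtain ⟨ha, hb⟩ := hlevel t ht1 z (hr z (sphere_subset_closedBall hz) hz') hz'
    rw [hρ.eq_sublevel]
    refine mem_frontier_of_fderiv_ne_zero hρ.contDiff.continuous ?_ ?_
    · rw [ha]; exact hρ.eq_zero (hf.mapsTo_boundary hz)
    · intro h0; rw [h0] at hb; exact lt_irrefl _ hb
  · intro z hz
    have hbase : HasDerivAt (fun t : ℝ => f z + t • V z) (V z) 0 := by
      simpa using ((hasDerivAt_id (0 : ℝ)).smul_const (V z)).const_add (f z)
    rcases lt_or_ge ‖z‖ r₁ with h | h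
    · have hd : HasDerivAt (fun t : ℝ => F t z) (V z) 0 := by
        exact hbase.congr_of_eventuallyEq (Eventually.of_forall fun t => hFin t z h)
      rw [hd.deriv, hχ0 z h]; simp
    · have hzA : z ∈ A := ⟨hz, h01.le.trans h⟩
      let c : ℝ → ℝ := fun t => σ (f z, X z, t • V z)
      have h0m : (0 : ℝ) ∈ Ioo (-ε₁) ε₁ := ⟨by linarith, hε₁⟩
      have hcd : DifferentiableAt ℝ c 0 := by
        have h1 := ((hσ.contDiffAt (hO.mem_nhds (hmemO 0 h0m z hzA))).differentiableAt hmo)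
        have h2 : DifferentiableAt ℝ (fun t : ℝ => (f z, X z, t • V z)) 0 := by fun_prop
        exact h1.comp (0 : ℝ) h2
      have hc := hcd.hasDerivAt
      have hc0 : c 0 = 0 := by
        simp only [c, zero_smul]; exact (hσ0 (f z, X z) ⟨z, hzA, rfl⟩).2
      have hcurve : HasDerivAt (fun t : ℝ => f z + t • V z + c t • X z)
          (V z + deriv c 0 • X z) 0 := by
        exact hbase.add (hc.smul_const (X z))
      have hcomp : HasDerivAt (fun t : ℝ => ρ (f z + t • V z + c t • X z))
          (fderiv ℝ ρ (f z) (V z + deriv c 0 • X z)) 0 := by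
        have h3 : HasFDerivAt ρ (fderiv ℝ ρ (f z)) (f z + (0 : ℝ) • V z + c 0 • X z) := by
          simpa [hc0] using (hρ.contDiff.differentiable hmo).differentiableAt.hasFDerivAt
        exact h3.comp_hasDerivAt (0 : ℝ) hcurve
      have hconst : HasDerivAt (fun t : ℝ => ρ (f z + t • V z + c t • X z)) 0 0 := by
        refine (hasDerivAt_const (0 : ℝ) (ρ (f z))).congr_of_eventuallyEq ?_
        filter_upwards [Ioo_mem_nhds h0m.1 h0m.2] with t ht
        exact (hσO _ (hmemO t ht z hzA)).1
      have hz0 := hcomp.unique hconst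
      rw [map_add, map_smul, smul_eq_mul] at hz0
      have hp := hpos z hz hzA.2
      -- Obtained by differentiating the conservation of ρ at t = 0.
      have hc' : deriv c 0 = -(fderiv ℝ ρ (f z) (V z) / fderiv ℝ ρ (f z) (X z)) := by
        field_simp; linarith
      have hd : HasDerivAt (fun t : ℝ => F t z) (V z + (χ z * deriv c 0) • X z) 0 := by
        exact hbase.add ((hc.const_mul (χ z)).smul_const (X z))
      rw [hd.deriv, hc', mul_neg, neg_smul, sub_eq_add_neg]

/-! ### Differentiation under the integral sign. -/

section ParametricIntegrals

variable {X : Type*} [TopologicalSpace X] [TopologicalSpace.MetrizableSpace X]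
  [MeasurableSpace X]
  [BorelSpace X] {ν : Measure X} [IsFiniteMeasureOnCompacts ν] {K S : Set X} {ε : ℝ}

theorem hasDerivAt_setIntegral (hK : IsCompact K) (hS : MeasurableSet S) (hSK : S ⊆ K)
    {Φ Φ' : ℝ → X → ℝ}
    (hd : ∀ t ∈ Ioo (-ε) ε, ∀ x ∈ K, HasDerivAt (fun t => Φ t x) (Φ' t x) t)
    (hc : ContinuousOn (fun q : ℝ × X => Φ q.1 q.2) (Ioo (-ε) ε ×ˢ K))
    (hc' : ContinuousOn (fun q : ℝ × X => Φ' q.1 q.2) (Ioo (-ε) ε ×ˢ K))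
    {t₀ : ℝ} (ht₀ : t₀ ∈ Ioo (-ε) ε) :
    HasDerivAt (fun t => ∫ x in S, Φ t x ∂ν) (∫ x in S, Φ' t₀ x ∂ν) t₀ := by
  obtain ⟨r, hr, hrI⟩ := Metric.nhds_basis_closedBall.mem_iff.1 (isOpen_Ioo.mem_nhds ht₀)
  obtain ⟨C, hC⟩ := ((isCompact_closedBall t₀ r).prod hK).exists_bound_of_continuousOn
    (hc'.mono (prod_mono hrI Subset.rfl))
  have hslice : ∀ {Ψ : ℝ → X → ℝ}, ContinuousOn (fun q : ℝ × X => Ψ q.1 q.2) (Ioo (-ε) ε ×ˢ K) →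
      ∀ t ∈ Ioo (-ε) ε, ContinuousOn (Ψ t) K := fun h t ht =>
    h.comp (f := fun x => (t, x)) (by fun_prop) fun x hx => ⟨ht, hx⟩
  have hfin : ν S < ⊤ := (measure_mono hSK).trans_lt hK.measure_lt_top
  refine (hasDerivAt_integral_of_dominated_loc_of_deriv_le (s := closedBall t₀ r)
    (bound := fun _ => C) (closedBall_mem_nhds t₀ hr) ?_ ?_ ?_ ?_ ?_ ?_).2
  · filter_upwards [isOpen_Ioo.mem_nhds ht₀] with t ht
    exact ((hslice hc t ht).mono hSK).aestronglyMeasurable hS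
  · exact ((hslice hc t₀ ht₀).integrableOn_compact hK).mono_set hSK
  · exact ((hslice hc' t₀ ht₀).mono hSK).aestronglyMeasurable hS
  · filter_upwards [ae_restrict_mem hS] with x hx t ht
    exact hC (t, x) ⟨ht, hSK hx⟩
  · exact integrableOn_const hfin.ne
  · filter_upwards [ae_restrict_mem hS] with x hx t ht
    exact hd t (hrI ht) x (hSK hx)

/-- Only b is differentiated in t; a is merely continuous. Since b vanishes at t = 0, the difference
quotient is ⟨a(t), b(t)/t⟩, which tends to |a(0)|². With b = ∂̄F_t − ∂̄f this allows a second
derivative of the energy for families of class C². -/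
theorem hasDerivAt_setIntegral_inner {n : ℕ} (hε : 0 < ε) (hK : IsCompact K) (hS : MeasurableSet S)
    (hSK : S ⊆ K) {a b : ℝ → X → Cn n}
    (hd : ∀ t ∈ Ioo (-ε) ε, ∀ x ∈ K, HasDerivAt (fun t => b t x) (a t x) t)
    (ha : ContinuousOn (fun q : ℝ × X => a q.1 q.2) (Ioo (-ε) ε ×ˢ K))
    (hb : ContinuousOn (fun q : ℝ × X => b q.1 q.2) (Ioo (-ε) ε ×ˢ K))
    (hb0 : ∀ x ∈ K, b 0 x = 0) :
    HasDerivAt (fun t => ∫ x in S, (inner ℂ (a t x) (b t x)).re ∂ν)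
      (∫ x in S, ‖a 0 x‖ ^ 2 ∂ν) 0 := by
  have h0 : (0 : ℝ) ∈ Ioo (-ε) ε := ⟨by linarith, hε⟩
  obtain ⟨r, hr, hrI⟩ := Metric.nhds_basis_closedBall.mem_iff.1 (isOpen_Ioo.mem_nhds h0)
  obtain ⟨C, hC⟩ := ((isCompact_closedBall 0 r).prod hK).exists_bound_of_continuousOn
    (ha.mono (prod_mono hrI Subset.rfl))
  have hab : ContinuousOn (fun q : ℝ × X => (inner ℂ (a q.1 q.2) (b q.1 q.2)).re)
      (Ioo (-ε) ε ×ˢ K) := Complex.continuous_re.comp_continuousOn (ha.inner (𝕜 := ℂ) hb)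
  have hslice : ∀ {E : Type} [TopologicalSpace E] {Ψ : ℝ → X → E},
      ContinuousOn (fun q : ℝ × X => Ψ q.1 q.2) (Ioo (-ε) ε ×ˢ K) →
      ∀ t ∈ Ioo (-ε) ε, ContinuousOn (Ψ t) K := fun h t ht =>
    h.comp (f := fun x => (t, x)) (by fun_prop) fun x hx => ⟨ht, hx⟩
  have hfin : ν S < ⊤ := (measure_mono hSK).trans_lt hK.measure_lt_top
  -- The mean value inequality gives b = O(t) uniformly, hence a Lipschitz bound at 0 for the
  -- integrand.
  have hbb : ∀ t ∈ closedBall (0 : ℝ) r, ∀ x ∈ K, ‖b t x‖ ≤ C * ‖t‖ := by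
    intro t ht x hx
    have := (convex_closedBall (0 : ℝ) r).norm_image_sub_le_of_norm_hasDerivWithin_le
      (f := fun t => b t x) (f' := fun t => a t x) (C := C)
      (fun s hs => (hd s (hrI hs) x hx).hasDerivWithinAt) (fun s hs => hC (s, x) ⟨hs, hx⟩)
      (mem_closedBall_self hr.le) ht
    simpa [hb0 x hx] using this
  have key := (hasFDerivAt_integral_of_dominated_loc_of_lip' (𝕜 := ℝ) (μ := ν.restrict S)
    (F := fun t x => (inner ℂ (a t x) (b t x)).re) (x₀ := (0 : ℝ)) (s := closedBall 0 r)
    (bound := fun _ => C * C)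
    (F' := fun x => (1 : ℝ →L[ℝ] ℝ).smulRight (‖a 0 x‖ ^ 2)) (closedBall_mem_nhds 0 hr)
    ?_ ?_ ?_ ?_ ?_ ?_)
  · have h := key.2.hasDerivAt
    refine h.congr_deriv ?_
    rw [ContinuousLinearMap.integral_apply key.1]
    simp
  · intro t ht
    exact ((hslice (Ψ := fun t x => (inner ℂ (a t x) (b t x)).re) hab t (hrI ht)).mono hSK).aestronglyMeasurable hS
  · exact ((hslice (Ψ := fun t x => (inner ℂ (a t x) (b t x)).re) hab 0 h0).integrableOn_compact hK).mono_set hSK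
  · have : ContinuousOn (fun x => (1 : ℝ →L[ℝ] ℝ).smulRight (‖a 0 x‖ ^ 2)) K :=
      ((ContinuousLinearMap.smulRightL ℝ ℝ ℝ 1).continuous.comp_continuousOn
        ((hslice ha 0 h0).norm.pow 2))
    exact (this.mono hSK).aestronglyMeasurable hS
  · filter_upwards [ae_restrict_mem hS] with x hx t ht
    have hx := hSK hx
    simp only [hb0 x hx, inner_zero_right, Complex.zero_re, sub_zero]
    calc ‖(inner ℂ (a t x) (b t x)).re‖ ≤ ‖a t x‖ * ‖b t x‖ :=
          (Complex.abs_re_le_norm _).trans (norm_inner_le_norm _ _)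
      _ ≤ C * (C * ‖t‖) := mul_le_mul (hC (t, x) ⟨ht, hx⟩) (hbb t ht x hx) (norm_nonneg _)
          ((norm_nonneg _).trans (hC (t, x) ⟨ht, hx⟩))
      _ = C * C * ‖t‖ := by ring
  · exact integrableOn_const hfin.ne
  · filter_upwards [ae_restrict_mem hS] with x hx
    have hx := hSK hx
    refine HasDerivAt.hasFDerivAt ?_
    have hca : ContinuousAt (fun t => a t x) 0 :=
      (ha.comp (f := fun t : ℝ => (t, x)) (s := Ioo (-ε) ε) (by fun_prop)
        fun t ht => ⟨ht, hx⟩).continuousAt (isOpen_Ioo.mem_nhds h0)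
    rw [hasDerivAt_iff_tendsto_slope]
    have h1 := (hasDerivAt_iff_tendsto_slope.1 (hd 0 h0 x hx))
    have h2 := Complex.continuous_re.continuousAt.tendsto.comp
      ((hca.tendsto.mono_left nhdsWithin_le_nhds).inner (𝕜 := ℂ) h1)
    have h3 : (inner ℂ (a 0 x) (a 0 x)).re = ‖a 0 x‖ ^ 2 := by
      rw [inner_self_eq_norm_sq_to_K]; norm_cast
    rw [h3] at h2
    refine h2.congr fun t => ?_
    simp only [slope_def_module, hb0 x hx, sub_zero, inner_zero_right, Complex.zero_re,
      Function.comp_apply, smul_eq_mul]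
    have : (t⁻¹ : ℝ) • b t x = ((t⁻¹ : ℝ) : ℂ) • b t x := (Complex.coe_smul _ _).symm
    rw [this, inner_smul_right, Complex.re_ofReal_mul]

end ParametricIntegrals

/-! ### Derivatives of families of maps of the closed disk. -/

section Cylinder

variable {n : ℕ} {ε : ℝ} {u : ℝ × ℂ → Cn n}

/-- The product of the parameter interval with the closed disk. -/
def cylinder (ε : ℝ) : Set (ℝ × ℂ) := Ioo (-ε) ε ×ˢ closedBall (0 : ℂ) 1

/-- The parameter derivative of a family of maps of the closed disk. -/
def timeDeriv (ε : ℝ) (u : ℝ × ℂ → Cn n) (q : ℝ × ℂ) : Cn n :=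
  fderivWithin ℝ u (cylinder ε) q (1, 0)

/-- The `∂/∂z̄`-derivative of a family of maps of the closed disk. -/
def familyDbar (ε : ℝ) (u : ℝ × ℂ → Cn n) (q : ℝ × ℂ) : Cn n :=
  (1 / 2 : ℂ) • (fderivWithin ℝ u (cylinder ε) q (0, 1) +
    Complex.I • fderivWithin ℝ u (cylinder ε) q (0, Complex.I))

theorem uniqueDiffOn_cylinder : UniqueDiffOn ℝ (cylinder ε) :=
  isOpen_Ioo.uniqueDiffOn.prod uniqueDiffOn_closedDisk

theorem cylinder_mem_nhds {t : ℝ} {z : ℂ} (ht : t ∈ Ioo (-ε) ε) (hz : z ∈ ball (0 : ℂ) 1) :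
    cylinder ε ∈ 𝓝 (t, z) :=
  prod_mem_nhds (isOpen_Ioo.mem_nhds ht)
    (mem_of_superset (isOpen_ball.mem_nhds hz) ball_subset_closedBall)

theorem contDiffOn_timeDeriv {k l : ℕ∞ω} (hu : ContDiffOn ℝ l u (cylinder ε)) (hk : k + 1 ≤ l) :
    ContDiffOn ℝ k (timeDeriv ε u) (cylinder ε) :=
  (hu.fderivWithin uniqueDiffOn_cylinder hk).clm_apply contDiffOn_const

theorem contDiffOn_familyDbar {k l : ℕ∞ω} (hu : ContDiffOn ℝ l u (cylinder ε)) (hk : k + 1 ≤ l) :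
    ContDiffOn ℝ k (familyDbar ε u) (cylinder ε) := by
  have h := hu.fderivWithin uniqueDiffOn_cylinder hk
  unfold familyDbar
  exact ((h.clm_apply contDiffOn_const).add
    ((h.clm_apply contDiffOn_const).const_smul Complex.I)).const_smul (1 / 2 : ℂ)

theorem hasDerivAt_timeDeriv (hu : DifferentiableOn ℝ u (cylinder ε)) {t : ℝ} {z : ℂ}
    (ht : t ∈ Ioo (-ε) ε) (hz : z ∈ closedBall (0 : ℂ) 1) :
    HasDerivAt (fun t => u (t, z)) (timeDeriv ε u (t, z)) t := by
  have h1 := (hu (t, z) ⟨ht, hz⟩).hasFDerivWithinAt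
  have h2 : HasDerivWithinAt (fun t : ℝ => (t, z)) ((1 : ℝ), (0 : ℂ)) (Ioo (-ε) ε) t :=
    ((hasDerivAt_id t).prodMk (hasDerivAt_const t z)).hasDerivWithinAt
  have h3 : MapsTo (fun t : ℝ => (t, z)) (Ioo (-ε) ε) (cylinder ε) := fun s hs => ⟨hs, hz⟩
  exact (h1.comp_hasDerivWithinAt t h2 h3).hasDerivAt (isOpen_Ioo.mem_nhds ht)

theorem dbarOn_slice (hu : DifferentiableOn ℝ u (cylinder ε)) {t : ℝ} {z : ℂ}
    (ht : t ∈ Ioo (-ε) ε) (hz : z ∈ closedBall (0 : ℂ) 1) :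
    dbarOn (fun z => u (t, z)) z = familyDbar ε u (t, z) := by
  have h1 := (hu (t, z) ⟨ht, hz⟩).hasFDerivWithinAt
  have h2 : HasFDerivWithinAt (fun z : ℂ => (t, z)) (ContinuousLinearMap.inr ℝ ℝ ℂ)
      (closedBall 0 1) z := (hasFDerivAt_prodMk_right t z).hasFDerivWithinAt
  have h3 : HasFDerivWithinAt (fun z => u (t, z))
      ((fderivWithin ℝ u (cylinder ε) (t, z)).comp (ContinuousLinearMap.inr ℝ ℝ ℂ))
      (closedBall 0 1) z := h1.comp z h2 fun w hw => ⟨ht, hw⟩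
  simp only [dbarOn, familyDbar, h3.fderivWithin (uniqueDiffOn_closedDisk z hz)]
  simp

/-- Symmetry of second derivatives. The interior is enough, since the identity is only used under an
integral over the open disk. -/
theorem timeDeriv_familyDbar (hu : ContDiffOn ℝ 2 u (cylinder ε)) {t : ℝ} {z : ℂ}
    (ht : t ∈ Ioo (-ε) ε) (hz : z ∈ ball (0 : ℂ) 1) :
    timeDeriv ε (familyDbar ε u) (t, z) = familyDbar ε (timeDeriv ε u) (t, z) := by
  have hnhds := cylinder_mem_nhds ht hz
  have hat : ContDiffAt ℝ 2 u (t, z) := hu.contDiffAt hnhds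
  have hsymm : IsSymmSndFDerivAt ℝ u (t, z) := hat.isSymmSndFDerivAt (by simp)
  have hD : DifferentiableAt ℝ (fderiv ℝ u) (t, z) :=
    (hat.fderiv_right (m := 1) (by norm_num)).differentiableAt (by norm_num)
  have hev : ∀ᶠ q in 𝓝 (t, z), fderivWithin ℝ u (cylinder ε) q = fderiv ℝ u q := by
    filter_upwards [eventually_mem_nhds_iff.2 hnhds] with q hq
    exact fderivWithin_of_mem_nhds hq
  have happ : ∀ v w, fderiv ℝ (fun q => fderiv ℝ u q v) (t, z) w =
      fderiv ℝ (fderiv ℝ u) (t, z) w v := by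
    intro v w
    rw [fderiv_clm_apply hD (differentiableAt_const v)]
    simp
  have hda : ∀ v, DifferentiableAt ℝ (fun q => fderiv ℝ u q v) (t, z) := fun v =>
    hD.clm_apply (differentiableAt_const v)
  have e1 : familyDbar ε u =ᶠ[𝓝 (t, z)] fun q => (1 / 2 : ℂ) • (fderiv ℝ u q (0, 1) +
      Complex.I • fderiv ℝ u q (0, Complex.I)) := by
    filter_upwards [hev] with q hq
    simp only [familyDbar, hq]
  have e2 : timeDeriv ε u =ᶠ[𝓝 (t, z)] fun q => fderiv ℝ u q (1, 0) := by
    filter_upwards [hev] with q hq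
    simp only [timeDeriv, hq]
  have f1 : HasFDerivAt (fun q => (1 / 2 : ℂ) • (fderiv ℝ u q (0, 1) +
      Complex.I • fderiv ℝ u q (0, Complex.I))) ((1 / 2 : ℂ) •
      (fderiv ℝ (fun q => fderiv ℝ u q (0, 1)) (t, z) +
        Complex.I • fderiv ℝ (fun q => fderiv ℝ u q (0, Complex.I)) (t, z))) (t, z) :=
    ((hda _).hasFDerivAt.add ((hda _).hasFDerivAt.const_smul Complex.I)).const_smul (1 / 2 : ℂ)
  simp only [timeDeriv, familyDbar, fderivWithin_of_mem_nhds hnhds]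
  change fderiv ℝ (familyDbar ε u) (t, z) (1, 0) = (1 / 2 : ℂ) •
    (fderiv ℝ (timeDeriv ε u) (t, z) (0, 1) +
      Complex.I • fderiv ℝ (timeDeriv ε u) (t, z) (0, Complex.I))
  rw [e1.fderiv_eq, e2.fderiv_eq, f1.fderiv]
  simp only [smul_apply, add_apply, happ]
  rw [hsymm.eq (1, 0) (0, 1), hsymm.eq (1, 0) (0, Complex.I)]

end Cylinder

/-! ### First and second variation of the ∂̄-energy. -/

section Energy

variable {n : ℕ} {N : Set (Cn n)} {f : ℂ → Cn n} {ε : ℝ} {F : ℝ → ℂ → Cn n} {m : ℕ∞}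

theorem exp_mem_sphere (θ : ℝ) : Complex.exp (θ * Complex.I) ∈ sphere (0 : ℂ) 1 := by
  simp [Complex.norm_exp_ofReal_mul_I]

theorem circleInt_congr {E : Type*} [NormedAddCommGroup E] [NormedSpace ℝ E] {u v : ℂ → E}
    (h : EqOn u v (sphere 0 1)) : circleInt u = circleInt v := by
  simp only [circleInt]
  exact intervalIntegral.integral_congr fun θ _ => h (exp_mem_sphere θ)

theorem circleInt_re {u : ℂ → ℂ} (hu : ContinuousOn u (sphere 0 1)) :
    (circleInt u).re = circleInt fun z => (u z).re := by
  have h := (circleInt_continuousOn hu).intervalIntegrable (μ := volume) (-Real.pi) Real.pi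
  exact ((Complex.reCLM.intervalIntegral_comp_comm h)).symm

theorem setIntegral_re {u : ℂ → ℂ} (hu : ContinuousOn u (closedBall (0 : ℂ) 1)) :
    (∫ z in ball (0 : ℂ) 1, u z).re = ∫ z in ball (0 : ℂ) 1, (u z).re := by
  have h := (hu.integrableOn_compact (isCompact_closedBall 0 1) (μ := volume)).mono_set
    ball_subset_closedBall
  exact (Complex.reCLM.integral_comp_comm h).symm

theorem integrableOn_disk {E : Type*} [NormedAddCommGroup E] {u : ℂ → E}
    (hu : ContinuousOn u (closedBall (0 : ℂ) 1)) : IntegrableOn u (ball (0 : ℂ) 1) :=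
  (hu.integrableOn_compact (isCompact_closedBall 0 1)).mono_set ball_subset_closedBall

theorem hasDerivAt_circleInt {Φ Φ' : ℝ → ℂ → ℝ}
    (hd : ∀ t ∈ Ioo (-ε) ε, ∀ z ∈ sphere (0 : ℂ) 1, HasDerivAt (fun t => Φ t z) (Φ' t z) t)
    (hc : ContinuousOn (fun q : ℝ × ℂ => Φ q.1 q.2) (cylinder ε))
    (hc' : ContinuousOn (fun q : ℝ × ℂ => Φ' q.1 q.2) (cylinder ε))
    {t₀ : ℝ} (ht₀ : t₀ ∈ Ioo (-ε) ε) :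
    HasDerivAt (fun t => circleInt (Φ t)) (circleInt (Φ' t₀)) t₀ := by
  simp only [circleInt, intervalIntegral.integral_of_le (by linarith [Real.pi_pos] :
    -Real.pi ≤ Real.pi)]
  have hmaps : MapsTo (fun q : ℝ × ℝ => (q.1, Complex.exp (q.2 * Complex.I)))
      (Ioo (-ε) ε ×ˢ Icc (-Real.pi) Real.pi) (cylinder ε) := fun q hq =>
    ⟨hq.1, sphere_subset_closedBall (exp_mem_sphere q.2)⟩
  exact hasDerivAt_setIntegral (K := Icc (-Real.pi) Real.pi)
    (Φ := fun t θ => Φ t (Complex.exp (θ * Complex.I)))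
    (Φ' := fun t θ => Φ' t (Complex.exp (θ * Complex.I))) isCompact_Icc
    measurableSet_Ioc Ioc_subset_Icc_self (fun t ht θ _ => hd t ht _ (exp_mem_sphere θ))
    (hc.comp (by fun_prop) hmaps) (hc'.comp (by fun_prop) hmaps) ht₀

/-- The pairing of the `∂̄`-derivative of `f` with a field along the boundary which is the boundary
term of the first variation of the `∂̄`-energy. -/
def bdryPairing (f : ℂ → Cn n) (V : ℂ → Cn n) (z : ℂ) : ℝ :=
  (z * inner ℂ (dbarOn f z) (V z)).re

theorem dbarEnergy_eq (f : ℂ → Cn n) :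
    dbarEnergy f = ∫ z in ball (0 : ℂ) 1, ‖dbarOn f z‖ ^ 2 :=
  setIntegral_congr_fun measurableSet_ball fun z hz => by simp only [dbarOn_eq_dbar f hz]

theorem norm_sq_eq_add (x y : Cn n) :
    ‖y‖ ^ 2 = ‖x‖ ^ 2 + 2 * (inner ℂ x (y - x)).re + ‖y - x‖ ^ 2 := by
  have h := norm_add_sq (𝕜 := ℂ) x (y - x)
  rwa [add_sub_cancel] at h

/-- Expand the square about ∂̄f and integrate the linear term by parts. The linear terms then
contain no derivative of g, and ∂̄g enters only through a square vanishing to second order at g = f;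
two t-derivatives at 0 therefore require only a C² family. -/
theorem dbarEnergy_eq_add (hf : ContDiffOn ℝ 2 f (closedBall 0 1)) {g : ℂ → Cn n}
    (hg : ContDiffOn ℝ 2 g (closedBall 0 1)) :
    dbarEnergy g = dbarEnergy f + circleInt (bdryPairing f (fun z => g z - f z)) -
      2 * (∫ z in ball (0 : ℂ) 1, (inner ℂ (delOn (dbarOn f) z) (g z - f z)).re) +
      ∫ z in ball (0 : ℂ) 1, ‖dbarOn g z - dbarOn f z‖ ^ 2 := by
  have hdf : ContDiffOn ℝ 1 (dbarOn f) (closedBall 0 1) := contDiffOn_dbarOn hf (by norm_num)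
  have hdg : ContDiffOn ℝ 1 (dbarOn g) (closedBall 0 1) := contDiffOn_dbarOn hg (by norm_num)
  have hgf : ContDiffOn ℝ 2 (fun z => g z - f z) (closedBall 0 1) := hg.sub hf
  have hsub : ∀ z ∈ closedBall (0 : ℂ) 1, dbarOn (fun z => g z - f z) z =
      dbarOn g z - dbarOn f z := by
    intro z hz
    simp only [dbarOn]
    rw [fderivWithin_fun_sub (uniqueDiffOn_closedDisk z hz) (hg.differentiableOn (by norm_num) z hz)
      (hf.differentiableOn (by norm_num) z hz)]
    simp only [sub_apply, smul_sub, smul_add]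
    abel
  have hc1 : ContinuousOn (fun z => inner ℂ (dbarOn f z) (dbarOn g z - dbarOn f z))
      (closedBall (0 : ℂ) 1) := hdf.continuousOn.inner (hdg.continuousOn.sub hdf.continuousOn)
  have hc2 : ContinuousOn (fun z => inner ℂ (delOn (dbarOn f) z) (g z - f z))
      (closedBall (0 : ℂ) 1) := (contDiffOn_delOn (k := 0) hdf (by norm_num)).continuousOn.inner
      hgf.continuousOn
  have hc3 : ContinuousOn (fun z => z * inner ℂ (dbarOn f z) (g z - f z)) (sphere (0 : ℂ) 1) :=
    (continuousOn_id.mul (hdf.continuousOn.inner hgf.continuousOn)).mono sphere_subset_closedBall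
  have hgreen := integral_inner_dbarOn hdf (hgf.of_le (by norm_num))
  have hre := congrArg Complex.re hgreen
  rw [Complex.sub_re, show (1 / 2 : ℂ) = ((1 / 2 : ℝ) : ℂ) by norm_num, Complex.re_ofReal_mul,
    setIntegral_re hc2, circleInt_re hc3, setIntegral_congr_fun measurableSet_ball (fun z hz =>
      congrArg (inner ℂ (dbarOn f z)) (hsub z (ball_subset_closedBall hz))),
    setIntegral_re hc1] at hre
  have hi1 : IntegrableOn (fun z => ‖dbarOn f z‖ ^ 2) (ball (0 : ℂ) 1) :=
    integrableOn_disk (hdf.continuousOn.norm.pow 2)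
  have hi2 : IntegrableOn (fun z => 2 * (inner ℂ (dbarOn f z) (dbarOn g z - dbarOn f z)).re)
      (ball (0 : ℂ) 1) :=
    integrableOn_disk (continuousOn_const.mul (Complex.continuous_re.comp_continuousOn hc1))
  have hi3 : IntegrableOn (fun z => ‖dbarOn g z - dbarOn f z‖ ^ 2) (ball (0 : ℂ) 1) :=
    integrableOn_disk ((hdg.continuousOn.sub hdf.continuousOn).norm.pow 2)
  rw [dbarEnergy_eq, dbarEnergy_eq, setIntegral_congr_fun measurableSet_ball (fun z _ =>
    norm_sq_eq_add (dbarOn f z) (dbarOn g z)), integral_add (hi1.fun_add hi2) hi3,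
    integral_add hi1 hi2, integral_const_mul, hre]
  unfold bdryPairing
  ring

variable (hm : 2 ≤ m) (hf : IsDisk N f) (hF : IsVariation m N f ε F)

include hm hF in
theorem IsVariation.contDiffOn_two :
    ContDiffOn ℝ 2 (fun q : ℝ × ℂ => F q.1 q.2) (cylinder ε) :=
  hF.contDiffOn.of_le (WithTop.coe_le_coe.2 hm)

include hm hF in
theorem IsVariation.hasDerivAt {t : ℝ} {z : ℂ}
    (ht : t ∈ Ioo (-ε) ε) (hz : z ∈ closedBall (0 : ℂ) 1) :
    HasDerivAt (fun t => F t z) (timeDeriv ε (fun q => F q.1 q.2) (t, z)) t :=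
  hasDerivAt_timeDeriv ((hF.contDiffOn_two hm).differentiableOn (by norm_num)) ht hz

include hm hF in
theorem IsVariation.hasDerivAt_timeDeriv {t : ℝ} {z : ℂ}
    (ht : t ∈ Ioo (-ε) ε) (hz : z ∈ closedBall (0 : ℂ) 1) :
    HasDerivAt (fun t => timeDeriv ε (fun q => F q.1 q.2) (t, z))
      (timeDeriv ε (timeDeriv ε (fun q => F q.1 q.2)) (t, z)) t :=
  DbarDisk.hasDerivAt_timeDeriv ((contDiffOn_timeDeriv (k := 1) (hF.contDiffOn_two hm)
    (by norm_num)).differentiableOn (by norm_num)) ht hz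

theorem dbarOn_congr {f g : ℂ → Cn n} (h : EqOn f g (closedBall 0 1)) {z : ℂ}
    (hz : z ∈ closedBall (0 : ℂ) 1) : dbarOn f z = dbarOn g z := by
  simp only [dbarOn, fderivWithin_congr h (h hz)]

include hm hF in
theorem IsVariation.dbarOn_eq {t : ℝ} {z : ℂ} (ht : t ∈ Ioo (-ε) ε)
    (hz : z ∈ closedBall (0 : ℂ) 1) :
    dbarOn (F t) z = familyDbar ε (fun q => F q.1 q.2) (t, z) :=
  dbarOn_slice (u := fun q : ℝ × ℂ => F q.1 q.2)
    ((hF.contDiffOn_two hm).differentiableOn (by norm_num)) ht hz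

theorem continuousOn_pairing {h : ℂ → Cn n} (hh : ContinuousOn h (closedBall 0 1))
    {u : ℝ × ℂ → Cn n} (hu : ContinuousOn u (cylinder ε)) :
    ContinuousOn (fun q : ℝ × ℂ => inner ℂ (h q.2) (u q)) (cylinder ε) :=
  (hh.comp continuousOn_snd fun _ hq => hq.2).inner hu

theorem hasDerivAt_re_inner {y : ℝ → Cn n} {y' : Cn n} {t : ℝ} (w : ℂ) (x : Cn n)
    (h : HasDerivAt y y' t) :
    HasDerivAt (fun t => (w * inner ℂ x (y t)).re) (w * inner ℂ x y').re t := by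
  have h1 : HasDerivAt (fun t => w * inner ℂ x (y t)) (w * inner ℂ x y') t := by
    simpa using ((hasDerivAt_const t x).inner ℂ h).const_mul w
  exact Complex.reCLM.hasFDerivAt.comp_hasDerivAt t h1

theorem hasDerivAt_norm_sq_sub {y : ℝ → Cn n} {y' : Cn n} {t : ℝ} (x : Cn n)
    (h : HasDerivAt y y' t) :
    HasDerivAt (fun t => ‖y t - x‖ ^ 2) (2 * (inner ℂ y' (y t - x)).re) t := by
  have h0 := h.sub_const x
  have h1 := Complex.reCLM.hasFDerivAt.comp_hasDerivAt t (h0.inner ℂ h0)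
  refine (h1.congr_of_eventuallyEq (Eventually.of_forall fun s => ?_)).congr_deriv ?_
  · simp only [Function.comp_apply, Complex.reCLM_apply]
    rw [inner_self_eq_norm_sq_to_K]; norm_cast
  · simp only [Complex.reCLM_apply, Complex.add_re]
    rw [← inner_conj_symm (y t - x) y', Complex.conj_re]; ring

include hm hf hF in
-- The formula is needed for all small t, so that it can be differentiated once more at 0. Its last
-- term carries the factor ∂̄F_t − ∂̄f, zero at t = 0.
theorem IsVariation.hasDerivAt_dbarEnergy {t : ℝ} (ht : t ∈ Ioo (-ε) ε) :
    HasDerivAt (fun t => dbarEnergy (F t))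
      (circleInt (bdryPairing f fun z => timeDeriv ε (fun q => F q.1 q.2) (t, z)) -
        2 * (∫ z in ball (0 : ℂ) 1,
          (inner ℂ (delOn (dbarOn f) z) (timeDeriv ε (fun q => F q.1 q.2) (t, z))).re) +
        2 * ∫ z in ball (0 : ℂ) 1,
          (inner ℂ (timeDeriv ε (familyDbar ε fun q => F q.1 q.2) (t, z))
            (familyDbar ε (fun q => F q.1 q.2) (t, z) - dbarOn f z)).re) t := by
  have hu := hF.contDiffOn_two hm
  set u : ℝ × ℂ → Cn n := fun q => F q.1 q.2 with hudef
  have hf2 : ContDiffOn ℝ 2 f (closedBall 0 1) := hf.smooth.of_le (WithTop.coe_le_coe.2 le_top)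
  have hdf : ContDiffOn ℝ 1 (dbarOn f) (closedBall 0 1) := contDiffOn_dbarOn hf2 (by norm_num)
  have hddf : ContinuousOn (delOn (dbarOn f)) (closedBall 0 1) :=
    (contDiffOn_delOn (k := 0) hdf (by norm_num)).continuousOn
  have hB : ContDiffOn ℝ 1 (familyDbar ε u) (cylinder ε) := contDiffOn_familyDbar hu (by norm_num)
  have hT : ContinuousOn (timeDeriv ε u) (cylinder ε) :=
    (contDiffOn_timeDeriv (k := 1) hu (by norm_num)).continuousOn
  have hTB : ContinuousOn (timeDeriv ε (familyDbar ε u)) (cylinder ε) :=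
    (contDiffOn_timeDeriv (k := 0) hB (by norm_num)).continuousOn
  have hfc : ContinuousOn (fun q : ℝ × ℂ => f q.2) (cylinder ε) :=
    hf2.continuousOn.comp continuousOn_snd fun _ hq => hq.2
  have hdfc : ContinuousOn (fun q : ℝ × ℂ => dbarOn f q.2) (cylinder ε) :=
    hdf.continuousOn.comp continuousOn_snd fun _ hq => hq.2
  have hG : ContinuousOn (fun q : ℝ × ℂ => F q.1 q.2 - f q.2) (cylinder ε) :=
    hu.continuousOn.sub hfc
  have hFd : ∀ s ∈ Ioo (-ε) ε, ∀ z ∈ closedBall (0 : ℂ) 1,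
      HasDerivAt (fun s => F s z - f z) (timeDeriv ε u (s, z)) s := fun s hs z hz =>
    (hF.hasDerivAt hm hs hz).sub_const (f z)
  have d1 := hasDerivAt_circleInt (Φ := fun s => bdryPairing f fun z => F s z - f z)
    (Φ' := fun s => bdryPairing f fun z => timeDeriv ε u (s, z))
    (fun s hs z hz => hasDerivAt_re_inner z (dbarOn f z) (hFd s hs z (sphere_subset_closedBall hz)))
    (Complex.continuous_re.comp_continuousOn
      (continuousOn_snd.mul (continuousOn_pairing hdf.continuousOn hG)))
    (Complex.continuous_re.comp_continuousOn
      (continuousOn_snd.mul (continuousOn_pairing hdf.continuousOn hT))) ht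
  have d2 := hasDerivAt_setIntegral (ν := (volume : Measure ℂ)) (isCompact_closedBall (0 : ℂ) 1)
    measurableSet_ball ball_subset_closedBall
    (Φ := fun s z => (inner ℂ (delOn (dbarOn f) z) (F s z - f z)).re)
    (Φ' := fun s z => (inner ℂ (delOn (dbarOn f) z) (timeDeriv ε u (s, z))).re)
    (fun s hs z hz => by simpa using hasDerivAt_re_inner 1 (delOn (dbarOn f) z) (hFd s hs z hz))
    (Complex.continuous_re.comp_continuousOn (continuousOn_pairing hddf hG))
    (Complex.continuous_re.comp_continuousOn (continuousOn_pairing hddf hT)) ht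
  have d3 := hasDerivAt_setIntegral (ν := (volume : Measure ℂ)) (isCompact_closedBall (0 : ℂ) 1)
    measurableSet_ball ball_subset_closedBall
    (Φ := fun s z => ‖familyDbar ε u (s, z) - dbarOn f z‖ ^ 2)
    (Φ' := fun s z => 2 * (inner ℂ (timeDeriv ε (familyDbar ε u) (s, z))
      (familyDbar ε u (s, z) - dbarOn f z)).re)
    (fun s hs z hz => hasDerivAt_norm_sq_sub (dbarOn f z)
      (DbarDisk.hasDerivAt_timeDeriv (hB.differentiableOn (by norm_num)) hs hz))
    ((hB.continuousOn.sub hdfc).norm.pow 2)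
    (continuousOn_const.mul (Complex.continuous_re.comp_continuousOn
      (hTB.inner (hB.continuousOn.sub hdfc)))) ht
  rw [integral_const_mul] at d3
  refine (((d1.const_add (dbarEnergy f)).sub (d2.const_mul 2)).add d3).congr_of_eventuallyEq ?_
  filter_upwards [isOpen_Ioo.mem_nhds ht] with s hs
  have hFs : ContDiffOn ℝ 2 (F s) (closedBall 0 1) :=
    hu.comp (f := fun z : ℂ => (s, z)) (by fun_prop) fun z hz => ⟨hs, hz⟩
  rw [dbarEnergy_eq_add hf2 hFs, setIntegral_congr_fun (μ := volume) measurableSet_ball fun z hz =>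
    show ‖dbarOn (F s) z - dbarOn f z‖ ^ 2 = ‖familyDbar ε u (s, z) - dbarOn f z‖ ^ 2 by
      rw [hF.dbarOn_eq hm hs (ball_subset_closedBall hz)]]
  rfl

include hm hF in
theorem IsVariation.familyDbar_zero {z : ℂ} (hz : z ∈ closedBall (0 : ℂ) 1) :
    familyDbar ε (fun q => F q.1 q.2) (0, z) = dbarOn f z := by
  have h0 : (0 : ℝ) ∈ Ioo (-ε) ε := ⟨by linarith [hF.pos], hF.pos⟩
  rw [← hF.dbarOn_eq hm h0 hz, dbarOn_congr hF.initial hz]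

include hm hf hF in
/-- The first variation of the `∂̄`-energy. -/
theorem IsVariation.first_variation :
    HasDerivAt (fun t => dbarEnergy (F t))
      (circleInt (bdryPairing f fun z => deriv (fun t => F t z) 0) -
        2 * ∫ z in ball (0 : ℂ) 1,
          (inner ℂ (delOn (dbarOn f) z) (deriv (fun t => F t z) 0)).re) 0 := by
  have h0 : (0 : ℝ) ∈ Ioo (-ε) ε := ⟨by linarith [hF.pos], hF.pos⟩
  have hT : ∀ z ∈ closedBall (0 : ℂ) 1, timeDeriv ε (fun q => F q.1 q.2) (0, z) =
      deriv (fun t => F t z) 0 := fun z hz => (hF.hasDerivAt hm h0 hz).deriv.symm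
  refine (hF.hasDerivAt_dbarEnergy hm hf h0).congr_deriv ?_
  rw [setIntegral_congr_fun (μ := volume) measurableSet_ball fun z hz =>
    show (inner ℂ (timeDeriv ε (familyDbar ε fun q => F q.1 q.2) (0, z))
      (familyDbar ε (fun q => F q.1 q.2) (0, z) - dbarOn f z)).re = 0 by
      rw [hF.familyDbar_zero hm (ball_subset_closedBall hz)]; simp,
    setIntegral_congr_fun (μ := volume) measurableSet_ball fun z hz =>
      show (inner ℂ (delOn (dbarOn f) z) (timeDeriv ε (fun q => F q.1 q.2) (0, z))).re = _ by
        rw [hT z (ball_subset_closedBall hz)],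
    circleInt_congr (v := bdryPairing f fun z => deriv (fun t => F t z) 0) fun z hz => by
      simp only [bdryPairing, hT z (sphere_subset_closedBall hz)]]
  simp

include hm hf hF in
/-- The second variation of the `∂̄`-energy at a harmonic map. -/
theorem IsVariation.second_variation
    (hharm : ∀ z ∈ ball (0 : ℂ) 1, delOn (dbarOn f) z = 0) :
    deriv (deriv fun t => dbarEnergy (F t)) 0 =
      circleInt (bdryPairing f fun z => deriv (deriv fun t => F t z) 0) +
        2 * ∫ z in ball (0 : ℂ) 1, ‖dbarOn (fun z => deriv (fun t => F t z) 0) z‖ ^ 2 := by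
  have h0 : (0 : ℝ) ∈ Ioo (-ε) ε := ⟨by linarith [hF.pos], hF.pos⟩
  have hu := hF.contDiffOn_two hm
  have hE := fun t ht => hF.hasDerivAt_dbarEnergy hm hf (t := t) ht
  have hFd := fun t ht z hz => hF.hasDerivAt hm (t := t) (z := z) ht hz
  have hFdd := fun t ht z hz => hF.hasDerivAt_timeDeriv hm (t := t) (z := z) ht hz
  have hB0 := fun z hz => hF.familyDbar_zero hm (z := z) hz
  set u : ℝ × ℂ → Cn n := fun q => F q.1 q.2 with hudef
  have hf2 : ContDiffOn ℝ 2 f (closedBall 0 1) := hf.smooth.of_le (WithTop.coe_le_coe.2 le_top)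
  have hdf : ContDiffOn ℝ 1 (dbarOn f) (closedBall 0 1) := contDiffOn_dbarOn hf2 (by norm_num)
  have hB : ContDiffOn ℝ 1 (familyDbar ε u) (cylinder ε) := contDiffOn_familyDbar hu (by norm_num)
  have hT : ContDiffOn ℝ 1 (timeDeriv ε u) (cylinder ε) :=
    contDiffOn_timeDeriv hu (by norm_num)
  have hTT : ContinuousOn (timeDeriv ε (timeDeriv ε u)) (cylinder ε) :=
    (contDiffOn_timeDeriv (k := 0) hT (by norm_num)).continuousOn
  have hTB : ContinuousOn (timeDeriv ε (familyDbar ε u)) (cylinder ε) :=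
    (contDiffOn_timeDeriv (k := 0) hB (by norm_num)).continuousOn
  have hdfc : ContinuousOn (fun q : ℝ × ℂ => dbarOn f q.2) (cylinder ε) :=
    hdf.continuousOn.comp continuousOn_snd fun _ hq => hq.2
  have d1 := hasDerivAt_circleInt (Φ := fun s => bdryPairing f fun z => timeDeriv ε u (s, z))
    (Φ' := fun s => bdryPairing f fun z => timeDeriv ε (timeDeriv ε u) (s, z))
    (fun s hs z hz => hasDerivAt_re_inner z (dbarOn f z) (hFdd s hs z (sphere_subset_closedBall hz)))
    (Complex.continuous_re.comp_continuousOn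
      (continuousOn_snd.mul (continuousOn_pairing hdf.continuousOn hT.continuousOn)))
    (Complex.continuous_re.comp_continuousOn
      (continuousOn_snd.mul (continuousOn_pairing hdf.continuousOn hTT))) h0
  have d2 := hasDerivAt_setIntegral_inner (ν := (volume : Measure ℂ)) hF.pos
    (isCompact_closedBall (0 : ℂ) 1) measurableSet_ball ball_subset_closedBall
    (a := fun s z => timeDeriv ε (familyDbar ε u) (s, z))
    (b := fun s z => familyDbar ε u (s, z) - dbarOn f z)
    (fun s hs z hz => (DbarDisk.hasDerivAt_timeDeriv
      (hB.differentiableOn (by norm_num)) hs hz).sub_const _)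
    hTB (hB.continuousOn.sub hdfc) (fun z hz => by rw [hB0 z hz, sub_self])
  -- Harmonicity removes the interior linear term for every t.
  have hev : deriv (fun t => dbarEnergy (F t)) =ᶠ[𝓝 0] fun t =>
      circleInt (bdryPairing f fun z => timeDeriv ε u (t, z)) +
        2 * ∫ z in ball (0 : ℂ) 1, (inner ℂ (timeDeriv ε (familyDbar ε u) (t, z))
            (familyDbar ε u (t, z) - dbarOn f z)).re := by
    filter_upwards [isOpen_Ioo.mem_nhds h0] with t ht
    rw [(hE t ht).deriv, setIntegral_congr_fun (μ := volume) measurableSet_ball fun z hz =>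
      show (inner ℂ (delOn (dbarOn f) z) (timeDeriv ε u (t, z))).re = 0 by
        rw [hharm z hz]; simp]
    simp
  rw [hev.deriv_eq, (d1.fun_add (d2.const_mul 2)).deriv]
  have hV : ∀ z ∈ closedBall (0 : ℂ) 1, deriv (fun t => F t z) 0 = timeDeriv ε u (0, z) :=
    fun z hz => (hFd 0 h0 z hz).deriv
  congr 1
  · refine circleInt_congr fun z hz => ?_
    have hz := sphere_subset_closedBall hz
    have : deriv (fun t => F t z) =ᶠ[𝓝 0] fun t => timeDeriv ε u (t, z) := by
      filter_upwards [isOpen_Ioo.mem_nhds h0] with t ht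
      exact (hFd t ht z hz).deriv
    simp only [bdryPairing, this.deriv_eq, (hFdd 0 h0 z hz).deriv]
  · congr 1
    refine setIntegral_congr_fun measurableSet_ball fun z hz => ?_
    rw [timeDeriv_familyDbar hu h0 hz, dbarOn_congr hV (ball_subset_closedBall hz),
      ← dbarOn_slice (hT.differentiableOn (by norm_num)) h0 (ball_subset_closedBall hz)]

end Energy

/-! ### Cutoff functions in a boundary layer. -/

section Cutoff

/-- A cutoff function on the disk, equal to `1` where `1 - |z|² ≤ δ` and to `0` where
`1 - |z|² ≥ 2δ`. -/
def cutoff (δ : ℝ) (z : ℂ) : ℝ := Real.smoothTransition (2 - (1 - ‖z‖ ^ 2) / δ)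

theorem contDiff_cutoff (δ : ℝ) : ContDiff ℝ ∞ (cutoff δ) :=
  Real.smoothTransition.contDiff.comp (contDiff_const.sub
    ((contDiff_const.sub (contDiff_norm_sq ℝ)).div_const δ))

theorem cutoff_eq_zero {δ : ℝ} (hδ : 0 < δ) {z : ℂ} (h : 2 * δ ≤ 1 - ‖z‖ ^ 2) :
    cutoff δ z = 0 := by
  apply Real.smoothTransition.zero_of_nonpos
  have : 2 ≤ (1 - ‖z‖ ^ 2) / δ := by rwa [le_div_iff₀ hδ]
  linarith

theorem cutoff_eq_one {δ : ℝ} (hδ : 0 < δ) {z : ℂ} (h : 1 - ‖z‖ ^ 2 ≤ δ) :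
    cutoff δ z = 1 := by
  apply Real.smoothTransition.one_of_one_le
  have : (1 - ‖z‖ ^ 2) / δ ≤ 1 := by rwa [div_le_one hδ]
  linarith

end Cutoff

/-! ### Harmonicity and the natural boundary condition at a critical disk. -/

section Critical

variable {n : ℕ} {N : Set (Cn n)} {f X V : ℂ → Cn n} {m : ℕ∞} {ρ : Cn n → ℝ} {r₀ δ : ℝ}

/-- The multiple of the transverse field `X` by which `V` differs from a field along which `ρ` is
infinitesimally constant. -/
def transverseCoeff (ρ : Cn n → ℝ) (f X V : ℂ → Cn n) (z : ℂ) : ℝ :=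
  fderiv ℝ ρ (f z) (V z) / fderiv ℝ ρ (f z) (X z)

theorem exists_pos_of_ne_zero {E : Type*} [NormedAddCommGroup E] [NormedSpace ℝ E]
    {L : E →L[ℝ] ℝ} (hL : L ≠ 0) : ∃ v, 0 < L v := by
  obtain ⟨v, hv⟩ := DFunLike.exists_ne hL
  rcases lt_or_gt_of_ne hv with h | h
  · exact ⟨-v, by simpa using h⟩
  · exact ⟨v, h⟩

/-- A smooth field transverse to the boundary along a disk. -/
theorem exists_transverse (hm : 2 ≤ m) (hρ : IsDefiningFunction m ρ N) (hf : IsDisk N f) :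
    ∃ X : ℂ → Cn n, ContDiff ℝ ∞ X ∧ ∃ r₀ : ℝ, 0 ≤ r₀ ∧ r₀ < 1 ∧
      ∀ z ∈ closedBall (0 : ℂ) 1, r₀ ≤ ‖z‖ → 0 < fderiv ℝ ρ (f z) (X z) := by
  have hmo : (m : ℕ∞ω) ≠ 0 := by
    have : m ≠ 0 := by rintro rfl; exact absurd hm (by decide)
    exact_mod_cast this
  have hc : ContinuousOn (fun z => fderiv ℝ ρ (f z)) (closedBall (0 : ℂ) 1) :=
    (hρ.contDiff.continuous_fderiv hmo).comp_continuousOn hf.smooth.continuousOn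
  -- Positivity of dρ(v) is a convex condition on v and, by continuity along the circle, holds for a
  -- constant v near each point; a partition of unity glues these choices.
  obtain ⟨X, hX⟩ := exists_contMDiffMap_forall_mem_convex_of_local_const
    (modelWithCornersSelf ℝ ℂ) (n := ⊤)
    (t := fun z : ℂ => {v : Cn n | z ∈ sphere (0 : ℂ) 1 → 0 < fderiv ℝ ρ (f z) v})
    (fun z v hv w hw a b ha hb hab hz => by
      have h1 := hv hz
      have h2 := hw hz
      rw [map_add, map_smul, map_smul, smul_eq_mul, smul_eq_mul]
      rcases eq_or_lt_of_le ha with rfl | ha'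
      · obtain rfl : b = 1 := by linarith
        simpa using h2
      · exact add_pos_of_pos_of_nonneg (mul_pos ha' h1) (mul_nonneg hb h2.le))
    (fun z => by
      by_cases hz : z ∈ sphere (0 : ℂ) 1
      · obtain ⟨v, hv⟩ := exists_pos_of_ne_zero (hρ.fderiv_ne_zero _ (hf.mapsTo_boundary hz))
        refine ⟨v, ?_⟩
        have h1 : ContinuousWithinAt (fun z => fderiv ℝ ρ (f z) v) (closedBall (0 : ℂ) 1) z :=
          (hc.clm_apply continuousOn_const) z (sphere_subset_closedBall hz)
        have h2 := eventually_nhdsWithin_iff.1 (h1.eventually (lt_mem_nhds hv))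
        filter_upwards [h2] with y hy hys
        exact hy (sphere_subset_closedBall hys)
      · refine ⟨0, ?_⟩
        filter_upwards [isClosed_sphere.isOpen_compl.mem_nhds hz] with y hy hys
        exact absurd hys hy)
  have hXs : ContDiff ℝ ∞ X := X.contMDiff.contDiff
  refine ⟨X, hXs, ?_⟩
  have hp : ContinuousOn (fun z => fderiv ℝ ρ (f z) (X z)) (closedBall (0 : ℂ) 1) :=
    hc.clm_apply hXs.continuous.continuousOn
  let B : Set ℂ := closedBall (0 : ℂ) 1 ∩ (fun z => fderiv ℝ ρ (f z) (X z)) ⁻¹' Iic 0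
  have hB : IsCompact B := (isCompact_closedBall (0 : ℂ) 1).of_isClosed_subset
    (hp.preimage_isClosed_of_isClosed isClosed_closedBall isClosed_Iic) inter_subset_left
  rcases B.eq_empty_or_nonempty with h | h
  · refine ⟨0, le_rfl, one_pos, fun z hz _ => ?_⟩
    by_contra hcon
    have : z ∈ B := ⟨hz, not_lt.1 hcon⟩
    rw [h] at this
    exact this
  · obtain ⟨w, hw, hmax⟩ := hB.exists_isMaxOn h continuous_norm.continuousOn
    have hw1 : ‖w‖ < 1 := by
      refine lt_of_le_of_ne (mem_closedBall_zero_iff.1 hw.1) fun h1 => ?_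
      exact absurd (hX w (mem_sphere_zero_iff_norm.2 h1)) (not_lt.2 hw.2)
    -- w is a point of largest modulus where transversality fails; any radius strictly between |w|
    -- and 1 would do.
    refine ⟨(‖w‖ + 1) / 2, by positivity, by linarith, fun z hz hz' => ?_⟩
    by_contra hcon
    have : ‖z‖ ≤ ‖w‖ := hmax ⟨hz, not_lt.1 hcon⟩
    linarith

/-- `X` is a smooth field along the disk `f`, transverse to the level sets of `ρ` where
`r₀ ≤ |z| ≤ 1`. -/
structure IsTransverse (ρ : Cn n → ℝ) (f X : ℂ → Cn n) (r₀ : ℝ) : Prop where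
  contDiff : ContDiff ℝ ∞ X
  nonneg : 0 ≤ r₀
  lt_one : r₀ < 1
  pos : ∀ z ∈ closedBall (0 : ℂ) 1, r₀ ≤ ‖z‖ → 0 < fderiv ℝ ρ (f z) (X z)

theorem IsTransverse.pos_sphere (hX : IsTransverse ρ f X r₀) {z : ℂ} (hz : z ∈ sphere (0 : ℂ) 1) :
    0 < fderiv ℝ ρ (f z) (X z) :=
  hX.pos z (sphere_subset_closedBall hz) (by rw [mem_sphere_zero_iff_norm.1 hz]; exact hX.lt_one.le)

/-- The field of the variation attached to `V`: it agrees with `V` away from the boundary and is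
tangent to the level sets of `ρ` near the boundary. -/
def tangentField (ρ : Cn n → ℝ) (f X : ℂ → Cn n) (δ : ℝ) (V : ℂ → Cn n) (z : ℂ) : Cn n :=
  V z - (cutoff δ z * transverseCoeff ρ f X V z) • X z

variable (hm : 2 ≤ m) (hρ : IsDefiningFunction m ρ N) (hf : IsDisk N f)
  (hX : IsTransverse ρ f X r₀)

include hm hρ hf hX in
theorem exists_variation_tangentField (hV : ContDiffOn ℝ ∞ V (closedBall 0 1)) (hδ : 0 < δ)
    (hδr : 2 * δ < 1 - r₀ ^ 2) :
    ∃ (ε : ℝ) (F : ℝ → ℂ → Cn n), IsVariation m N f ε F ∧ ∀ z ∈ closedBall (0 : ℂ) 1,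
      deriv (fun t => F t z) 0 = tangentField ρ f X δ V z := by
  have h1 : 0 ≤ 1 - 2 * δ := by nlinarith [sq_nonneg r₀]
  -- The thresholds 1 − |z|² = 2δ and 1 − |z|² = δ of the cutoff, written as radii. The bound on δ
  -- puts the layer where X is transverse.
  refine exists_variation hm hρ hf hX.contDiff.contDiffOn hV (contDiff_cutoff δ)
    (r₀ := r₀) (r₁ := √(1 - 2 * δ)) (r₂ := √(1 - δ)) ?_ ?_ hX.pos ?_ ?_
  · exact Real.lt_sqrt_of_sq_lt (by linarith)
  · rw [Real.sqrt_lt' one_pos]; linarith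
  · intro z hz
    refine cutoff_eq_zero hδ ?_
    have := (Real.lt_sqrt (norm_nonneg z)).1 hz
    linarith
  · intro z hz
    refine cutoff_eq_one hδ ?_
    have := (Real.sqrt_le_left (norm_nonneg z)).1 hz
    linarith

include hm hρ hf hX in
theorem first_variation_tangentField (hcrit : IsCritical m N f)
    (hV : ContDiffOn ℝ ∞ V (closedBall 0 1)) (hδ : 0 < δ) (hδr : 2 * δ < 1 - r₀ ^ 2) :
    circleInt (bdryPairing f (tangentField ρ f X δ V)) =
      2 * ∫ z in ball (0 : ℂ) 1, (inner ℂ (delOn (dbarOn f) z) (tangentField ρ f X δ V z)).re := by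
  obtain ⟨ε, F, hF, hFV⟩ := exists_variation_tangentField hm hρ hf hX hV hδ hδr
  have h := (hF.first_variation hm hf).unique (hcrit ε F hF)
  rw [circleInt_congr (v := bdryPairing f (tangentField ρ f X δ V)) fun z hz => by
      simp only [bdryPairing, hFV z (sphere_subset_closedBall hz)],
    setIntegral_congr_fun (μ := volume) measurableSet_ball fun z hz =>
      show (inner ℂ (delOn (dbarOn f) z) (deriv (fun t => F t z) 0)).re = _ by
        rw [hFV z (ball_subset_closedBall hz)]] at h
  linarith

include hf in
theorem IsDisk.contDiffOn_two : ContDiffOn ℝ 2 f (closedBall 0 1) :=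
  hf.smooth.of_le (WithTop.coe_le_coe.2 le_top)

include hf in
theorem IsDisk.contDiffOn_dbarOn : ContDiffOn ℝ ∞ (dbarOn f) (closedBall 0 1) :=
  DbarDisk.contDiffOn_dbarOn hf.smooth (by exact le_rfl)

include hm hρ hf hX in
/-- A critical point of the `∂̄`-energy is harmonic. -/
theorem delOn_dbarOn_eq_zero (hcrit : IsCritical m N f) {z : ℂ} (hz : z ∈ ball (0 : ℂ) 1) :
    delOn (dbarOn f) z = 0 := by
  have hdd : ContinuousOn (delOn (dbarOn f)) (closedBall 0 1) :=
    (contDiffOn_delOn (k := 0) hf.contDiffOn_dbarOn (by simp)).continuousOn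
  have hr0 : 0 < 1 - r₀ ^ 2 := by nlinarith [hX.nonneg, hX.lt_one]
  have key : ∀ w : Cn n, ∀ g : ℂ → ℝ, ContDiff ℝ ∞ g → HasCompactSupport g →
      tsupport g ⊆ ball (0 : ℂ) 1 →
      ∫ z, g z • (inner ℂ (delOn (dbarOn f) z) w).re = 0 := by
    intro w g hg hgc hgs
    obtain ⟨r, hr0', hr1, hgr⟩ : ∃ r, 0 ≤ r ∧ r < 1 ∧ ∀ z, r < ‖z‖ → g z = 0 := by
      rcases (tsupport g).eq_empty_or_nonempty with h | h
      · refine ⟨0, le_rfl, one_pos, fun z _ => image_eq_zero_of_notMem_tsupport (by simp [h])⟩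
      · obtain ⟨a, ha, hmax⟩ := hgc.isCompact.exists_isMaxOn h continuous_norm.continuousOn
        refine ⟨‖a‖, norm_nonneg _, mem_ball_zero_iff.1 (hgs ha), fun z hz => ?_⟩
        exact image_eq_zero_of_notMem_tsupport fun hz' => absurd (hmax hz') (not_le.2 hz)
    let δ := min (1 - r₀ ^ 2) (1 - r ^ 2) / 3
    have hmin : 0 < min (1 - r₀ ^ 2) (1 - r ^ 2) := lt_min hr0 (by nlinarith)
    have hδ : 0 < δ := by positivity
    have hδ1 : 2 * δ < 1 - r₀ ^ 2 := by
      have := min_le_left (1 - r₀ ^ 2) (1 - r ^ 2)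
      simp only [δ]; linarith
    have hδ2 : 2 * δ ≤ 1 - r ^ 2 := by
      have := min_le_right (1 - r₀ ^ 2) (1 - r ^ 2)
      simp only [δ]; linarith
    have hV : ContDiffOn ℝ ∞ (fun z => g z • w) (closedBall 0 1) :=
      (hg.smul contDiff_const).contDiffOn
    -- At every point either g or the cutoff vanishes, so a compactly supported field needs no
    -- correction.
    have hfield : ∀ z, tangentField ρ f X δ (fun z => g z • w) z = g z • w := by
      intro z
      rcases lt_or_ge r ‖z‖ with h | h
      · simp [tangentField, transverseCoeff, hgr z h]
      · have : cutoff δ z = 0 := cutoff_eq_zero hδ (by nlinarith [norm_nonneg z])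
        simp [tangentField, this]
    have h := first_variation_tangentField hm hρ hf hX hcrit hV hδ hδ1
    have hb : circleInt (bdryPairing f (tangentField ρ f X δ fun z => g z • w)) = 0 := by
      rw [circleInt_congr (v := fun _ => (0 : ℝ))]
      · simp [circleInt]
      · intro z hz
        have : g z = 0 := hgr z (by rw [mem_sphere_zero_iff_norm.1 hz]; exact hr1)
        simp [bdryPairing, hfield, this]
    rw [hb] at h
    have h2 : ∫ z in ball (0 : ℂ) 1, g z • (inner ℂ (delOn (dbarOn f) z) w).re = 0 := by
      rw [← (by linarith : ∫ z in ball (0 : ℂ) 1, (inner ℂ (delOn (dbarOn f) z)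
        (tangentField ρ f X δ (fun z => g z • w) z)).re = 0)]
      refine setIntegral_congr_fun measurableSet_ball fun z _ => ?_
      rw [hfield z, ← Complex.coe_smul, inner_smul_right, Complex.re_ofReal_mul, smul_eq_mul]
    rw [← h2, setIntegral_eq_integral_of_forall_compl_eq_zero]
    intro z hz
    rw [image_eq_zero_of_notMem_tsupport fun h => hz (hgs h), zero_smul]
  have hzero : ∀ w : Cn n, (inner ℂ (delOn (dbarOn f) z) w).re = 0 := by
    intro w
    have hcw : ContinuousOn (fun z => (inner ℂ (delOn (dbarOn f) z) w).re) (ball (0 : ℂ) 1) :=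
      Complex.continuous_re.comp_continuousOn
        ((hdd.mono ball_subset_closedBall).inner continuousOn_const)
    have hae := isOpen_ball.ae_eq_zero_of_integral_contDiff_smul_eq_zero (μ := volume)
      (hcw.locallyIntegrableOn measurableSet_ball) (key w)
    have hae' : (fun z => (inner ℂ (delOn (dbarOn f) z) w).re)
        =ᵐ[volume.restrict (ball (0 : ℂ) 1)] fun _ => 0 :=
      (ae_restrict_iff' measurableSet_ball).2 hae
    exact Measure.eqOn_open_of_ae_eq hae' isOpen_ball hcw continuousOn_const hz
  -- Pairing the vector with itself gives its squared norm.
  have := hzero (delOn (dbarOn f) z)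
  rw [← RCLike.re_eq_complex_re, inner_self_eq_norm_sq] at this
  simpa using this

/-- The fundamental lemma of the calculus of variations on the circle: near a point where κ ≠ 0 its
sign is constant, and a bump function there has nonzero integral against κ. -/
theorem eq_zero_of_circleInt_mul {κ : ℂ → ℝ} (hκ : ContinuousOn κ (sphere 0 1))
    (h : ∀ g : ℂ → ℝ, ContDiff ℝ ∞ g → circleInt (fun z => g z * κ z) = 0) {z : ℂ}
    (hz : z ∈ sphere (0 : ℂ) 1) : κ z = 0 := by
  by_contra hne
  have hpos : 0 < κ z * κ z := mul_self_pos.2 hne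
  have hev : ∀ᶠ y in 𝓝[sphere (0 : ℂ) 1] z, 0 < κ y * κ z :=
    ((hκ z hz).mul continuousWithinAt_const).eventually (lt_mem_nhds hpos)
  obtain ⟨r, hr, hrs⟩ := Metric.eventually_nhds_iff_ball.1 (eventually_nhdsWithin_iff.1 hev)
  let g : ContDiffBump z := ⟨r / 2, r, by positivity, by linarith⟩
  have hint : circleInt (fun y => g y * κ y * κ z) = 0 := by
    have h1 := h g g.contDiff
    simp only [circleInt] at h1 ⊢
    rw [intervalIntegral.integral_mul_const, h1, zero_mul]
  have hcont : ContinuousOn (fun y => g y * κ y * κ z) (sphere 0 1) :=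
    (g.continuous.continuousOn.mul hκ).mul continuousOn_const
  have hexp : Complex.exp (z.arg * Complex.I) = z := by
    have := Complex.norm_mul_exp_arg_mul_I z
    rwa [mem_sphere_zero_iff_norm.1 hz, Complex.ofReal_one, one_mul] at this
  have := intervalIntegral.integral_pos (a := -Real.pi) (b := Real.pi)
    (by linarith [Real.pi_pos]) (circleInt_continuousOn hcont).continuousOn
    (fun θ _ => by
      by_cases hb : Complex.exp (θ * Complex.I) ∈ ball z r
      · rw [mul_assoc]
        exact mul_nonneg g.nonneg (hrs _ hb (exp_mem_sphere θ)).le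
      · rw [g.zero_of_le_dist (by simpa using hb)]; simp)
    ⟨z.arg, ⟨(Complex.neg_pi_lt_arg z).le, Complex.arg_le_pi z⟩, by
      rw [hexp, g.one_of_mem_closedBall (mem_closedBall_self g.rIn_pos.le), one_mul]; exact hpos⟩
  exact absurd hint this.ne'

/-- The Lagrange multiplier of the free boundary condition. -/
def multiplier (ρ : Cn n → ℝ) (f X : ℂ → Cn n) (z : ℂ) : ℝ :=
  bdryPairing f X z / fderiv ℝ ρ (f z) (X z)

include hm hρ hf in
theorem continuousOn_fderiv_rho :
    ContinuousOn (fun z => fderiv ℝ ρ (f z)) (closedBall (0 : ℂ) 1) := by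
  have hmo : (m : ℕ∞ω) ≠ 0 := by
    have : m ≠ 0 := by rintro rfl; exact absurd hm (by decide)
    exact_mod_cast this
  exact (hρ.contDiff.continuous_fderiv hmo).comp_continuousOn hf.smooth.continuousOn

include hf in
theorem IsDisk.continuousOn_bdryPairing (hV : ContinuousOn V (closedBall 0 1)) :
    ContinuousOn (bdryPairing f V) (closedBall 0 1) :=
  Complex.continuous_re.comp_continuousOn
    (continuousOn_id.mul (hf.contDiffOn_dbarOn.continuousOn.inner hV))

include hm hρ hf hX in
theorem continuousOn_multiplier : ContinuousOn (multiplier ρ f X) (sphere 0 1) :=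
  ((hf.continuousOn_bdryPairing hX.contDiff.continuous.continuousOn).mono
    sphere_subset_closedBall).div (((continuousOn_fderiv_rho hm hρ hf).clm_apply
      hX.contDiff.continuous.continuousOn).mono sphere_subset_closedBall)
    fun _ hz => (hX.pos_sphere hz).ne'

include hm hρ hf hX in
/-- The natural boundary condition at a critical point of the `∂̄`-energy. -/
theorem bdryPairing_eq (hcrit : IsCritical m N f) {z : ℂ} (hz : z ∈ sphere (0 : ℂ) 1)
    (V : ℂ → Cn n) : bdryPairing f V z = multiplier ρ f X z * fderiv ℝ ρ (f z) (V z) := by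
  set w := V z with hw
  have hr0 : 0 < 1 - r₀ ^ 2 := by nlinarith [hX.nonneg, hX.lt_one]
  have hδ : 0 < (1 - r₀ ^ 2) / 3 := by positivity
  let κ : ℂ → ℝ := fun z => bdryPairing f (fun _ => w) z -
    multiplier ρ f X z * fderiv ℝ ρ (f z) w
  have hκ : ContinuousOn κ (sphere 0 1) :=
    ((hf.continuousOn_bdryPairing continuousOn_const).mono sphere_subset_closedBall).sub
      ((continuousOn_multiplier hm hρ hf hX).mul (((continuousOn_fderiv_rho hm hρ hf).clm_apply
        continuousOn_const).mono sphere_subset_closedBall))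
  have h0 : κ z = 0 := by
    refine eq_zero_of_circleInt_mul hκ (fun g hg => ?_) hz
    -- The test field is g times a constant vector w. On the circle its tangential correction
    -- subtracts exactly the multiple of X that turns the pairing into g κ.
    have h := first_variation_tangentField hm hρ hf hX hcrit (V := fun z => g z • w)
      (hg.smul contDiff_const).contDiffOn hδ (by linarith)
    rw [setIntegral_congr_fun (g := fun _ => (0 : ℝ)) (μ := volume) measurableSet_ball fun z hz => by
      simp only [delOn_dbarOn_eq_zero hm hρ hf hX hcrit hz, inner_zero_left, Complex.zero_re]] at h
    simp only [integral_zero, mul_zero] at h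
    rw [← h]
    refine circleInt_congr fun y hy => ?_
    have hc : cutoff ((1 - r₀ ^ 2) / 3) y = 1 :=
      cutoff_eq_one hδ (by rw [mem_sphere_zero_iff_norm.1 hy]; norm_num; linarith)
    have hp := (hX.pos_sphere hy).ne'
    have hcoe : ∀ (a : ℝ) (v : Cn n), a • v = (a : ℂ) • v := fun a v => (Complex.coe_smul a v).symm
    simp only [κ, bdryPairing, multiplier, tangentField, transverseCoeff, hc, one_mul, map_smul,
      smul_eq_mul]
    simp only [inner_sub_right, hcoe, inner_smul_right, mul_sub, Complex.sub_re]
    rw [mul_left_comm y, mul_left_comm y, Complex.re_ofReal_mul, Complex.re_ofReal_mul]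
    field_simp
  exact sub_eq_zero.1 h0

end Critical

/-! ### Eliminating the acceleration from the second variation. -/

section BoundaryTerm

variable {n : ℕ} {N : Set (Cn n)} {f X V : ℂ → Cn n} {m : ℕ∞} {ρ : Cn n → ℝ} {r₀ δ ε : ℝ}
  {F : ℝ → ℂ → Cn n}
variable (hm : 2 ≤ m) (hρ : IsDefiningFunction m ρ N) (hf : IsDisk N f)
  (hX : IsTransverse ρ f X r₀) (hF : IsVariation m N f ε F)

theorem zero_lt_of_two_le (hm : 2 ≤ m) : (m : ℕ∞ω) ≠ 0 := by
  have : m ≠ 0 := by rintro rfl; exact absurd hm (by decide)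
  exact_mod_cast this

include hm hρ hF in
-- On the circle ρ(F_t(z)) = 0 for all t; differentiate twice.
theorem IsVariation.fderiv_acceleration {z : ℂ} (hz : z ∈ sphere (0 : ℂ) 1) :
    fderiv ℝ ρ (f z) (deriv (deriv fun t => F t z) 0) =
      -fderiv ℝ (fderiv ℝ ρ) (f z) (deriv (fun t => F t z) 0) (deriv (fun t => F t z) 0) := by
  have h0 : (0 : ℝ) ∈ Ioo (-ε) ε := ⟨by linarith [hF.pos], hF.pos⟩
  have hz' := sphere_subset_closedBall hz
  have hρd : Differentiable ℝ ρ := hρ.contDiff.differentiable (zero_lt_of_two_le hm)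
  have hρdd : Differentiable ℝ (fderiv ℝ ρ) :=
    (hρ.contDiff.fderiv_right (m := 1) (WithTop.coe_le_coe.2 hm)).differentiable (by norm_num)
  have hFd := fun t ht => hF.hasDerivAt hm (t := t) ht hz'
  have hFdd := hF.hasDerivAt_timeDeriv hm h0 hz'
  have hF0 : F 0 z = f z := hF.initial hz'
  set T : ℝ → Cn n := fun t => timeDeriv ε (fun q => F q.1 q.2) (t, z) with hT
  have hder : deriv (fun t => F t z) =ᶠ[𝓝 0] T := by
    filter_upwards [isOpen_Ioo.mem_nhds h0] with t ht
    exact (hFd t ht).deriv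
  have hvanish : ∀ t ∈ Ioo (-ε) ε, fderiv ℝ ρ (F t z) (T t) = 0 := by
    intro t ht
    have h1 : HasDerivAt (fun t => ρ (F t z)) (fderiv ℝ ρ (F t z) (T t)) t :=
      hρd.differentiableAt.hasFDerivAt.comp_hasDerivAt t (hFd t ht)
    refine h1.unique ((hasDerivAt_const t (0 : ℝ)).congr_of_eventuallyEq ?_)
    filter_upwards [isOpen_Ioo.mem_nhds ht] with s hs
    exact hρ.eq_zero (hF.mapsTo_boundary s hs hz)
  have h2 : HasDerivAt (fun t => fderiv ℝ ρ (F t z)) (fderiv ℝ (fderiv ℝ ρ) (F 0 z) (T 0)) 0 :=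
    hρdd.differentiableAt.hasFDerivAt.comp_hasDerivAt (0 : ℝ) (hFd 0 h0)
  have h3 := h2.clm_apply hFdd
  have h4 := h3.unique ((hasDerivAt_const (0 : ℝ) (0 : ℝ)).congr_of_eventuallyEq (by
    filter_upwards [isOpen_Ioo.mem_nhds h0] with t ht using hvanish t ht))
  rw [hder.deriv_eq, hder.eq_of_nhds, hFdd.deriv, ← hF0]
  linarith

include hm hρ hf hX hF in
/-- The second variation of the `∂̄`-energy at a critical point. -/
theorem IsVariation.second_variation_eq (hcrit : IsCritical m N f)
    (hV : ∀ z ∈ closedBall (0 : ℂ) 1, deriv (fun t => F t z) 0 = V z) :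
    deriv (deriv fun t => dbarEnergy (F t)) 0 =
      2 * (∫ z in ball (0 : ℂ) 1, ‖dbarOn V z‖ ^ 2) -
        circleInt fun z => multiplier ρ f X z * fderiv ℝ (fderiv ℝ ρ) (f z) (V z) (V z) := by
  rw [hF.second_variation hm hf fun z hz => delOn_dbarOn_eq_zero hm hρ hf hX hcrit hz,
    circleInt_congr (v := fun z => -(multiplier ρ f X z *
      fderiv ℝ (fderiv ℝ ρ) (f z) (V z) (V z))) fun z hz => by
      rw [bdryPairing_eq hm hρ hf hX hcrit hz, hF.fderiv_acceleration hm hρ hz,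
        hV z (sphere_subset_closedBall hz), mul_neg],
    setIntegral_congr_fun (μ := volume) measurableSet_ball fun z hz =>
      show ‖dbarOn (fun z => deriv (fun t => F t z) 0) z‖ ^ 2 = ‖dbarOn V z‖ ^ 2 by
        rw [dbarOn_congr hV (ball_subset_closedBall hz)]]
  simp only [circleInt, intervalIntegral.integral_neg]
  ring

end BoundaryTerm

/-! ### Positivity of the multiplier somewhere on the circle. -/

section PositiveMultiplier

variable {n : ℕ} {N : Set (Cn n)} {f X V : ℂ → Cn n} {m : ℕ∞} {ρ : Cn n → ℝ} {r₀ δ ε : ℝ}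
variable (hm : 2 ≤ m) (hρ : IsDefiningFunction m ρ N) (hf : IsDisk N f)
  (hX : IsTransverse ρ f X r₀)

theorem dbarOn_delOn_comm (hf : ContDiffOn ℝ 2 f (closedBall 0 1)) {z : ℂ}
    (hz : z ∈ ball (0 : ℂ) 1) : dbarOn (delOn f) z = delOn (dbarOn f) z := by
  have hnhds : closedBall (0 : ℂ) 1 ∈ 𝓝 z :=
    mem_of_superset (isOpen_ball.mem_nhds hz) ball_subset_closedBall
  have hat : ContDiffAt ℝ 2 f z := hf.contDiffAt hnhds
  have hsymm : IsSymmSndFDerivAt ℝ f z := hat.isSymmSndFDerivAt (by simp)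
  have hD : DifferentiableAt ℝ (fderiv ℝ f) z :=
    (hat.fderiv_right (m := 1) (by norm_num)).differentiableAt (by norm_num)
  have hev : ∀ᶠ q in 𝓝 z, fderivWithin ℝ f (closedBall 0 1) q = fderiv ℝ f q := by
    filter_upwards [eventually_mem_nhds_iff.2 hnhds] with q hq
    exact fderivWithin_of_mem_nhds hq
  have happ : ∀ v w, fderiv ℝ (fun q => fderiv ℝ f q v) z w = fderiv ℝ (fderiv ℝ f) z w v := by
    intro v w
    rw [fderiv_clm_apply hD (differentiableAt_const v)]
    simp
  have hda : ∀ v, HasFDerivAt (fun q => fderiv ℝ f q v) (fderiv ℝ (fun q => fderiv ℝ f q v) z) z :=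
    fun v => (hD.clm_apply (differentiableAt_const v)).hasFDerivAt
  have e1 : dbarOn f =ᶠ[𝓝 z] fun q => (1 / 2 : ℂ) • (fderiv ℝ f q 1 +
      Complex.I • fderiv ℝ f q Complex.I) := by
    filter_upwards [hev] with q hq
    simp only [dbarOn, hq]
  have e2 : delOn f =ᶠ[𝓝 z] fun q => (1 / 2 : ℂ) • (fderiv ℝ f q 1 -
      Complex.I • fderiv ℝ f q Complex.I) := by
    filter_upwards [hev] with q hq
    simp only [delOn, hq]
  have f1 := ((hda 1).fun_add ((hda Complex.I).fun_const_smul Complex.I)).fun_const_smul (1 / 2 : ℂ)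
  have f2 := ((hda 1).fun_sub ((hda Complex.I).fun_const_smul Complex.I)).fun_const_smul (1 / 2 : ℂ)
  rw [dbarOn, delOn, fderivWithin_of_mem_nhds hnhds, fderivWithin_of_mem_nhds hnhds,
    e1.fderiv_eq, e2.fderiv_eq, f1.fderiv, f2.fderiv]
  simp only [smul_apply, add_apply, sub_apply, happ]
  rw [hsymm.eq 1 Complex.I]
  module

/-- The radial derivative of a map of the closed disk. -/
def radialDeriv (f : ℂ → Cn n) (z : ℂ) : Cn n := fderivWithin ℝ f (closedBall 0 1) z z

theorem radialDeriv_eq (f : ℂ → Cn n) (z : ℂ) :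
    radialDeriv f z = z • delOn f z + (starRingEnd ℂ) z • dbarOn f z := by
  have h : fderivWithin ℝ f (closedBall 0 1) z z =
      (z.re : ℂ) • fderivWithin ℝ f (closedBall 0 1) z 1 +
        (z.im : ℂ) • fderivWithin ℝ f (closedBall 0 1) z Complex.I := by
    have hz : z = z.re • (1 : ℂ) + z.im • Complex.I := by simp
    conv_lhs => rw [hz]
    rw [map_add, map_smul, map_smul, Complex.coe_smul, Complex.coe_smul]
    congr 3 <;> simp
  rw [radialDeriv, h, delOn, dbarOn]
  have h1 : z = z.re + z.im * Complex.I := (Complex.re_add_im z).symm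
  have h2 : (starRingEnd ℂ) z = z.re - z.im * Complex.I := by
    apply Complex.ext <;> simp
  set a := fderivWithin ℝ f (closedBall 0 1) z 1
  set b := fderivWithin ℝ f (closedBall 0 1) z Complex.I
  rw [h2]
  nth_rewrite 3 [h1]
  match_scalars
  · ring
  · ring_nf
    rw [Complex.I_sq]
    ring

include hm hρ hf in
-- ρ∘f is negative inside and zero on the circle, so it has a maximum at z over the closed disk, and
-- its derivative in the inward direction −z is nonpositive.
theorem fderiv_radialDeriv_nonneg {z : ℂ} (hz : z ∈ sphere (0 : ℂ) 1) :
    0 ≤ fderiv ℝ ρ (f z) (radialDeriv f z) := by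
  have hz' := sphere_subset_closedBall hz
  have hρd : Differentiable ℝ ρ := hρ.contDiff.differentiable (zero_lt_of_two_le hm)
  have h1 : HasFDerivWithinAt (fun z => ρ (f z))
      ((fderiv ℝ ρ (f z)).comp (fderivWithin ℝ f (closedBall 0 1) z)) (closedBall 0 1) z :=
    hρd.differentiableAt.hasFDerivAt.comp_hasFDerivWithinAt z
      (hf.smooth.differentiableOn (by simp) z hz').hasFDerivWithinAt
  have hmax : IsLocalMaxOn (fun z => ρ (f z)) (closedBall 0 1) z := by
    refine IsMaxOn.localize fun y hy => ?_
    change ρ (f y) ≤ ρ (f z)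
    rw [hρ.eq_zero (hf.mapsTo_boundary hz)]
    rcases eq_or_lt_of_le (mem_closedBall_zero_iff.1 hy) with h | h
    · exact (hρ.eq_zero (hf.mapsTo_boundary (mem_sphere_zero_iff_norm.2 h))).le
    · exact (hρ.neg (hf.mapsTo_interior (mem_ball_zero_iff.2 h))).le
  have hcone : 0 - z ∈ posTangentConeAt (closedBall (0 : ℂ) 1) z :=
    sub_mem_posTangentConeAt_of_segment_subset
      ((convex_closedBall (0 : ℂ) 1).segment_subset hz' (mem_closedBall_self zero_le_one))
  have := hmax.hasFDerivWithinAt_nonpos h1 hcone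
  simp only [zero_sub, ContinuousLinearMap.comp_apply, map_neg] at this
  simpa [radialDeriv] using this

theorem re_inner_self {n : ℕ} (x : Cn n) : (inner ℂ x x).re = ‖x‖ ^ 2 := by
  rw [← RCLike.re_eq_complex_re, inner_self_eq_norm_sq]

include hm hρ hf hX in
-- In f_r = z f_z + z̄ f_z̄ the field z f_z is holomorphic and f_z̄ is antiholomorphic, so Green's
-- formula gives ∮ z⟨f_z̄, z f_z⟩ = 0. On |z| = 1 the other part pairs to |f_z̄|².
theorem circleInt_bdryPairing_radialDeriv (hcrit : IsCritical m N f) :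
    circleInt (bdryPairing f (radialDeriv f)) = circleInt fun z => ‖dbarOn f z‖ ^ 2 := by
  have hdel : ContDiffOn ℝ ∞ (delOn f) (closedBall 0 1) := contDiffOn_delOn hf.smooth (by exact le_rfl)
  let y : ℂ → Cn n := fun z => z • delOn f z
  have hy : ContDiffOn ℝ 1 y (closedBall 0 1) :=
    contDiffOn_id.smul (hdel.of_le (by simp))
  have hh : ContDiffOn ℝ 1 (dbarOn f) (closedBall 0 1) := hf.contDiffOn_dbarOn.of_le (by simp)
  have hdby : ∀ z ∈ ball (0 : ℂ) 1, dbarOn y z = 0 := by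
    intro z hz
    have hz' := ball_subset_closedBall hz
    have hd : DifferentiableWithinAt ℝ (delOn f) (closedBall 0 1) z :=
      hdel.differentiableOn (by simp) z hz'
    have h1 : HasFDerivWithinAt y _ (closedBall 0 1) z :=
      (hasFDerivWithinAt_id z _).smul hd.hasFDerivWithinAt
    have h2 : dbarOn y z = z • dbarOn (delOn f) z := by
      simp only [dbarOn, h1.fderivWithin (uniqueDiffOn_closedDisk z hz')]
      simp
      match_scalars <;> ring_nf
      rw [Complex.I_sq]
      ring
    rw [h2, dbarOn_delOn_comm hf.contDiffOn_two hz, delOn_dbarOn_eq_zero hm hρ hf hX hcrit hz,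
      smul_zero]
  have hgreen := integral_inner_dbarOn hh hy
  rw [setIntegral_congr_fun (g := fun _ => (0 : ℂ)) measurableSet_ball fun z hz => by
      simp only [hdby z hz, inner_zero_right],
    setIntegral_congr_fun (f := fun z => inner ℂ (delOn (dbarOn f) z) (y z))
      (g := fun _ => (0 : ℂ)) measurableSet_ball fun z hz => by
      simp only [delOn_dbarOn_eq_zero hm hρ hf hX hcrit hz, inner_zero_left]] at hgreen
  simp only [integral_zero, sub_zero] at hgreen
  have hc : ContinuousOn (fun z => z * inner ℂ (dbarOn f z) (y z)) (sphere 0 1) :=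
    (continuousOn_id.mul (hh.continuousOn.inner hy.continuousOn)).mono sphere_subset_closedBall
  have h0 : circleInt (fun z => (z * inner ℂ (dbarOn f z) (y z)).re) = 0 := by
    rw [← circleInt_re hc]
    have : circleInt (fun z => z * inner ℂ (dbarOn f z) (y z)) = 0 := by
      rcases mul_eq_zero.1 hgreen.symm with h | h
      · norm_num at h
      · exact h
    rw [this, Complex.zero_re]
  have hcn : ContinuousOn (fun z => ‖dbarOn f z‖ ^ 2) (sphere 0 1) :=
    (hh.continuousOn.norm.pow 2).mono sphere_subset_closedBall
  have hsplit : circleInt (bdryPairing f (radialDeriv f)) =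
      circleInt (fun z => (z * inner ℂ (dbarOn f z) (y z)).re + ‖dbarOn f z‖ ^ 2) := by
    refine circleInt_congr fun z hz => ?_
    have hzz : z * (starRingEnd ℂ) z = 1 := by
      rw [Complex.mul_conj, Complex.normSq_eq_norm_sq, mem_sphere_zero_iff_norm.1 hz]; simp
    simp only [bdryPairing, radialDeriv_eq, inner_add_right, mul_add, Complex.add_re, y]
    rw [inner_smul_right _ _ ((starRingEnd ℂ) z), ← mul_assoc z, hzz, one_mul, re_inner_self]
  rw [hsplit]
  have hadd := intervalIntegral.integral_add (μ := volume) (a := -Real.pi) (b := Real.pi)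
    ((circleInt_continuousOn (Complex.continuous_re.comp_continuousOn hc)).intervalIntegrable _ _)
    ((circleInt_continuousOn hcn).intervalIntegrable _ _)
  simp only [circleInt] at h0 hadd ⊢
  rw [← zero_add (∫ θ in (-Real.pi)..Real.pi, ‖dbarOn f (Complex.exp (θ * Complex.I))‖ ^ 2), ← h0]
  exact hadd

theorem eq_zero_of_circleInt_nonpos {u : ℂ → ℝ} (hu : ContinuousOn u (sphere 0 1))
    (h0 : ∀ z ∈ sphere (0 : ℂ) 1, 0 ≤ u z) (h : circleInt u ≤ 0) {z : ℂ}
    (hz : z ∈ sphere (0 : ℂ) 1) : u z = 0 := by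
  by_contra hne
  have hexp : Complex.exp (z.arg * Complex.I) = z := by
    have := Complex.norm_mul_exp_arg_mul_I z
    rwa [mem_sphere_zero_iff_norm.1 hz, Complex.ofReal_one, one_mul] at this
  have := intervalIntegral.integral_pos (a := -Real.pi) (b := Real.pi)
    (by linarith [Real.pi_pos]) (circleInt_continuousOn hu).continuousOn
    (fun θ _ => h0 _ (exp_mem_sphere θ))
    ⟨z.arg, ⟨(Complex.neg_pi_lt_arg z).le, Complex.arg_le_pi z⟩, by
      rw [hexp]; exact lt_of_le_of_ne (h0 z hz) (Ne.symm hne)⟩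
  exact absurd h (not_le.2 this)

include hm hρ hf hX in
/-- At some boundary point of a nonholomorphic critical disk the multiplier is positive. -/
theorem exists_multiplier_pos (hcrit : IsCritical m N f)
    (hnonhol : ¬ DifferentiableOn ℂ f (ball 0 1)) :
    ∃ z ∈ sphere (0 : ℂ) 1, 0 < multiplier ρ f X z := by
  by_contra hcon
  push Not at hcon
  have hh : ContDiffOn ℝ 1 (dbarOn f) (closedBall 0 1) := hf.contDiffOn_dbarOn.of_le (by simp)
  have hle : circleInt (bdryPairing f (radialDeriv f)) ≤ 0 := by
    rw [circleInt, intervalIntegral.integral_of_le (by linarith [Real.pi_pos])]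
    refine integral_nonpos fun θ => ?_
    simp only [Pi.zero_apply]
    rw [bdryPairing_eq hm hρ hf hX hcrit (exp_mem_sphere θ)]
    exact mul_nonpos_of_nonpos_of_nonneg (hcon _ (exp_mem_sphere θ))
      (fderiv_radialDeriv_nonneg hm hρ hf (exp_mem_sphere θ))
  rw [circleInt_bdryPairing_radialDeriv hm hρ hf hX hcrit] at hle
  have hbd : ∀ z ∈ sphere (0 : ℂ) 1, dbarOn f z = 0 := by
    intro z hz
    have := eq_zero_of_circleInt_nonpos
      ((hh.continuousOn.norm.pow 2).mono sphere_subset_closedBall) (fun z _ => sq_nonneg _) hle hz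
    simpa using this
  -- Green's formula for the pair ∂̄f, f: the boundary term vanishes because ∂̄f = 0 on the circle,
  -- the interior term by harmonicity. Hence ∫|∂̄f|² = 0.
  have hgreen := integral_inner_dbarOn hh (hf.contDiffOn_two.of_le (by norm_num))
  rw [setIntegral_congr_fun (g := fun z => ((‖dbarOn f z‖ ^ 2 : ℝ) : ℂ)) measurableSet_ball
      fun z _ => by simp only [inner_self_eq_norm_sq_to_K]; norm_cast,
    setIntegral_congr_fun (f := fun z => inner ℂ (delOn (dbarOn f) z) (f z))
      (g := fun _ => (0 : ℂ)) measurableSet_ball fun z hz => by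
      simp only [delOn_dbarOn_eq_zero hm hρ hf hX hcrit hz, inner_zero_left],
    circleInt_congr (v := fun _ => (0 : ℂ)) fun z hz => by simp [hbd z hz]] at hgreen
  simp only [circleInt, intervalIntegral.integral_zero, integral_zero, mul_zero, sub_zero] at hgreen
  rw [integral_complex_ofReal] at hgreen
  have hint : ∫ z in ball (0 : ℂ) 1, ‖dbarOn f z‖ ^ 2 = 0 := by exact_mod_cast hgreen
  have hcn : ContinuousOn (fun z => ‖dbarOn f z‖ ^ 2) (closedBall (0 : ℂ) 1) :=
    hh.continuousOn.norm.pow 2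
  rw [setIntegral_eq_zero_iff_of_nonneg_ae (Eventually.of_forall fun z => sq_nonneg _)
    (integrableOn_disk hcn)] at hint
  have hzero := Measure.eqOn_open_of_ae_eq hint isOpen_ball (hcn.mono ball_subset_closedBall)
    continuousOn_const
  refine hnonhol fun z hz => DifferentiableAt.differentiableWithinAt ?_
  have hdb : dbarOn f z = 0 := by simpa using hzero hz
  rw [differentiableAt_complex_iff_differentiableAt_real]
  refine ⟨hf.contDiffOn_two.contDiffAt (mem_of_superset (isOpen_ball.mem_nhds hz)
    ball_subset_closedBall) |>.differentiableAt (by norm_num), ?_⟩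
  rw [dbarOn_eq_dbar f hz, dbar, smul_eq_zero] at hdb
  have h1 : fderiv ℝ f z 1 + Complex.I • fderiv ℝ f z Complex.I = 0 :=
    hdb.resolve_left (by norm_num)
  rw [eq_neg_of_add_eq_zero_left h1, smul_neg, smul_smul, Complex.I_mul_I]
  simp

end PositiveMultiplier

/-! ### Holomorphic fields tangent to the boundary. -/

section TangentFields

variable {n k : ℕ} {N : Set (Cn n)} {f X V : ℂ → Cn n} {m : ℕ∞} {ρ : Cn n → ℝ} {r₀ δ ε : ℝ}
variable (hm : 2 ≤ m) (hρ : IsDefiningFunction m ρ N) (hf : IsDisk N f)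
  (hX : IsTransverse ρ f X r₀)

theorem dbarOn_ne_zero_of_multiplier {z : ℂ} (hμ : multiplier ρ f X z ≠ 0) : dbarOn f z ≠ 0 := by
  intro h
  exact hμ (by simp [multiplier, bdryPairing, h])

include hm hρ hf hX in
-- Where μ ≠ 0, dρ is the real functional Re(z⟨∂̄f, ·⟩) divided by μ. It therefore vanishes on the
-- Hermitian complement of ∂̄f, which is stable under multiplication by i.
theorem mem_complexTangentSpace (hcrit : IsCritical m N f) {z : ℂ} (hz : z ∈ sphere (0 : ℂ) 1)
    (hμ : multiplier ρ f X z ≠ 0) {v : Cn n} (hv : inner ℂ (dbarOn f z) v = 0) :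
    v ∈ complexTangentSpace ρ (f z) := by
  have key : ∀ u : Cn n, inner ℂ (dbarOn f z) u = 0 → fderiv ℝ ρ (f z) u = 0 := by
    intro u hu
    have h := bdryPairing_eq hm hρ hf hX hcrit hz (fun _ => u)
    simp only [bdryPairing, hu, mul_zero, Complex.zero_re] at h
    exact (mul_eq_zero.1 h.symm).resolve_left hμ
  exact ⟨key v hv, key _ (by rw [inner_smul_right, hv, mul_zero])⟩

/-- A positive trace has a positive summand; the trace is taken over the span of k members of an
orthonormal basis of P. -/
theorem exists_leviForm_pos_of_le {p : Cn n} {P : Submodule ℂ (Cn n)}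
    (hP : P ≤ complexTangentSpace ρ p) (hk : k ≤ Module.finrank ℂ P)
    (hpsc : ∀ U : Submodule ℂ (Cn n), U ≤ complexTangentSpace ρ p →
      ∀ b : OrthonormalBasis (Fin k) ℂ U, 0 < ∑ i, leviForm ρ p (b i : Cn n)) :
    ∃ v ∈ P, 0 < leviForm ρ p v := by
  let b₀ := stdOrthonormalBasis ℂ P
  let v : Fin k → Cn n := fun i => (b₀ (Fin.castLE hk i) : Cn n)
  have hv : Orthonormal ℂ v :=
    (b₀.orthonormal.comp _ (Fin.castLE_injective hk)).comp_linearIsometry P.subtypeₗᵢ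
  have hvP : ∀ i, v i ∈ P := fun i => (b₀ (Fin.castLE hk i)).2
  let U := Submodule.span ℂ (range v)
  have hUP : U ≤ P := Submodule.span_le.2 (by rintro _ ⟨i, rfl⟩; exact hvP i)
  let v' : Fin k → U := fun i => ⟨v i, Submodule.subset_span ⟨i, rfl⟩⟩
  have hv' : Orthonormal ℂ v' := by
    constructor
    · exact fun i => hv.1 i
    · exact fun i j hij => hv.2 hij
  have hspan : ⊤ ≤ Submodule.span ℂ (range v') := by
    intro x _
    have hx : (x : Cn n) ∈ (Submodule.span ℂ (range v')).map U.subtype := by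
      rw [Submodule.map_span, ← range_comp]
      exact x.2
    obtain ⟨y, hy, hyx⟩ := hx
    rwa [Subtype.ext hyx] at hy
  let b : OrthonormalBasis (Fin k) ℂ U := OrthonormalBasis.mk hv' hspan
  obtain ⟨i, _, hi⟩ := Finset.exists_lt_of_sum_lt (s := Finset.univ) (f := fun _ : Fin k => (0 : ℝ))
    (by simpa using hpsc U (hUP.trans hP) b)
  refine ⟨v i, hvP i, ?_⟩
  simpa [b, v'] using hi

include hm hρ hf hX in
theorem exists_leviForm_pos (hcrit : IsCritical m N f) (hk : k + 1 ≤ n)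
    {z : ℂ} (hz : z ∈ sphere (0 : ℂ) 1) (hμ : multiplier ρ f X z ≠ 0)
    (hpsc : ∀ U : Submodule ℂ (Cn n), U ≤ complexTangentSpace ρ (f z) →
      ∀ b : OrthonormalBasis (Fin k) ℂ U, 0 < ∑ i, leviForm ρ (f z) (b i : Cn n)) :
    ∃ w, inner ℂ (dbarOn f z) w = 0 ∧ 0 < leviForm ρ (f z) w := by
  have hh : dbarOn f z ≠ 0 := dbarOn_ne_zero_of_multiplier hμ
  let P := (ℂ ∙ dbarOn f z)ᗮ
  have hP : P ≤ complexTangentSpace ρ (f z) := fun v hv =>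
    mem_complexTangentSpace hm hρ hf hX hcrit hz hμ (Submodule.mem_orthogonal_singleton_iff_inner_right.1 hv)
  have hfin : k ≤ Module.finrank ℂ P := by
    have h1 := Submodule.finrank_add_finrank_orthogonal (ℂ ∙ dbarOn f z)
    rw [finrank_span_singleton hh, finrank_euclideanSpace_fin] at h1
    change k ≤ Module.finrank ℂ (ℂ ∙ dbarOn f z)ᗮ
    omega
  obtain ⟨w, hw, hw'⟩ := exists_leviForm_pos_of_le hP hfin hpsc
  exact ⟨w, Submodule.mem_orthogonal_singleton_iff_inner_right.1 hw, hw'⟩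

/-- A field along `f`, holomorphic if `f` is harmonic, with values in the Hermitian orthogonal
complement of `∂f/∂z̄`. -/
def orthogonalField (f : ℂ → Cn n) (c w : Cn n) (z : ℂ) : Cn n :=
  (inner ℂ (dbarOn f z) c : ℂ) • w - (inner ℂ (dbarOn f z) w : ℂ) • c

theorem inner_orthogonalField (f : ℂ → Cn n) (c w : Cn n) (z : ℂ) :
    inner ℂ (dbarOn f z) (orthogonalField f c w z) = 0 := by
  simp only [orthogonalField, inner_sub_right, inner_smul_right]
  ring

include hf in
theorem contDiffOn_orthogonalField (c w : Cn n) :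
    ContDiffOn ℝ ∞ (orthogonalField f c w) (closedBall 0 1) :=
  ((hf.contDiffOn_dbarOn.inner ℂ contDiffOn_const).smul contDiffOn_const).sub
    ((hf.contDiffOn_dbarOn.inner ℂ contDiffOn_const).smul contDiffOn_const)

theorem dbarOn_smul {η : ℂ → ℂ} {z : ℂ} (hz : z ∈ closedBall (0 : ℂ) 1)
    (hη : DifferentiableWithinAt ℝ η (closedBall 0 1) z)
    (hV : DifferentiableWithinAt ℝ V (closedBall 0 1) z) :
    dbarOn (fun z => η z • V z) z = dbarOn η z • V z + η z • dbarOn V z := by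
  have h1 : HasFDerivWithinAt (fun z => η z • V z) _ (closedBall 0 1) z :=
    hη.hasFDerivWithinAt.smul hV.hasFDerivWithinAt
  simp only [dbarOn, h1.fderivWithin (uniqueDiffOn_closedDisk z hz)]
  simp
  module

theorem dbarOn_sub {U : ℂ → Cn n} {z : ℂ} (hz : z ∈ closedBall (0 : ℂ) 1)
    (hU : DifferentiableWithinAt ℝ U (closedBall 0 1) z)
    (hV : DifferentiableWithinAt ℝ V (closedBall 0 1) z) :
    dbarOn (fun z => U z - V z) z = dbarOn U z - dbarOn V z := by
  simp only [dbarOn]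
  rw [fderivWithin_fun_sub (uniqueDiffOn_closedDisk z hz) hU hV]
  simp only [sub_apply]
  module

theorem dbarOn_const (w : Cn n) (z : ℂ) : dbarOn (fun _ => w) z = 0 := by
  simp [dbarOn]

theorem dbarOn_of_differentiableAt {η : ℂ → ℂ} {z : ℂ} (hz : z ∈ ball (0 : ℂ) 1)
    (hη : DifferentiableAt ℂ η z) : dbarOn η z = 0 := by
  have h := (differentiableAt_complex_iff_differentiableAt_real.1 hη).2
  rw [dbarOn, fderivWithin_closedDisk η hz, h, smul_smul, Complex.I_mul_I]
  simp

include hf in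
-- Harmonicity makes ∂̄f antiholomorphic, so its Hermitian products with constant vectors are
-- holomorphic coefficients.
theorem dbarOn_smul_orthogonalField
    (hharm : ∀ z ∈ ball (0 : ℂ) 1, delOn (dbarOn f) z = 0) (c w : Cn n) {η : ℂ → ℂ}
    (hη : Differentiable ℂ η) {z : ℂ} (hz : z ∈ ball (0 : ℂ) 1) :
    dbarOn (fun z => η z • orthogonalField f c w z) z = 0 := by
  have hz' := ball_subset_closedBall hz
  have hh : ∀ v : Cn n, DifferentiableWithinAt ℝ (fun z => (inner ℂ (dbarOn f z) v : ℂ))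
      (closedBall 0 1) z := fun v =>
    (hf.contDiffOn_dbarOn.inner ℂ contDiffOn_const).differentiableOn (by simp) z hz'
  have hi : ∀ v : Cn n, dbarOn (fun z => (inner ℂ (dbarOn f z) v : ℂ)) z = 0 := by
    intro v
    rw [dbarOn_inner hz' (hf.contDiffOn_dbarOn.differentiableOn (by simp) z hz')
      (differentiableWithinAt_const v), dbarOn_const, hharm z hz]
    simp
  have h1 : ∀ v u : Cn n, dbarOn (fun z => (inner ℂ (dbarOn f z) v : ℂ) • u) z = 0 := by
    intro v u
    rw [dbarOn_smul hz' (hh v) (differentiableWithinAt_const u), hi, dbarOn_const]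
    simp
  have h2 : dbarOn (orthogonalField f c w) z = 0 := by
    have e : dbarOn (orthogonalField f c w) z = _ :=
      dbarOn_sub hz' ((hh c).smul_const w) ((hh w).smul_const c)
    rw [e, h1, h1, sub_zero]
  rw [dbarOn_smul hz' ((hη.restrictScalars ℝ).differentiableAt.differentiableWithinAt)
    ((contDiffOn_orthogonalField hf c w).differentiableOn (by simp) z hz'), h2,
    dbarOn_of_differentiableAt hz hη.differentiableAt]
  simp

include hm hρ hf hX in
-- If μ ≠ 0 at the point, orthogonality to ∂̄f implies tangency. If μ = 0, then ∂̄f vanishes there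
-- and so does the field.
theorem fderiv_smul_orthogonalField (hcrit : IsCritical m N f) (c w : Cn n) (a : ℂ) {z : ℂ}
    (hz : z ∈ sphere (0 : ℂ) 1) :
    fderiv ℝ ρ (f z) (a • orthogonalField f c w z) = 0 := by
  by_cases hμ : multiplier ρ f X z = 0
  · have h0 : dbarOn f z = 0 := by
      by_contra hne
      -- On |z| = 1 the test field z̄ ∂̄f pairs to |∂̄f|².
      have h := bdryPairing_eq hm hρ hf hX hcrit hz
        (fun z => (starRingEnd ℂ) z • dbarOn f z)
      have hzz : z * (starRingEnd ℂ) z = 1 := by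
        rw [Complex.mul_conj, Complex.normSq_eq_norm_sq, mem_sphere_zero_iff_norm.1 hz]; simp
      rw [hμ, zero_mul, bdryPairing, inner_smul_right, ← mul_assoc, hzz, one_mul,
        re_inner_self] at h
      exact hne (by simpa using h)
    simp [orthogonalField, h0]
  · exact (mem_complexTangentSpace hm hρ hf hX hcrit hz hμ
      (by rw [inner_smul_right, inner_orthogonalField, mul_zero])).1

end TangentFields

/-! ### The real Hessian on a complex line. -/

section Hessian

variable {n : ℕ} {m : ℕ∞} {ρ : Cn n → ℝ}

/-- The complex-symmetric part of the real Hessian. -/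
def symmetricHessian (ρ : Cn n → ℝ) (p v : Cn n) : ℂ :=
  ((fderiv ℝ (fderiv ℝ ρ) p v v -
    fderiv ℝ (fderiv ℝ ρ) p (Complex.I • v) (Complex.I • v)) / 2 : ℝ) -
    Complex.I * (fderiv ℝ (fderiv ℝ ρ) p v (Complex.I • v) : ℝ)

/-- The splitting of a real bilinear form into its Hermitian and complex-symmetric parts. With a = b
= η the first sees only |η|², while the second depends on η² and can be averaged out by oscillation.
-/
theorem hessian_smul_smul (hm : 2 ≤ m) (hρ : ContDiff ℝ m ρ) (p v : Cn n) (a b : ℂ) :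
    fderiv ℝ (fderiv ℝ ρ) p (a • v) (b • v) =
      2 * leviForm ρ p v * (a * (starRingEnd ℂ) b).re + (a * b * symmetricHessian ρ p v).re := by
  have hsymm : IsSymmSndFDerivAt ℝ ρ p :=
    (hρ.of_le (WithTop.coe_le_coe.2 hm : (2 : ℕ∞ω) ≤ m)).contDiffAt.isSymmSndFDerivAt (by simp)
  have e : ∀ c : ℂ, c • v = c.re • v + c.im • (Complex.I • v) := by
    intro c
    conv_lhs => rw [← Complex.re_add_im c]
    rw [add_smul, mul_smul, Complex.coe_smul, Complex.coe_smul]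
  rw [e a, e b]
  simp only [map_add, map_smul, add_apply, smul_apply, smul_eq_mul]
  rw [hsymm.eq (Complex.I • v) v]
  simp only [leviForm, symmetricHessian]
  simp
  ring

theorem leviForm_smul (p v : Cn n) (r : ℝ) :
    leviForm ρ p ((r : ℂ) • v) = r ^ 2 * leviForm ρ p v := by
  have e : Complex.I • ((r : ℂ) • v) = r • (Complex.I • v) := by
    rw [smul_comm, Complex.coe_smul]
  rw [leviForm, e, Complex.coe_smul]
  simp only [map_smul, smul_apply, smul_eq_mul, leviForm]
  ring

end Hessian

/-! ### Positive forms on holomorphic functions by concentration and oscillation. -/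

section CircleFrequencies

/-- The Riemann–Lebesgue lemma at integer frequencies. It needs no regularity of u, as integrals of
nonintegrable functions are 0 by convention. -/
theorem norm_circleInt_mul_zpow_lt (u : ℂ → ℂ) {e : ℝ}
    (he : 0 < e) :
    ∃ J : ℕ, ∀ N : ℤ, (J : ℤ) ≤ |N| → ‖circleInt fun z => u z * z ^ N‖ < e := by
  have hpi := Real.pi_pos
  let g : ℝ → ℂ := (Ioc (-Real.pi) Real.pi).indicator fun θ => u (Complex.exp (θ * Complex.I))
  have h1 := Real.tendsto_integral_exp_smul_cocompact g
  have h2 : Tendsto (fun N : ℤ => -(N : ℝ) * (2 * Real.pi)⁻¹) cofinite (cocompact ℝ) := by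
    have hh : Topology.IsClosedEmbedding fun x : ℝ => -x * (2 * Real.pi)⁻¹ :=
      ((Homeomorph.neg ℝ).trans
        (Homeomorph.mulRight₀ (2 * Real.pi)⁻¹ (by positivity))).isClosedEmbedding
    exact hh.tendsto_cocompact.comp Int.tendsto_coe_cofinite
  have h3 := (h1.comp h2).norm
  rw [norm_zero] at h3
  have hev := h3.eventually (gt_mem_nhds he)
  rw [Int.cofinite_eq, eventually_sup] at hev
  obtain ⟨a, ha⟩ := eventually_atBot.1 hev.1
  obtain ⟨b, hb⟩ := eventually_atTop.1 hev.2
  refine ⟨a.natAbs + b.natAbs, fun N hN => ?_⟩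
  have hcase : N ≤ a ∨ b ≤ N := by
    rcases le_or_gt 0 N with h | h
    · rw [abs_of_nonneg h] at hN; right; omega
    · rw [abs_of_neg h] at hN; left; omega
  have hlt : ‖∫ v : ℝ, Real.fourierChar (-(v * (-(N : ℝ) * (2 * Real.pi)⁻¹))) • g v‖ < e := by
    rcases hcase with h | h
    · exact ha N h
    · exact hb N h
  convert hlt using 2
  rw [circleInt, intervalIntegral.integral_of_le (by linarith),
    ← integral_indicator measurableSet_Ioc]
  congr 1
  ext θ
  by_cases hθ : θ ∈ Ioc (-Real.pi) Real.pi
  · simp only [g, indicator_of_mem hθ, Circle.smul_def, Real.fourierChar_apply, smul_eq_mul]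
    rw [← Complex.exp_int_mul, mul_comm]
    congr 2
    push_cast
    field_simp
  · simp only [g, indicator_of_notMem hθ, smul_zero]

/-- Centring the window at θ₀ makes the peak an interior and unique maximum, also for z₀ = −1. -/
theorem circleInt_eq_shift {E : Type*} [NormedAddCommGroup E] [NormedSpace ℝ E] (u : ℂ → E)
    (θ₀ : ℝ) :
    circleInt u = ∫ θ in (θ₀ - Real.pi)..(θ₀ + Real.pi), u (Complex.exp (θ * Complex.I)) := by
  have hper : Function.Periodic (fun θ : ℝ => u (Complex.exp (θ * Complex.I))) (2 * Real.pi) := by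
    intro θ
    simp only
    congr 1
    push_cast
    rw [add_mul, Complex.exp_add, Complex.exp_two_pi_mul_I, mul_one]
  have := hper.intervalIntegral_add_eq (-Real.pi) (θ₀ - Real.pi)
  rw [circleInt]
  convert this using 2 <;> ring

/-- On the circle |(1 + z̄₀z)/2|² = (1 + cos(θ − θ₀))/2 is maximal only at z₀, so its normalized
powers form an approximate identity there. The normalized integrals tend to w(z₀) > 0. -/
theorem exists_circleInt_peak_pos {w : ℂ → ℝ} (hw : ContinuousOn w (sphere 0 1)) {z₀ : ℂ}
    (hz₀ : z₀ ∈ sphere (0 : ℂ) 1) (hpos : 0 < w z₀) :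
    ∃ M : ℕ, 0 < circleInt fun z => w z * ‖((1 + (starRingEnd ℂ) z₀ * z) / 2) ^ M‖ ^ 2 := by
  have hpi := Real.pi_pos
  set θ₀ := z₀.arg with hθ₀
  have hexp : Complex.exp (θ₀ * Complex.I) = z₀ := by
    have := Complex.norm_mul_exp_arg_mul_I z₀
    rwa [mem_sphere_zero_iff_norm.1 hz₀, Complex.ofReal_one, one_mul] at this
  let c : ℝ → ℝ := fun θ => (1 + Real.cos (θ - θ₀)) / 2
  have hc : ∀ θ : ℝ, ‖((1 + (starRingEnd ℂ) z₀ * Complex.exp (θ * Complex.I)) / 2)‖ ^ 2 = c θ := by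
    intro θ
    have e : (starRingEnd ℂ) z₀ * Complex.exp (θ * Complex.I) =
        Complex.cos ((θ - θ₀ : ℝ) : ℂ) + Complex.sin ((θ - θ₀ : ℝ) : ℂ) * Complex.I := by
      rw [← Complex.exp_mul_I, ← hexp, ← Complex.exp_conj, ← Complex.exp_add]
      congr 1
      simp
      ring
    have e' : (1 : ℂ) + ((Real.cos (θ - θ₀) : ℝ) + (Real.sin (θ - θ₀) : ℝ) * Complex.I) =
        ((1 + Real.cos (θ - θ₀) : ℝ) : ℂ) + (Real.sin (θ - θ₀) : ℝ) * Complex.I := by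
      push_cast; ring
    rw [e, ← Complex.normSq_eq_norm_sq, ← Complex.ofReal_cos, ← Complex.ofReal_sin, e',
      map_div₀, Complex.normSq_add_mul_I]
    have h4 : Complex.normSq 2 = 4 := by norm_num [Complex.normSq_apply]
    rw [h4]
    have := Real.sin_sq_add_cos_sq (θ - θ₀)
    simp only [c]
    linear_combination this / 4
  have hlim := tendsto_setIntegral_pow_smul_of_unique_maximum_of_isCompact_of_continuousOn
    (μ := volume) (s := Icc (θ₀ - Real.pi) (θ₀ + Real.pi)) (x₀ := θ₀) (c := c)
    (g := fun θ : ℝ => w (Complex.exp (θ * Complex.I))) isCompact_Icc (by fun_prop)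
    (fun y hy hne => by
      have h1 : Real.cos (y - θ₀) ≠ 1 := by
        rw [Ne, Real.cos_eq_one_iff_of_lt_of_lt (by linarith [hy.1]) (by linarith [hy.2])]
        exact sub_ne_zero.2 hne
      have h2 := lt_of_le_of_ne (Real.cos_le_one (y - θ₀)) h1
      simp only [c, sub_self, Real.cos_zero]
      linarith)
    (fun x _ => by simp only [c]; linarith [Real.neg_one_le_cos (x - θ₀)])
    (by simp [c])
    (by
      rw [interior_Icc, closure_Ioo (by linarith)]
      exact ⟨by linarith, by linarith⟩)
    (circleInt_continuousOn hw).continuousOn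
  rw [hexp] at hlim
  obtain ⟨M, hM⟩ := (hlim.eventually (lt_mem_nhds hpos)).exists
  refine ⟨M, ?_⟩
  have hI : circleInt (fun z => w z * ‖((1 + (starRingEnd ℂ) z₀ * z) / 2) ^ M‖ ^ 2) =
      ∫ θ in Icc (θ₀ - Real.pi) (θ₀ + Real.pi), c θ ^ M • w (Complex.exp (θ * Complex.I)) := by
    rw [circleInt_eq_shift _ θ₀, intervalIntegral.integral_of_le (by linarith),
      integral_Icc_eq_integral_Ioc]
    congr 1
    ext θ
    rw [norm_pow, ← pow_mul, mul_comm M 2, pow_mul, hc, smul_eq_mul, mul_comm]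
  rw [hI]
  have hnn : 0 ≤ (∫ θ in Icc (θ₀ - Real.pi) (θ₀ + Real.pi), c θ ^ M)⁻¹ := by
    refine inv_nonneg.2 (integral_nonneg fun θ => pow_nonneg ?_ _)
    simp only [c]; linarith [Real.neg_one_le_cos (θ - θ₀)]
  rw [smul_eq_mul] at hM
  exact pos_of_mul_pos_right hM hnn

theorem circleInt_add {u v : ℂ → ℝ} (hu : ContinuousOn u (sphere 0 1))
    (hv : ContinuousOn v (sphere 0 1)) :
    circleInt (fun z => u z + v z) = circleInt u + circleInt v :=
  intervalIntegral.integral_add ((circleInt_continuousOn hu).intervalIntegrable _ _)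
    ((circleInt_continuousOn hv).intervalIntegrable _ _)

theorem circleInt_sum {ι : Type*} (s : Finset ι) {u : ι → ℂ → ℝ}
    (hu : ∀ i ∈ s, ContinuousOn (u i) (sphere 0 1)) :
    circleInt (fun z => ∑ i ∈ s, u i z) = ∑ i ∈ s, circleInt (u i) :=
  intervalIntegral.integral_finsetSum fun i hi =>
    (circleInt_continuousOn (hu i hi)).intervalIntegrable _ _

/-- An entrywise error e in c₀ times the identity costs at most e(∑|c_j|)², which is at most e d
∑c_j² by Cauchy–Schwarz. -/
theorem sum_mul_mul_ge {d : ℕ} {G : Fin d → Fin d → ℝ} {c₀ e : ℝ} (he : 0 ≤ e)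
    (hG : ∀ j k, |G j k - if j = k then c₀ else 0| ≤ e) (c : Fin d → ℝ) :
    (c₀ - e * d) * ∑ j, c j ^ 2 ≤ ∑ j, ∑ k, c j * c k * G j k := by
  have h1 : ∀ j k, c j * c k * (if j = k then c₀ else 0) - e * (|c j| * |c k|) ≤
      c j * c k * G j k := by
    intro j k
    have h2 := neg_abs_le (c j * c k * (G j k - if j = k then c₀ else 0))
    rw [abs_mul, abs_mul] at h2
    have h3 := mul_le_mul_of_nonneg_left (hG j k) (mul_nonneg (abs_nonneg (c j)) (abs_nonneg (c k)))
    linarith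
  have h4 : (∑ j, |c j|) ^ 2 ≤ d * ∑ j, c j ^ 2 := by
    have := sq_sum_le_card_mul_sum_sq (s := Finset.univ) (f := fun j => |c j|)
    simpa using this
  calc (c₀ - e * d) * ∑ j, c j ^ 2 ≤ c₀ * ∑ j, c j ^ 2 - e * (∑ j, |c j|) ^ 2 := by nlinarith
    _ = ∑ j, ∑ k, (c j * c k * (if j = k then c₀ else 0) - e * (|c j| * |c k|)) := by
        simp only [Finset.sum_sub_distrib, ← Finset.mul_sum, mul_ite, mul_zero, Finset.sum_ite_eq,
          Finset.mem_univ, if_true, sq, Finset.sum_mul_sum]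
        rw [Finset.mul_sum]
        congr 1
        exact Finset.sum_congr rfl fun j _ => by ring
    _ ≤ _ := Finset.sum_le_sum fun j _ => Finset.sum_le_sum fun k _ => h1 j k

/-- A real quadratic form `∮ (w|η|² + Re(κη²))` is positive definite on arbitrarily large spaces of
holomorphic functions `η` if `w` is somewhere positive. -/
theorem exists_holomorphic_pos {w : ℂ → ℝ} {κ : ℂ → ℂ} (hw : ContinuousOn w (sphere 0 1))
    (hκ : ContinuousOn κ (sphere 0 1)) {z₀ : ℂ} (hz₀ : z₀ ∈ sphere (0 : ℂ) 1) (hpos : 0 < w z₀)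
    (d : ℕ) :
    ∃ h : Fin d → ℂ → ℂ, (∀ j, Differentiable ℂ (h j)) ∧ ∃ c₀ > 0, ∀ c : Fin d → ℝ,
      c₀ * ∑ j, c j ^ 2 ≤ circleInt fun z =>
        w z * ((∑ j, (c j : ℂ) * h j z) * (starRingEnd ℂ) (∑ j, (c j : ℂ) * h j z)).re +
          ((∑ j, (c j : ℂ) * h j z) * (∑ j, (c j : ℂ) * h j z) * κ z).re := by
  obtain ⟨M, hM⟩ := exists_circleInt_peak_pos hw hz₀ hpos
  set p : ℂ → ℂ := fun z => ((1 + (starRingEnd ℂ) z₀ * z) / 2) ^ M with hp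
  have hpd : Differentiable ℂ p := by
    simp only [hp]; fun_prop
  set C := circleInt fun z => w z * ‖p z‖ ^ 2 with hC
  -- Gram entries will be within 2e of C times the identity, with total loss 2ed ≤ C/2; using d + 1
  -- covers d = 0.
  let e : ℝ := C / (4 * (d + 1))
  have he : 0 < e := by positivity
  let u₁ : ℂ → ℂ := fun z => ((w z * ‖p z‖ ^ 2 : ℝ) : ℂ)
  let u₂ : ℂ → ℂ := fun z => p z ^ 2 * κ z
  have hu₁ : ContinuousOn u₁ (sphere 0 1) :=
    Complex.continuous_ofReal.comp_continuousOn
      (hw.mul (hpd.continuous.norm.pow 2).continuousOn)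
  have hu₂ : ContinuousOn u₂ (sphere 0 1) := (hpd.continuous.pow 2).continuousOn.mul hκ
  obtain ⟨J₁, hJ₁⟩ := norm_circleInt_mul_zpow_lt u₁ he
  obtain ⟨J₂, hJ₂⟩ := norm_circleInt_mul_zpow_lt u₂ he
  let J := J₁ + J₂ + 1
  -- The frequency of h_j h̄_k is J(j − k), zero or of size at least J; that of h_j h_k is J(j + k +
  -- 2), never zero. Both Riemann–Lebesgue thresholds are thus passed.
  let h : Fin d → ℂ → ℂ := fun j z => p z * z ^ (J * (j + 1) : ℕ)
  have hh : ∀ j, Differentiable ℂ (h j) := fun j => hpd.mul (differentiable_id.pow _)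
  have hzpow : ∀ N : ℤ, ContinuousOn (fun z : ℂ => z ^ N) (sphere 0 1) := fun N z hz =>
    (continuousAt_zpow₀ z N (Or.inl (ne_of_mem_sphere hz one_ne_zero))).continuousWithinAt
  have hm₁ : ∀ N : ℤ, ContinuousOn (fun z => u₁ z * z ^ N) (sphere 0 1) := fun N =>
    hu₁.mul (hzpow N)
  have hm₂ : ∀ N : ℤ, ContinuousOn (fun z => u₂ z * z ^ N) (sphere 0 1) := fun N =>
    hu₂.mul (hzpow N)
  let G : Fin d → Fin d → ℂ → ℝ := fun j k z =>
    w z * (h j z * (starRingEnd ℂ) (h k z)).re + (h j z * h k z * κ z).re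
  have hGc : ∀ j k, ContinuousOn (G j k) (sphere 0 1) := by
    intro j k
    refine (hw.mul (Complex.continuous_re.comp_continuousOn ?_)).add
      (Complex.continuous_re.comp_continuousOn ?_)
    · exact ((hh j).continuous.mul
        (Complex.continuous_conj.comp (hh k).continuous)).continuousOn
    · exact ((hh j).continuous.mul (hh k).continuous).continuousOn.mul hκ
  have hGeq : ∀ j k, circleInt (G j k) =
      (circleInt fun z => u₁ z * z ^ ((J : ℤ) * ((j : ℤ) - k))).re +
        (circleInt fun z => u₂ z * z ^ ((J : ℤ) * ((j : ℤ) + k + 2))).re := by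
    intro j k
    rw [circleInt_re (hm₁ _), circleInt_re (hm₂ _)]
    refine Eq.trans ?_ (circleInt_add (Complex.continuous_re.comp_continuousOn (hm₁ _))
      (Complex.continuous_re.comp_continuousOn (hm₂ _)))
    refine circleInt_congr fun z hz => ?_
    have hz0 : z ≠ 0 := ne_of_mem_sphere hz one_ne_zero
    have hconj : (starRingEnd ℂ) z = z⁻¹ := by
      rw [Complex.inv_def, Complex.normSq_eq_norm_sq, mem_sphere_zero_iff_norm.1 hz]; simp
    have e1 : h j z * (starRingEnd ℂ) (h k z) =
        ((‖p z‖ ^ 2 : ℝ) : ℂ) * z ^ ((J : ℤ) * ((j : ℤ) - k)) := by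
      have : z ^ ((J : ℤ) * ((j : ℤ) - k)) =
          z ^ (J * (j + 1) : ℕ) * (z⁻¹) ^ (J * (k + 1) : ℕ) := by
        rw [← zpow_natCast, ← zpow_natCast, inv_zpow', ← zpow_add₀ hz0]
        congr 1; push_cast; ring
      rw [this]
      simp only [h, map_mul, map_pow, hconj]
      have hpp : p z * (starRingEnd ℂ) (p z) = ((‖p z‖ ^ 2 : ℝ) : ℂ) := by
        rw [Complex.mul_conj, Complex.normSq_eq_norm_sq]
      rw [← hpp]; ring
    have e2 : h j z * h k z * κ z = u₂ z * z ^ ((J : ℤ) * ((j : ℤ) + k + 2)) := by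
      have : z ^ ((J : ℤ) * ((j : ℤ) + k + 2)) =
          z ^ (J * (j + 1) : ℕ) * z ^ (J * (k + 1) : ℕ) := by
        rw [← zpow_natCast, ← zpow_natCast, ← zpow_add₀ hz0]
        congr 1; push_cast; ring
      rw [this]
      simp only [h, u₂]; ring
    simp only [G, e1, e2, u₁]
    rw [← Complex.re_ofReal_mul, ← mul_assoc, ← Complex.ofReal_mul]
  have hsmall : ∀ j k, |circleInt (G j k) - if j = k then C else 0| ≤ 2 * e := by
    intro j k
    rw [hGeq]
    have hN2 : (J₂ : ℤ) ≤ |(J : ℤ) * ((j : ℤ) + k + 2)| := by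
      rw [abs_of_nonneg (by positivity)]
      have : (J₂ : ℤ) ≤ J := by simp only [J]; push_cast; omega
      nlinarith [Int.natCast_nonneg (j : ℕ), Int.natCast_nonneg (k : ℕ), Int.natCast_nonneg J]
    have h2 := (Complex.abs_re_le_norm _).trans (hJ₂ _ hN2).le
    split_ifs with hjk
    · subst hjk
      have : (circleInt fun z => u₁ z * z ^ ((J : ℤ) * ((j : ℤ) - j))).re = C := by
        rw [circleInt_re (hm₁ _), hC]
        simp only [sub_self, mul_zero, zpow_zero, mul_one]
        rfl
      rw [this, add_sub_cancel_left]
      linarith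
    · have hN1 : (J₁ : ℤ) ≤ |(J : ℤ) * ((j : ℤ) - k)| := by
        rw [abs_mul, abs_of_nonneg (Int.natCast_nonneg J)]
        have h3 : 1 ≤ |((j : ℕ) : ℤ) - (k : ℕ)| := by
          apply Int.one_le_abs
          intro h0
          exact hjk (Fin.ext (by omega))
        have : (J₁ : ℤ) ≤ J := by simp only [J]; push_cast; omega
        nlinarith [Int.natCast_nonneg J]
      have h1 := (Complex.abs_re_le_norm _).trans (hJ₁ _ hN1).le
      rw [sub_zero]
      exact (abs_add_le _ _).trans (by linarith)
  refine ⟨h, hh, C / 2, by positivity, fun c => ?_⟩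
  have hsum := sum_mul_mul_ge (by positivity) hsmall c
  have hint : circleInt (fun z =>
        w z * ((∑ j, (c j : ℂ) * h j z) * (starRingEnd ℂ) (∑ j, (c j : ℂ) * h j z)).re +
          ((∑ j, (c j : ℂ) * h j z) * (∑ j, (c j : ℂ) * h j z) * κ z).re) =
      ∑ j, ∑ k, c j * c k * circleInt (G j k) := by
    have e3 : ∀ j k, c j * c k * circleInt (G j k) = circleInt fun z => c j * c k * G j k z := by
      intro j k
      simp only [circleInt, intervalIntegral.integral_const_mul]
    simp only [e3]
    have hGc' : ∀ j k, ContinuousOn (fun z => c j * c k * G j k z) (sphere 0 1) := fun j k =>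
      continuousOn_const.mul (hGc j k)
    rw [Finset.sum_congr rfl fun j _ => (circleInt_sum Finset.univ fun k _ => hGc' j k).symm,
      ← circleInt_sum Finset.univ fun j _ => continuousOn_finsetSum _ fun k _ => hGc' j k]
    congr 1
    ext z
    rw [map_sum, Finset.sum_mul_sum, Finset.sum_mul_sum, Finset.sum_mul]
    simp only [Complex.re_sum, Finset.mul_sum, Finset.sum_mul, ← Finset.sum_add_distrib]
    refine Finset.sum_congr rfl fun j _ => Finset.sum_congr rfl fun k _ => ?_
    simp only [G, map_mul, Complex.conj_ofReal]
    have e4 : (c j : ℂ) * h j z * ((c k : ℂ) * (starRingEnd ℂ) (h k z)) =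
        ((c j * c k : ℝ) : ℂ) * (h j z * (starRingEnd ℂ) (h k z)) := by push_cast; ring
    have e5 : (c j : ℂ) * h j z * ((c k : ℂ) * h k z) * κ z =
        ((c j * c k : ℝ) : ℂ) * (h j z * h k z * κ z) := by push_cast; ring
    rw [e4, e5, Complex.re_ofReal_mul, Complex.re_ofReal_mul]
    ring
  rw [hint]
  refine le_trans ?_ hsum
  have h5 : 2 * e * d ≤ C / 2 := by
    simp only [e]
    rw [show 2 * (C / (4 * ((d : ℝ) + 1))) * d = (C / 2) * (d / (d + 1)) by field_simp; ring]
    have : (d : ℝ) / (d + 1) ≤ 1 := by rw [div_le_one (by positivity)]; linarith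
    nlinarith
  exact mul_le_mul_of_nonneg_right (by linarith) (Finset.sum_nonneg fun j _ => sq_nonneg _)

end CircleFrequencies

/-! ### The energy cost of the correction near the boundary. -/

section BoundaryLayer

theorem deriv_smoothTransition_of_neg {x : ℝ} (hx : x < 0) : deriv Real.smoothTransition x = 0 := by
  have : Real.smoothTransition =ᶠ[𝓝 x] fun _ => 0 := by
    filter_upwards [gt_mem_nhds hx] with y hy
    exact Real.smoothTransition.zero_of_nonpos (le_of_lt hy)
  rw [this.deriv_eq, deriv_const]

theorem exists_bound_deriv_smoothTransition :
    ∃ C, 0 ≤ C ∧ ∀ x, |deriv Real.smoothTransition x| ≤ C := by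
  have hc : Continuous (deriv Real.smoothTransition) :=
    (Real.smoothTransition.contDiff (n := 1)).continuous_deriv (by simp)
  obtain ⟨C, hC⟩ := (isCompact_Icc (a := (0 : ℝ)) (b := 1)).exists_bound_of_continuousOn
    hc.continuousOn
  refine ⟨|C|, abs_nonneg C, fun x => ?_⟩
  rcases lt_or_ge x 0 with h | h
  · rw [deriv_smoothTransition_of_neg h, abs_zero]; exact abs_nonneg C
  rcases le_or_gt x 1 with h1 | h1
  · exact (hC x ⟨h, h1⟩).trans (le_abs_self C)
  · have : Real.smoothTransition =ᶠ[𝓝 x] fun _ => 1 := by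
      filter_upwards [lt_mem_nhds h1] with y hy
      exact Real.smoothTransition.one_of_one_le (le_of_lt hy)
    rw [this.deriv_eq, deriv_const, abs_zero]; exact abs_nonneg C

variable {n : ℕ}

/-- The factor z/δ comes from ∂̄(|z|²) = z. -/
theorem dbarOn_cutoff_smul {Y : ℂ → Cn n} (hY : DifferentiableOn ℝ Y (closedBall 0 1)) {δ : ℝ}
    {z : ℂ} (hz : z ∈ closedBall (0 : ℂ) 1) :
    dbarOn (fun z => cutoff δ z • Y z) z =
      ((deriv Real.smoothTransition (2 - (1 - ‖z‖ ^ 2) / δ) / δ : ℝ) : ℂ) • z • Y z +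
        cutoff δ z • dbarOn Y z := by
  have h1 : HasFDerivAt (fun z : ℂ => 2 - (1 - ‖z‖ ^ 2) / δ) ((1 / δ) • (2 • innerSL ℝ z)) z := by
    have h := (((hasStrictFDerivAt_norm_sq z).hasFDerivAt.const_sub 1).const_smul (1 / δ)).const_sub
      (2 : ℝ)
    refine (h.congr_fderiv (by simp)).congr_of_eventuallyEq (Eventually.of_forall fun y => ?_)
    simp only [Pi.smul_apply, smul_eq_mul]
    ring
  have h2 : HasFDerivAt (cutoff δ) (deriv Real.smoothTransition (2 - (1 - ‖z‖ ^ 2) / δ) •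
      ((1 / δ) • (2 • innerSL ℝ z))) z :=
    (((Real.smoothTransition.contDiff (n := 1)).differentiable (by simp)).differentiableAt
      (x := 2 - (1 - ‖z‖ ^ 2) / δ)).hasDerivAt.comp_hasFDerivAt z h1
  have h3 : HasFDerivWithinAt (fun z => cutoff δ z • Y z) _ (closedBall 0 1) z :=
    h2.hasFDerivWithinAt.smul (hY z hz).hasFDerivWithinAt
  simp only [dbarOn, h3.fderivWithin (uniqueDiffOn_closedDisk z hz)]
  have e1 : inner ℝ z 1 = z.re := by simp [Complex.inner]
  have e2 : inner ℝ z Complex.I = z.im := by simp [Complex.inner]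
  simp only [add_apply, smul_apply, ContinuousLinearMap.smulRight_apply, innerSL_apply_apply, e1, e2,
    ← Complex.coe_smul]
  have e3 : z • Y z = (z.re : ℂ) • Y z + (z.im : ℂ) • Complex.I • Y z := by
    rw [smul_smul, ← add_smul, Complex.re_add_im]
  rw [e3]
  generalize Y z = y
  generalize fderivWithin ℝ Y (closedBall 0 1) z 1 = a
  generalize fderivWithin ℝ Y (closedBall 0 1) z Complex.I = b
  generalize cutoff δ z = κ
  generalize deriv Real.smoothTransition (2 - (1 - ‖z‖ ^ 2) / δ) = s
  generalize z.re = p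
  generalize z.im = q
  match_scalars <;> simp <;> ring

/-- The mean value inequality between z and its radial projection to the circle, where Y vanishes.
-/
theorem exists_norm_le_one_sub {Y : ℂ → Cn n} (hY : ContDiffOn ℝ 1 Y (closedBall 0 1))
    (hY0 : ∀ z ∈ sphere (0 : ℂ) 1, Y z = 0) :
    ∃ C, 0 ≤ C ∧ ∀ z ∈ ball (0 : ℂ) 1, ‖Y z‖ ≤ C * (1 - ‖z‖) := by
  obtain ⟨C, hC⟩ := (isCompact_closedBall (0 : ℂ) 1).exists_bound_of_continuousOn
    (hY.continuousOn_fderivWithin uniqueDiffOn_closedDisk (by norm_num))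
  refine ⟨C, (norm_nonneg _).trans (hC 0 (by simp)), fun z hz => ?_⟩
  have hz1 : ‖z‖ < 1 := mem_ball_zero_iff.1 hz
  obtain ⟨y, hy, hyz⟩ : ∃ y ∈ sphere (0 : ℂ) 1, ‖z - y‖ = 1 - ‖z‖ := by
    by_cases h0 : z = 0
    · exact ⟨1, by simp, by simp [h0]⟩
    · have hn : ‖z‖ ≠ 0 := norm_ne_zero_iff.2 h0
      refine ⟨((‖z‖⁻¹ : ℝ) : ℂ) * z, ?_, ?_⟩
      · rw [mem_sphere_zero_iff_norm, norm_mul, Complex.norm_real, norm_inv, norm_norm,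
          inv_mul_cancel₀ hn]
      · have : z - ((‖z‖⁻¹ : ℝ) : ℂ) * z = ((1 - ‖z‖⁻¹ : ℝ) : ℂ) * z := by push_cast; ring
        rw [this, norm_mul, Complex.norm_real, Real.norm_eq_abs, abs_of_nonpos]
        · field_simp; ring
        · have : 1 ≤ ‖z‖⁻¹ := (one_le_inv₀ (by positivity)).2 hz1.le
          linarith
  have := (convex_closedBall (0 : ℂ) 1).norm_image_sub_le_of_norm_fderivWithin_le
    (hY.differentiableOn (by norm_num)) hC (sphere_subset_closedBall hy)
    (ball_subset_closedBall hz)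
  rwa [hY0 y hy, sub_zero, hyz] at this

/-- Cutting a field which vanishes on the boundary off near the boundary creates little energy. -/
theorem tendsto_integral_dbarOn_cutoff_smul {Y : ℂ → Cn n} (hY : ContDiffOn ℝ 1 Y (closedBall 0 1))
    (hY0 : ∀ z ∈ sphere (0 : ℂ) 1, Y z = 0) {δ : ℕ → ℝ} (hδ : ∀ j, 0 < δ j)
    (hδ0 : Tendsto δ atTop (𝓝 0)) :
    Tendsto (fun j => ∫ z in ball (0 : ℂ) 1, ‖dbarOn (fun z => cutoff (δ j) z • Y z) z‖ ^ 2)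
      atTop (𝓝 0) := by
  obtain ⟨C₀, hC₀, hY1⟩ := exists_norm_le_one_sub hY hY0
  obtain ⟨C₁, hC₁, hS⟩ := exists_bound_deriv_smoothTransition
  have hdY : ContinuousOn (dbarOn Y) (closedBall 0 1) :=
    (contDiffOn_dbarOn (k := 0) hY (by norm_num)).continuousOn
  obtain ⟨C₂, hC₂⟩ := (isCompact_closedBall (0 : ℂ) 1).exists_bound_of_continuousOn hdY
  have hYd := hY.differentiableOn (by norm_num)
  have hbound : ∀ j, ∀ z ∈ ball (0 : ℂ) 1,
      ‖dbarOn (fun z => cutoff (δ j) z • Y z) z‖ ≤ C₁ * (2 * C₀) + C₂ := by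
    intro j z hz
    have hz' := ball_subset_closedBall hz
    have hz1 : ‖z‖ < 1 := mem_ball_zero_iff.1 hz
    rw [dbarOn_cutoff_smul hYd hz']
    have hcut : ‖cutoff (δ j) z • dbarOn Y z‖ ≤ C₂ := by
      rw [norm_smul, Real.norm_eq_abs, abs_of_nonneg (show 0 ≤ cutoff (δ j) z from Real.smoothTransition.nonneg _)]
      exact (mul_le_of_le_one_left (norm_nonneg _)
        (show cutoff (δ j) z ≤ 1 from Real.smoothTransition.le_one _)).trans
        (hC₂ z hz')
    refine (norm_add_le _ _).trans (add_le_add ?_ hcut)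
    -- Away from the layer the cutoff has zero derivative. In the layer 1 − |z| ≤ 1 − |z|² ≤ 2δ, and
    -- the decay of Y absorbs the factor 1/δ.
    rcases lt_or_ge (2 * δ j) (1 - ‖z‖ ^ 2) with h | h
    · have : 2 - (1 - ‖z‖ ^ 2) / δ j < 0 := by
        have : 2 < (1 - ‖z‖ ^ 2) / δ j := by rwa [lt_div_iff₀ (hδ j)]
        linarith
      rw [deriv_smoothTransition_of_neg this]
      simp only [zero_div, Complex.ofReal_zero, zero_smul, norm_zero]
      positivity
    · rw [norm_smul, norm_smul, Complex.norm_real, Real.norm_eq_abs, abs_div, abs_of_pos (hδ j)]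
      have h1 : ‖z‖ * ‖Y z‖ ≤ C₀ * (2 * δ j) := by
        calc ‖z‖ * ‖Y z‖ ≤ 1 * (C₀ * (1 - ‖z‖)) :=
              mul_le_mul hz1.le (hY1 z hz) (norm_nonneg _) zero_le_one
          _ ≤ C₀ * (2 * δ j) := by
              rw [one_mul]
              refine mul_le_mul_of_nonneg_left ?_ hC₀
              nlinarith [norm_nonneg z]
      calc |deriv Real.smoothTransition (2 - (1 - ‖z‖ ^ 2) / δ j)| / δ j * (‖z‖ * ‖Y z‖)
          ≤ C₁ / δ j * (C₀ * (2 * δ j)) := by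
            refine mul_le_mul (div_le_div_of_nonneg_right (hS _) (hδ j).le) h1 (by positivity) ?_
            exact div_nonneg hC₁ (hδ j).le
        _ = C₁ * (2 * C₀) := by
            have := (hδ j).ne'
            field_simp
  -- The integrands are uniformly bounded, and each fixed interior point eventually leaves the
  -- layer.
  have hlim := tendsto_integral_of_dominated_convergence (μ := volume.restrict (ball (0 : ℂ) 1))
    (F := fun j z => ‖dbarOn (fun z => cutoff (δ j) z • Y z) z‖ ^ 2) (f := fun _ => (0 : ℝ))
    (fun _ => (C₁ * (2 * C₀) + C₂) ^ 2) (fun j => ?_) ?_ (fun j => ?_) ?_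
  · simpa using hlim
  · have : ContDiffOn ℝ 1 (fun z => cutoff (δ j) z • Y z) (closedBall 0 1) :=
      ((contDiff_cutoff (δ j)).of_le (by simp)).contDiffOn.smul hY
    exact (((contDiffOn_dbarOn (k := 0) this (by norm_num)).continuousOn.mono
      ball_subset_closedBall).norm.pow 2).aestronglyMeasurable measurableSet_ball
  · exact integrableOn_const measure_ball_lt_top.ne
  · filter_upwards [ae_restrict_mem measurableSet_ball] with z hz
    rw [norm_pow, norm_norm]
    exact pow_le_pow_left₀ (norm_nonneg _) (hbound j z hz) 2
  · filter_upwards [ae_restrict_mem measurableSet_ball] with z hz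
    have hz1 : ‖z‖ < 1 := mem_ball_zero_iff.1 hz
    refine tendsto_const_nhds.congr' ?_
    have hev : ∀ᶠ j in atTop, δ j < (1 - ‖z‖ ^ 2) / 2 :=
      hδ0.eventually (gt_mem_nhds (by nlinarith [norm_nonneg z]))
    filter_upwards [hev] with j hj
    have h2 : 2 * δ j < 1 - ‖z‖ ^ 2 := by linarith
    have : 2 - (1 - ‖z‖ ^ 2) / δ j < 0 := by
      have : 2 < (1 - ‖z‖ ^ 2) / δ j := by rwa [lt_div_iff₀ (hδ j)]
      linarith
    rw [dbarOn_cutoff_smul hYd (ball_subset_closedBall hz), deriv_smoothTransition_of_neg this,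
      cutoff_eq_zero (hδ j) h2.le]
    simp

variable {N : Set (Cn n)} {f X V : ℂ → Cn n} {m : ℕ∞} {ρ : Cn n → ℝ} {r₀ δ₁ : ℝ}
variable (hm : 2 ≤ m) (hρ : IsDefiningFunction m ρ N) (hf : IsDisk N f)
  (hX : IsTransverse ρ f X r₀)

include hm hρ hf hX in
-- The quotient defining the coefficient is controlled only where X is transverse; the cutoff
-- vanishes near all other points. C¹ is what m ≥ 2 guarantees for dρ.
theorem contDiffOn_cutoff_transverseCoeff (hV : ContDiffOn ℝ ∞ V (closedBall 0 1)) (hδ : 0 < δ₁)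
    (hδr : 2 * δ₁ < 1 - r₀ ^ 2) :
    ContDiffOn ℝ 1 (fun z => (cutoff δ₁ z * transverseCoeff ρ f X V z) • X z)
      (closedBall 0 1) := by
  have hD : ContDiffOn ℝ 1 (fun z => fderiv ℝ ρ (f z)) (closedBall 0 1) :=
    (hρ.contDiff.fderiv_right (m := 1) (WithTop.coe_le_coe.2 hm)).comp_contDiffOn
      (hf.smooth.of_le (by simp))
  have hXs : ContDiffOn ℝ 1 X (closedBall 0 1) := (hX.contDiff.of_le (by simp)).contDiffOn
  intro z hz
  rcases lt_or_ge r₀ ‖z‖ with h | h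
  · refine ContDiffWithinAt.smul (ContDiffWithinAt.mul
      ((contDiff_cutoff δ₁).of_le (by simp)).contDiffWithinAt ?_) (hXs z hz)
    exact ((hD.clm_apply (hV.of_le (by simp))) z hz).div ((hD.clm_apply hXs) z hz)
      (hX.pos z hz h.le).ne'
  · have hcut : ∀ y : ℂ, 2 * δ₁ < 1 - ‖y‖ ^ 2 →
        (cutoff δ₁ y * transverseCoeff ρ f X V y) • X y = 0 := by
      intro y hy
      rw [cutoff_eq_zero hδ hy.le, zero_mul, zero_smul]
    have hz2 : 2 * δ₁ < 1 - ‖z‖ ^ 2 := by nlinarith [norm_nonneg z]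
    refine (contDiffWithinAt_const (c := (0 : Cn n))).congr_of_eventuallyEq ?_ (hcut z hz2)
    have hopen : IsOpen {y : ℂ | 2 * δ₁ < 1 - ‖y‖ ^ 2} :=
      isOpen_lt continuous_const (by fun_prop)
    filter_upwards [nhdsWithin_le_nhds (hopen.mem_nhds hz2)] with y hy
    exact hcut y hy

include hm hρ hf hX in
theorem tendsto_integral_dbarOn_tangentField (hV : ContDiffOn ℝ ∞ V (closedBall 0 1))
    (hVd : ∀ z ∈ ball (0 : ℂ) 1, dbarOn V z = 0)
    (hVt : ∀ z ∈ sphere (0 : ℂ) 1, fderiv ℝ ρ (f z) (V z) = 0) (hδ : 0 < δ₁)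
    (hδr : 2 * δ₁ < 1 - r₀ ^ 2) :
    Tendsto (fun j : ℕ => ∫ z in ball (0 : ℂ) 1,
      ‖dbarOn (tangentField ρ f X (δ₁ / (j + 2)) V) z‖ ^ 2) atTop (𝓝 0) := by
  let Y : ℂ → Cn n := fun z => (cutoff δ₁ z * transverseCoeff ρ f X V z) • X z
  have hY : ContDiffOn ℝ 1 Y (closedBall 0 1) :=
    contDiffOn_cutoff_transverseCoeff hm hρ hf hX hV hδ hδr
  have hY0 : ∀ z ∈ sphere (0 : ℂ) 1, Y z = 0 := by
    intro z hz
    simp [Y, transverseCoeff, hVt z hz]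
  have hδj : ∀ j : ℕ, 0 < δ₁ / (j + 2) := fun j => by positivity
  have hlim0 : Tendsto (fun j : ℕ => δ₁ / ((j : ℝ) + 2)) atTop (𝓝 0) :=
    tendsto_const_nhds.div_atTop
      (tendsto_natCast_atTop_atTop.atTop_add tendsto_const_nhds)
  refine (tendsto_integral_dbarOn_cutoff_smul hY hY0 hδj hlim0).congr fun j => ?_
  refine setIntegral_congr_fun measurableSet_ball fun z hz => ?_
  have hz' := ball_subset_closedBall hz
  -- The shrinking cutoff lives where 1 − |z|² < 2δ₁/(j + 2) ≤ δ₁, and there the fixed cutoff in Y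
  -- is 1. The shift by 2 makes this true from j = 0, and Y does not depend on j.
  have hfield : tangentField ρ f X (δ₁ / (j + 2)) V =
      fun z => V z - cutoff (δ₁ / (j + 2)) z • Y z := by
    funext y
    simp only [tangentField, Y, smul_smul]
    rcases le_or_gt (2 * (δ₁ / (j + 2))) (1 - ‖y‖ ^ 2) with h | h
    · rw [cutoff_eq_zero (hδj j) h]; simp
    · have h2 : 2 * (δ₁ / (j + 2)) ≤ δ₁ := by
        rw [mul_div_assoc', div_le_iff₀ (by positivity)]
        nlinarith [Nat.cast_nonneg (α := ℝ) j]
      rw [cutoff_eq_one (δ := δ₁) hδ (by linarith), one_mul]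
  have hYc : DifferentiableWithinAt ℝ (fun z => cutoff (δ₁ / (j + 2)) z • Y z)
      (closedBall 0 1) z :=
    (((contDiff_cutoff (δ₁ / (j + 2))).of_le (by simp)).contDiffOn.smul hY).differentiableOn
      (by norm_num) z hz'
  rw [hfield, dbarOn_sub hz' (hV.differentiableOn (by simp) z hz') hYc, hVd z hz, zero_sub,
    norm_neg]

end BoundaryLayer

/-! ### From positive boundary forms to the Morse index. -/

section Index

variable {n : ℕ} {N : Set (Cn n)} {f X : ℂ → Cn n} {m : ℕ∞} {ρ : Cn n → ℝ} {r₀ δ : ℝ}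

theorem dbarOn_sum_smul {ι : Type*} (s : Finset ι) {T : ι → ℂ → Cn n} (c : ι → ℝ) {z : ℂ}
    (hz : z ∈ closedBall (0 : ℂ) 1)
    (hT : ∀ i ∈ s, DifferentiableWithinAt ℝ (T i) (closedBall 0 1) z) :
    dbarOn (fun z => ∑ i ∈ s, c i • T i z) z = ∑ i ∈ s, c i • dbarOn (T i) z := by
  have h : HasFDerivWithinAt (fun z => ∑ i ∈ s, c i • T i z)
      (∑ i ∈ s, c i • fderivWithin ℝ (T i) (closedBall 0 1) z) (closedBall 0 1) z :=
    HasFDerivWithinAt.fun_sum fun i hi => (hT i hi).hasFDerivWithinAt.const_smul (c i)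
  simp only [dbarOn, h.fderivWithin (uniqueDiffOn_closedDisk z hz), sum_apply, smul_apply,
    Finset.smul_sum, ← Finset.sum_add_distrib]
  refine Finset.sum_congr rfl fun i _ => ?_
  rw [smul_comm Complex.I (c i), ← smul_add, smul_comm (1 / 2 : ℂ) (c i)]

/-- `tangentField` as a real linear map in the field. -/
def tangentFieldₗ (ρ : Cn n → ℝ) (f X : ℂ → Cn n) (δ : ℝ) : (ℂ → Cn n) →ₗ[ℝ] (ℂ → Cn n) where
  toFun := tangentField ρ f X δ
  map_add' U V := by
    funext z
    simp only [tangentField, transverseCoeff, Pi.add_apply, map_add]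
    module
  map_smul' a V := by
    funext z
    simp only [tangentField, transverseCoeff, Pi.smul_apply, map_smul, smul_eq_mul,
      RingHom.id_apply]
    module

theorem tangentField_sum_smul {ι : Type*} (s : Finset ι) (c : ι → ℝ) (V : ι → ℂ → Cn n) :
    tangentField ρ f X δ (fun z => ∑ i ∈ s, c i • V i z) =
      fun z => ∑ i ∈ s, c i • tangentField ρ f X δ (V i) z := by
  have h := map_sum (tangentFieldₗ ρ f X δ) (fun i => c i • V i) s
  have e : (∑ i ∈ s, c i • V i) = fun z => ∑ i ∈ s, c i • V i z := by
    funext z; simp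
  rw [e] at h
  refine h.trans ?_
  funext z
  simp only [map_smul, Finset.sum_apply, Pi.smul_apply]
  rfl

theorem norm_sum_smul_sq_le {ι E : Type*} [NormedAddCommGroup E] [NormedSpace ℝ E] (s : Finset ι)
    (c : ι → ℝ) (v : ι → E) :
    ‖∑ i ∈ s, c i • v i‖ ^ 2 ≤ (∑ i ∈ s, c i ^ 2) * ∑ i ∈ s, ‖v i‖ ^ 2 := by
  calc ‖∑ i ∈ s, c i • v i‖ ^ 2 ≤ (∑ i ∈ s, |c i| * ‖v i‖) ^ 2 := by
        refine pow_le_pow_left₀ (norm_nonneg _) ((norm_sum_le _ _).trans (le_of_eq ?_)) 2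
        simp only [norm_smul, Real.norm_eq_abs]
    _ ≤ _ := by
        have := Finset.sum_mul_sq_le_sq_mul_sq s (fun i => |c i|) fun i => ‖v i‖
        simpa only [sq_abs] using this

variable (hm : 2 ≤ m) (hρ : IsDefiningFunction m ρ N) (hf : IsDisk N f)
  (hX : IsTransverse ρ f X r₀)

include hm hρ hf hX in
theorem contDiffOn_tangentField {V : ℂ → Cn n} (hV : ContDiffOn ℝ ∞ V (closedBall 0 1))
    (hδ : 0 < δ) (hδr : 2 * δ < 1 - r₀ ^ 2) :
    ContDiffOn ℝ 1 (tangentField ρ f X δ V) (closedBall 0 1) :=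
  (hV.of_le (by simp)).sub (contDiffOn_cutoff_transverseCoeff hm hρ hf hX hV hδ hδr)

include hm hρ hf hX in
-- Cauchy–Schwarz reduces smallness of the correction energy on the whole span to smallness on
-- finitely many generators, so one δ serves all coefficients.
theorem integral_dbarOn_sum_tangentField_le {d : ℕ} {V : Fin d → ℂ → Cn n}
    (hV : ∀ i, ContDiffOn ℝ ∞ (V i) (closedBall 0 1)) (hδ : 0 < δ) (hδr : 2 * δ < 1 - r₀ ^ 2)
    {e : ℝ}
    (he : ∀ i, ∫ z in ball (0 : ℂ) 1, ‖dbarOn (tangentField ρ f X δ (V i)) z‖ ^ 2 ≤ e)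
    (c : Fin d → ℝ) :
    ∫ z in ball (0 : ℂ) 1, ‖dbarOn (tangentField ρ f X δ fun z => ∑ i, c i • V i z) z‖ ^ 2 ≤
      (∑ i, c i ^ 2) * (d * e) := by
  have hT := fun i => contDiffOn_tangentField hm hρ hf hX (hV i) hδ hδr
  have hint : ∀ i, IntegrableOn (fun z => ‖dbarOn (tangentField ρ f X δ (V i)) z‖ ^ 2)
      (ball (0 : ℂ) 1) := fun i =>
    integrableOn_disk ((contDiffOn_dbarOn (k := 0) (hT i) (by norm_num)).continuousOn.norm.pow 2)
  have hint' : IntegrableOn (fun z => ∑ i, ‖dbarOn (tangentField ρ f X δ (V i)) z‖ ^ 2)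
      (ball (0 : ℂ) 1) := integrable_finsetSum _ fun i _ => hint i
  calc _ ≤ ∫ z in ball (0 : ℂ) 1,
        (∑ i, c i ^ 2) * ∑ i, ‖dbarOn (tangentField ρ f X δ (V i)) z‖ ^ 2 := by
        refine integral_mono_of_nonneg (Eventually.of_forall fun z => by positivity)
          (hint'.const_mul _) ?_
        filter_upwards [ae_restrict_mem measurableSet_ball] with z hz
        have hz' := ball_subset_closedBall hz
        rw [tangentField_sum_smul, dbarOn_sum_smul _ _ hz' fun i _ =>
          (hT i).differentiableOn (by norm_num) z hz']
        exact norm_sum_smul_sq_le _ _ _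
    _ = (∑ i, c i ^ 2) * ∑ i, ∫ z in ball (0 : ℂ) 1,
          ‖dbarOn (tangentField ρ f X δ (V i)) z‖ ^ 2 := by
        rw [integral_const_mul, integral_finsetSum _ fun i _ => hint i]
    _ ≤ _ := by
        refine mul_le_mul_of_nonneg_left ?_ (Finset.sum_nonneg fun i _ => sq_nonneg _)
        refine (Finset.sum_le_sum fun i _ => he i).trans (le_of_eq ?_)
        simp

include hm hρ hf hX in
/-- A space of `∂̄`-closed fields, tangent along the boundary, on which the boundary term of the
second variation is positive, bounds the Morse index from below. -/
theorem le_morseIndex_of_circleInt (hcrit : IsCritical m N f) {d : ℕ} {V : Fin d → ℂ → Cn n}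
    (hV : ∀ i, ContDiffOn ℝ ∞ (V i) (closedBall 0 1))
    (hVd : ∀ i, ∀ z ∈ ball (0 : ℂ) 1, dbarOn (V i) z = 0)
    (hVt : ∀ i, ∀ z ∈ sphere (0 : ℂ) 1, fderiv ℝ ρ (f z) (V i z) = 0) {c₀ : ℝ} (hc₀ : 0 < c₀)
    (hpos : ∀ c : Fin d → ℝ, c₀ * ∑ i, c i ^ 2 ≤ circleInt fun z => multiplier ρ f X z *
      fderiv ℝ (fderiv ℝ ρ) (f z) (∑ i, c i • V i z) (∑ i, c i • V i z)) :
    (d : ℕ∞) ≤ morseIndex m N f := by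
  have hr0 : 0 < 1 - r₀ ^ 2 := by nlinarith [hX.nonneg, hX.lt_one]
  obtain ⟨δ, hδ, hδr, hsmall⟩ : ∃ δ : ℝ, 0 < δ ∧ 2 * δ < 1 - r₀ ^ 2 ∧ ∀ i,
      ∫ z in ball (0 : ℂ) 1, ‖dbarOn (tangentField ρ f X δ (V i)) z‖ ^ 2 ≤
        c₀ / (4 * (d + 1)) := by
    have h1 : ∀ᶠ j : ℕ in atTop, ∀ i, ∫ z in ball (0 : ℂ) 1,
        ‖dbarOn (tangentField ρ f X ((1 - r₀ ^ 2) / 3 / (j + 2)) (V i)) z‖ ^ 2 <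
          c₀ / (4 * (d + 1)) :=
      eventually_all.2 fun i => (tendsto_integral_dbarOn_tangentField hm hρ hf hX (hV i) (hVd i)
        (hVt i) (by positivity) (by linarith)).eventually (gt_mem_nhds (by positivity))
    obtain ⟨j, hj⟩ := h1.exists
    refine ⟨(1 - r₀ ^ 2) / 3 / (j + 2), by positivity, ?_, fun i => (hj i).le⟩
    have : (1 - r₀ ^ 2) / 3 / ((j : ℝ) + 2) ≤ (1 - r₀ ^ 2) / 3 :=
      div_le_self (by positivity) (by linarith [Nat.cast_nonneg (α := ℝ) j])
    linarith
  let T : (Fin d → ℝ) →ₗ[ℝ] (closedBall (0 : ℂ) 1 → Cn n) :=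
    (LinearMap.funLeft ℝ (Cn n) (Subtype.val : closedBall (0 : ℂ) 1 → ℂ)) ∘ₗ
      tangentFieldₗ ρ f X δ ∘ₗ Fintype.linearCombination ℝ V
  have hT : ∀ (c : Fin d → ℝ) (z : closedBall (0 : ℂ) 1),
      T c z = tangentField ρ f X δ (fun z => ∑ i, c i • V i z) z := by
    intro c z
    have : Fintype.linearCombination ℝ V c = fun z => ∑ i, c i • V i z := by
      funext z; simp [Fintype.linearCombination_apply]
    change tangentField ρ f X δ (Fintype.linearCombination ℝ V c) z = _
    rw [this]
  -- Tangency makes the correction vanish on the circle, so the boundary term is unaffected by δ.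
  have hbdry : ∀ (c : Fin d → ℝ), ∀ z ∈ sphere (0 : ℂ) 1,
      tangentField ρ f X δ (fun z => ∑ i, c i • V i z) z = ∑ i, c i • V i z := by
    intro c z hz
    have : fderiv ℝ ρ (f z) (∑ i, c i • V i z) = 0 := by
      simp [hVt _ z hz]
    simp [tangentField, transverseCoeff, hVt _ z hz]
  have hsq : ∀ c : Fin d → ℝ, c ≠ 0 → 0 < ∑ i, c i ^ 2 := by
    intro c hc
    obtain ⟨i, hi⟩ := Function.ne_iff.1 hc
    exact Finset.sum_pos' (fun i _ => sq_nonneg _) ⟨i, Finset.mem_univ i, sq_pos_of_ne_zero hi⟩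
  have hinj : Function.Injective T := by
    rw [injective_iff_map_eq_zero]
    intro c hTc
    by_contra hc
    -- Positivity of the form already separates boundary values, so the corrected fields remain
    -- independent.
    have h0 : ∀ z ∈ sphere (0 : ℂ) 1, ∑ i, c i • V i z = 0 := by
      intro z hz
      rw [← hbdry c z hz, ← hT c ⟨z, sphere_subset_closedBall hz⟩, hTc]
      rfl
    have h := hpos c
    rw [circleInt_congr (v := fun _ => 0) fun z hz => by
      simp only [h0 z hz, map_zero, mul_zero]] at h
    simp only [circleInt, intervalIntegral.integral_zero] at h
    exact absurd (mul_pos hc₀ (hsq c hc)) (not_lt.2 h)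
  have hneg : IsNegativeDefiniteOn m N f (LinearMap.range T) := by
    rintro _ ⟨c, rfl⟩ hc0
    have hc : c ≠ 0 := by rintro rfl; exact hc0 (map_zero T)
    have hVc : ContDiffOn ℝ ∞ (fun z => ∑ i, c i • V i z) (closedBall 0 1) :=
      ContDiffOn.sum fun i _ => (hV i).const_smul (c i)
    refine ⟨?_, fun ε F hF hFV => ?_⟩
    · obtain ⟨ε, F, hF, hFV⟩ := exists_variation_tangentField hm hρ hf hX hVc hδ hδr
      refine ⟨ε, F, hF, ?_⟩
      funext z
      rw [hT]
      exact hFV z z.2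
    · rw [hF.second_variation_eq hm hρ hf hX hcrit
        (V := tangentField ρ f X δ fun z => ∑ i, c i • V i z)
        fun z hz => (congrFun hFV ⟨z, hz⟩).trans (hT c ⟨z, hz⟩),
        circleInt_congr (v := fun z => multiplier ρ f X z *
          fderiv ℝ (fderiv ℝ ρ) (f z) (∑ i, c i • V i z) (∑ i, c i • V i z)) fun z hz => by
          simp only [hbdry c z hz]]
      have h1 := integral_dbarOn_sum_tangentField_le hm hρ hf hX hV hδ hδr hsmall c
      have h2 := hpos c
      have h3 := hsq c hc
      -- The second variation is then at most 2(c₀/4)∑c_i² − c₀∑c_i² = −(c₀/2)∑c_i².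
      have h4 : (d : ℝ) * (c₀ / (4 * (d + 1))) ≤ c₀ / 4 := by
        rw [mul_div_assoc', div_le_div_iff₀ (by positivity) (by positivity)]
        nlinarith
      have h5 := mul_le_mul_of_nonneg_left h4 h3.le
      have h6 := mul_pos hc₀ h3
      nlinarith
  have hrank : Cardinal.toENat (Module.rank ℝ (LinearMap.range T)) = d := by
    rw [rank_range_of_injective T hinj]
    simp
  rw [← hrank]
  exact le_iSup₂ (f := fun (S : Submodule ℝ (closedBall (0 : ℂ) 1 → Cn n))
    (_ : IsNegativeDefiniteOn m N f S) => Cardinal.toENat (Module.rank ℝ S)) _ hneg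

end Index

end DbarDisk

end

/-! ### The index bound. -/

theorem mainTheorem2 (n k : ℕ) (hk : 1 ≤ k) (m : ℕ∞) (hm : 2 ≤ m)
    (N : Set (DbarDisk.Cn n)) (hN : DbarDisk.IsStrictlyKPseudoconvex m k N)
    (f : ℂ → DbarDisk.Cn n) (hf : DbarDisk.IsDisk N f)
    (hcrit : DbarDisk.IsCritical m N f)
    (hnonhol : ¬ DifferentiableOn ℂ f (Metric.ball 0 1)) :
    ((n - k : ℕ) : ℕ∞) ≤ DbarDisk.morseIndex m N f := by
  open DbarDisk Set Metric in
  rcases Nat.lt_or_ge k n with hkn | hkn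
  swap
  -- For k ≥ n the truncated difference is 0 and nothing is claimed.
  · simp [Nat.sub_eq_zero_of_le hkn]
  obtain ⟨ρ, hρ, hpsc⟩ := hN
  obtain ⟨X, hXs, r₀, h0, h1, hXp⟩ := exists_transverse hm hρ hf
  have hX : IsTransverse ρ f X r₀ := ⟨hXs, h0, h1, hXp⟩
  obtain ⟨z₀, hz₀, hμ⟩ := exists_multiplier_pos hm hρ hf hX hcrit hnonhol
  obtain ⟨w, hw, hw'⟩ := exists_leviForm_pos hm hρ hf hX hcrit hkn hz₀ hμ.ne'
    (hpsc _ (hf.mapsTo_boundary hz₀))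
  have hc : dbarOn f z₀ ≠ 0 := dbarOn_ne_zero_of_multiplier hμ.ne'
  set c := dbarOn f z₀ with hcdef
  have hO : ContinuousOn (orthogonalField f c w) (sphere 0 1) :=
    (contDiffOn_orthogonalField hf c w).continuousOn.mono sphere_subset_closedBall
  have hD2 : ContinuousOn (fun z => fderiv ℝ (fderiv ℝ ρ) (f z)) (sphere 0 1) := by
    have h2 : ContDiff ℝ 1 (fderiv ℝ ρ) :=
      hρ.contDiff.fderiv_right (m := 1) (WithTop.coe_le_coe.2 hm)
    exact (h2.continuous_fderiv (by simp)).comp_continuousOn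
      (hf.smooth.continuousOn.mono sphere_subset_closedBall)
  have hI : ContinuousOn (fun z => Complex.I • orthogonalField f c w z) (sphere 0 1) :=
    (continuous_const_smul Complex.I).comp_continuousOn hO
  have hμc : ContinuousOn (multiplier ρ f X) (sphere 0 1) := continuousOn_multiplier hm hρ hf hX
  have hlevi : ContinuousOn (fun z => leviForm ρ (f z) (orthogonalField f c w z)) (sphere 0 1) :=
    ((((hD2.clm_apply hO).clm_apply hO).add ((hD2.clm_apply hI).clm_apply hI)).div_const 4)
  have hsym : ContinuousOn (fun z => symmetricHessian ρ (f z) (orthogonalField f c w z))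
      (sphere 0 1) :=
    (Complex.continuous_ofReal.comp_continuousOn
      ((((hD2.clm_apply hO).clm_apply hO).sub ((hD2.clm_apply hI).clm_apply hI)).div_const
        2)).sub (continuousOn_const.mul (Complex.continuous_ofReal.comp_continuousOn
          ((hD2.clm_apply hO).clm_apply hI)))
  have hpos : 0 < 2 * multiplier ρ f X z₀ * leviForm ρ (f z₀) (orthogonalField f c w z₀) := by
    -- At z₀ the second coefficient ⟨c, w⟩ vanishes and the first is |c|², so the Levi form there is
    -- that of w times a positive factor.
    have e : orthogonalField f c w z₀ = ((‖c‖ ^ 2 : ℝ) : ℂ) • w := by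
      rw [orthogonalField, ← hcdef, hw, zero_smul, sub_zero, inner_self_eq_norm_sq_to_K]
      norm_cast
    rw [e, leviForm_smul]
    have := norm_pos_iff.2 hc
    positivity
  obtain ⟨h, hh, c₀, hc₀, hbound⟩ := exists_holomorphic_pos
    (w := fun z => 2 * multiplier ρ f X z * leviForm ρ (f z) (orthogonalField f c w z))
    (κ := fun z => (multiplier ρ f X z : ℂ) *
      symmetricHessian ρ (f z) (orthogonalField f c w z))
    ((continuousOn_const.mul hμc).mul hlevi)
    ((Complex.continuous_ofReal.comp_continuousOn hμc).mul hsym) hz₀ hpos (n - k)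
  refine le_morseIndex_of_circleInt hm hρ hf hX hcrit
    (V := fun i z => h i z • orthogonalField f c w z) (fun i => ?_) (fun i z hz => ?_)
    (fun i z hz => ?_) hc₀ fun a => ?_
  · exact ((hh i).contDiff.restrict_scalars ℝ).contDiffOn.smul (contDiffOn_orthogonalField hf c w)
  · exact dbarOn_smul_orthogonalField hf
      (fun z hz => delOn_dbarOn_eq_zero hm hρ hf hX hcrit hz) c w (hh i) hz
  · exact fderiv_smul_orthogonalField hm hρ hf hX hcrit c w _ hz
  · refine (hbound a).trans (le_of_eq (circleInt_congr fun z _ => ?_))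
    have e : ∑ i, a i • h i z • orthogonalField f c w z =
        (∑ i, (a i : ℂ) * h i z) • orthogonalField f c w z := by
      rw [Finset.sum_smul]
      refine Finset.sum_congr rfl fun i _ => ?_
      rw [mul_smul, Complex.coe_smul]
    simp only [e]
    rw [hessian_smul_smul hm hρ.contDiff]
    generalize (∑ i, (a i : ℂ) * h i z) = s
    have e2 : s * s * ((multiplier ρ f X z : ℂ) *
        symmetricHessian ρ (f z) (orthogonalField f c w z)) = (multiplier ρ f X z : ℂ) *
          (s * s * symmetricHessian ρ (f z) (orthogonalField f c w z)) := by ring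
    rw [e2, Complex.re_ofReal_mul]
    ring
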